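/- **Theorem 3.5.** Let $\rho,r\ge 0$ with $r+\frac{\rho}{2}\ge 1$ and $(\rho,r)\ne(0,1)$, let $p>1$, and put $s_0=\frac r2+\frac\rho2$, $g(u)=-|u|^{p-1}u$. Let $L$ and $B$ be the Fourier multiplier operators on $\mathbb{R}$ with smooth, real, even symbols $l(\xi)$ and $b(\xi)$, and suppose that there are constants $c_1,c_2,c_3,c_4>0$ with $$c_1^2(1+\xi^2)^{\rho/2}\le l(\xi)\le c_2^2(1+\xi^2)^{\rho/2},\qquad c_3^2(1+\xi^2)^{-r/2}\le b(\xi)\le c_4^2(1+\xi^2)^{-r/2}\qquad(\xi\in\mathbb{R}).$$ All functions are real-valued, and $H^s=H^s(\mathbb R)$ has the norm $\|f\|_{H^s}^2=\int_{\mathbb R}(1+\xi^2)^s|\widehat f(\xi)|^2\,d\xi$. For $u\in H^{s_0}$ and $w\in H^{s_0-\rho/2}$ let $$\mathcal I(u)=\tfrac12\int_{\mathbb R}(B^{-1/2}L^{1/2}u)^2dx,\qquad \mathcal Q(u)=\int_{\mathbb R}|u|^{p+1}dx,\qquad \mathcal E(u,w)=\tfrac12\|B^{-1/2}w\|_{L^2}^2+\mathcal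 I(u)-\tfrac1{p+1}\mathcal Q(u),$$ $$d=\inf\{\mathcal E(u,w):(u,w)\in H^{s_0}\times H^{s_0-\rho/2},\ u\ne0,\ 2\mathcal I(u)-\mathcal Q(u)=0\},$$ $$\Sigma_-=\{(u,w)\in H^{s_0}\times H^{s_0-\rho/2}:\ \mathcal E(u,w)<d,\ 2\mathcal I(u)-\mathcal Q(u)<0\}.$$ Let $(u_0,w_0)\in\Sigma_-$, and suppose that $u_0=(v_0)_x$ in the sense of distributions for some $v_0\in L^2(\mathbb R)$. Then the solution of the Cauchy problem $$u_t=w_x,\qquad w_t=Lu_x+B(g(u))_x,\qquad u(x,0)=u_0(x),\quad w(x,0)=w_0(x)$$ blows up in finite time. That is, there is $T_{\max}\in(0,\infty)$ such that the problem has a solution $(u,w)\in C([0,T_{\max}),H^{s_0})\times C([0,T_{\max}),H^{s_0-\rho/2})$ with $$\lim_{t\to T_{\max}^-}\left[\|u(t)\|_{H^{s_0}}+\|w(t)\|_{H^{s_0-\rho/2}}\right]=\infty,$$ and every solution with the same data in $C([0,T'),H^{s_0})\times C([0,T'),H^{s_0-\rho/2})$, $0<T'<\infty$, satisfies $T'\le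 T_{\max}$ and coincides with $(u,w)$ on $[0,T')$. Here the differential equations are understood in the sense of distributions. -/

import Mathlib

open MeasureTheory Filter Set
open scoped Topology ContDiff FourierTransform SchwartzMap

namespace NonlocalWave

noncomputable section

/-- The real Lebesgue space `L²(ℝ)`. -/
abbrev L2R := Lp ℝ 2 (volume : Measure ℝ)

/-- The complex Lebesgue space `L²(ℝ; ℂ)`. -/
abbrev L2C := Lp ℂ 2 (volume : Measure ℝ)

/-- A real-valued `L²` function regarded as a complex-valued one. -/
def toComplex (f : L2R) : L2C := Complex.ofRealCLM.compLp f

/-- The Fourier transform `f̂(ξ) = ∫ f(x) e^{-iξx} dx` of a real `L²` function. Mathlib's `𝓕` is the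
`L²` Fourier transform with kernel `e^{-2πiηx}`, so that `f̂(ξ) = (𝓕 f)(ξ / (2π))`. -/
def hat (f : L2R) (ξ : ℝ) : ℂ := (𝓕 (toComplex f) : L2C) (ξ / (2 * Real.pi))

/-- Membership in the Sobolev space `H^s(ℝ)` of real-valued functions (used only for `s ≥ 0`, where
`H^s(ℝ) ⊆ L²(ℝ)`). -/
def MemH (s : ℝ) (f : L2R) : Prop :=
  Integrable (fun ξ : ℝ => (1 + ξ ^ 2) ^ s * ‖hat f ξ‖ ^ 2)

/-- The Sobolev norm, `‖f‖²_{H^s} = ∫ (1 + ξ²)^s |f̂(ξ)|² dξ`. -/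
def normH (s : ℝ) (f : L2R) : ℝ :=
  Real.sqrt (∫ ξ : ℝ, (1 + ξ ^ 2) ^ s * ‖hat f ξ‖ ^ 2)

open Classical in
/-- The Fourier multiplier operator with real symbol `a`, `(a(D) f)^(ξ) = a(ξ) f̂(ξ)`, on those
complex `L²` functions for which the right-hand side is in `L²` (and `0` on the others).
In Mathlib's frequency variable `η = ξ / (2π)` the symbol is `a(2πη)`. -/
def multC (a : ℝ → ℝ) (f : L2C) : L2C :=
  if h : MemLp (fun η : ℝ => ((a (2 * Real.pi * η) : ℝ) : ℂ) * (𝓕 f : L2C) η) 2 volume then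
    (𝓕⁻ (h.toLp _) : L2C)
  else 0

/-- The Fourier multiplier operator with symbol `a` on real-valued `L²` functions. For an even
real symbol `a` the operator maps real-valued functions to real-valued functions, so that taking
the real part only changes the type. -/
def mult (a : ℝ → ℝ) (f : L2R) : L2R := Complex.reCLM.compLp (multC a (toComplex f))

/-- A smooth, real, even symbol `a` that is elliptic and coercive of order `k`:
`c² (1 + ξ²)^{k/2} ≤ a(ξ) ≤ C² (1 + ξ²)^{k/2}`. Evenness says that the operator `a(D)` preserves
real-valued functions. -/
structure IsEllipticSymbol (k : ℝ) (a : ℝ → ℝ) : Prop where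
  smooth : ContDiff ℝ ∞ a
  even : ∀ ξ, a (-ξ) = a ξ
  bounds : ∃ c > 0, ∃ C > 0, ∀ ξ : ℝ,
    c ^ 2 * (1 + ξ ^ 2) ^ (k / 2) ≤ a ξ ∧ a ξ ≤ C ^ 2 * (1 + ξ ^ 2) ^ (k / 2)

/-- The exponent `s₀ = r/2 + ρ/2` of the energy space `H^{s₀}(ℝ) × H^{s₀ - ρ/2}(ℝ)`. -/
def s₀ (ρ r : ℝ) : ℝ := r / 2 + ρ / 2

/-- The nonlinearity `g(u) = -|u|^{p-1} u`. -/
def g (p : ℝ) (y : ℝ) : ℝ := -(|y| ^ (p - 1) * y)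

/-- The operator `B^{-1/2}`, where `B` has symbol `b`. -/
def BInvSqrt (b : ℝ → ℝ) (f : L2R) : L2R := mult (fun ξ => (b ξ) ^ (-(1 / 2) : ℝ)) f

/-- The operator `B^{-1/2} L^{1/2}`, where `B` and `L` have symbols `b` and `l`. -/
def BInvSqrtLSqrt (l b : ℝ → ℝ) (f : L2R) : L2R :=
  mult (fun ξ => (b ξ) ^ (-(1 / 2) : ℝ) * (l ξ) ^ (1 / 2 : ℝ)) f

/-- `I(u) = ½ ∫ (B^{-1/2} L^{1/2} u)² dx`. -/
def I (l b : ℝ → ℝ) (u : L2R) : ℝ := 1 / 2 * ∫ x : ℝ, (BInvSqrtLSqrt l b u x) ^ 2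

/-- `Q(u) = ∫ |u|^{p+1} dx`. -/
def Q (p : ℝ) (u : L2R) : ℝ := ∫ x : ℝ, |u x| ^ (p + 1)

/-- The energy
`E(u,w) = ½ ‖B^{-1/2} w‖² + ½ ‖B^{-1/2} L^{1/2} u‖² - (1/(p+1)) ‖u‖_{L^{p+1}}^{p+1}`. -/
def energy (l b : ℝ → ℝ) (p : ℝ) (u w : L2R) : ℝ :=
  1 / 2 * ‖BInvSqrt b w‖ ^ 2 + 1 / 2 * ‖BInvSqrtLSqrt l b u‖ ^ 2 - 1 / (p + 1) * Q p u

/-- The critical energy constant (depth of the potential well). For elliptic symbols and `p > 1` the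
set is nonempty and consists of nonnegative numbers. -/
def depth (ρ r : ℝ) (l b : ℝ → ℝ) (p : ℝ) : ℝ :=
  sInf {e : ℝ | ∃ u w : L2R, MemH (s₀ ρ r) u ∧ MemH (s₀ ρ r - ρ / 2) w ∧ u ≠ 0 ∧
    2 * I l b u - Q p u = 0 ∧ e = energy l b p u w}

/-- The set `Σ₋`. -/
def SigmaMinus (ρ r : ℝ) (l b : ℝ → ℝ) (p : ℝ) : Set (L2R × L2R) :=
  {z | MemH (s₀ ρ r) z.1 ∧ MemH (s₀ ρ r - ρ / 2) z.2 ∧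
    energy l b p z.1 z.2 < depth ρ r l b p ∧ 2 * I l b z.1 - Q p z.1 < 0}

/-- A Schwartz function as an element of `L²(ℝ)`. -/
def testL2 (φ : 𝓢(ℝ, ℝ)) : L2R := φ.toLp 2 volume

/-- The derivative `φ_x` of a Schwartz function as an element of `L²(ℝ)`. -/
def testDeriv (φ : 𝓢(ℝ, ℝ)) : L2R := testL2 (SchwartzMap.derivCLM ℝ ℝ φ)

/-- `u = v_x` in the sense of distributions. -/
def IsWeakDeriv (v u : L2R) : Prop :=
  ∀ φ : 𝓢(ℝ, ℝ), inner ℝ u (testL2 φ) = -inner ℝ v (testDeriv φ)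

/-- `u ∈ C([0,T), H^s(ℝ))`. -/
def ContinuousInH (s T : ℝ) (u : ℝ → L2R) : Prop :=
  (∀ t ∈ Ico 0 T, MemH s (u t)) ∧
    ∀ t ∈ Ico 0 T, Tendsto (fun τ => normH s (u τ - u t)) (𝓝[Ico 0 T] t) (𝓝 0)

/-- `(u,w)` is a solution on `[0,T)`, in the energy space, of
`u_t = w_x`, `w_t = L u_x + B (g(u))_x`, `u(0) = u₀`, `w(0) = w₀`.
The equations hold in the sense of distributions in `x` for every `0 < t < T`: they are tested with
every Schwartz function `φ`, and the `x`-derivatives and the symmetric operators `L`, `B` (symbols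
`l`, `b`) are moved to `φ`. -/
structure IsSolution (ρ r : ℝ) (l b : ℝ → ℝ) (p : ℝ) (u₀ w₀ : L2R) (T : ℝ) (u w : ℝ → L2R) :
    Prop where
  cont_u : ContinuousInH (s₀ ρ r) T u
  cont_w : ContinuousInH (s₀ ρ r - ρ / 2) T w
  init_u : u 0 = u₀
  init_w : w 0 = w₀
  eq_u : ∀ φ : 𝓢(ℝ, ℝ), ∀ t ∈ Ioo 0 T,
    HasDerivAt (fun τ => (inner ℝ (u τ) (testL2 φ) : ℝ)) (-inner ℝ (w t) (testDeriv φ)) t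
  eq_w : ∀ φ : 𝓢(ℝ, ℝ), ∀ t ∈ Ioo 0 T,
    HasDerivAt (fun τ => (inner ℝ (w τ) (testL2 φ) : ℝ))
      (-inner ℝ (u t) (mult l (testDeriv φ))
        - ∫ x : ℝ, g p (u t x) * mult b (testDeriv φ) x) t

/-- The solution of the Cauchy problem with data `(u₀,w₀)` blows up in finite time: there is a
solution on some `[0,T)` with `0 < T < ∞` whose norm in the energy space tends to infinity as
`t → T⁻`, and it is the solution: every solution with these data, on any interval `[0,T')`, has
`T' ≤ T` and is a restriction of it. -/
def BlowsUpInFiniteTime (ρ r : ℝ) (l b : ℝ → ℝ) (p : ℝ) (u₀ w₀ : L2R) : Prop :=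
  ∃ (T : ℝ) (u w : ℝ → L2R), 0 < T ∧ IsSolution ρ r l b p u₀ w₀ T u w ∧
    Tendsto (fun t => normH (s₀ ρ r) (u t) + normH (s₀ ρ r - ρ / 2) (w t)) (𝓝[<] T) atTop ∧
    ∀ (T' : ℝ) (u' w' : ℝ → L2R), 0 < T' → IsSolution ρ r l b p u₀ w₀ T' u' w' →
      T' ≤ T ∧ ∀ t ∈ Ico 0 T', u' t = u t ∧ w' t = w t

end

end NonlocalWave

namespace NonlocalWave

noncomputable section

/-! ### The Fourier transform of real square integrable functions -/

/-! Write M = (B⁻¹L)^{-1/2} and N = B^{1/2}, and substitute u = M a, w = N c. The energy space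
becomes L² × L², and with ω(ξ) = ξ l(ξ)^{1/2} the system becomes a_t = iω(D) c, c_t = iω(D) a +
G(a), where G(a) = ∂ₓB^{1/2} g(M a). Moreover 2I(u) = ‖a‖², and the energy is ½‖c‖² + ½‖a‖² - Q(M
a)/(p+1).

Blow-up is Levine's concavity argument (`not_global`). Since u₀ = (v₀)ₓ, the function q₀ = B^{-1/2}
v₀ lies in L² and iω(D) q₀ = a₀ (`exists_primitive`), so q(t) = q₀ + ∫₀ᵗ c satisfies q' = c and
iω(D) q = a. For H = ‖q‖² one finds H' = 2⟨c, q⟩ and H'' = 2(‖c‖² - ‖a‖² + Q(M a)). Scaling onto the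
set 2I = Q gives d ≤ (p-1)/(2(p+1)) ‖a‖² wherever ‖a‖² < Q (`depth_le_of_lt`). This inequality
together with conservation of energy makes the unstable set invariant (`unstable_invariant`), and
then H'' ≥ (p+3)‖c‖² + 2(p+1)(d - E). By Cauchy–Schwarz H H'' ≥ (1 + (p-1)/4) H'², and H'' is
bounded below by a positive constant. No such H exists for all time (`not_global_of_concave`).

Well-posedness meets the difficulty that g is only C¹, so G is not known to be locally Lipschitz on
L². It is locally bounded there: superposition with a Lipschitz function is bounded on H^σ for 0 < σ
≤ 1 (difference quotients), and ∂ₓB^{1/2} has order 1 - r/2 ≤ s₀ (`exists_nonlin`). It is locally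
Lipschitz in the weaker norm ‖M a‖, because M ∂ₓB^{1/2} = ∂ₓ B L^{-1/2} has a bounded symbol when r
+ ρ/2 ≥ 1. A fixed point in the weak norm, on a set bounded in the strong norm, gives mild solutions
(`exists_isMild`). Boundedness of M a (`sobolev`) allows g to be truncated. Distributional solutions
are mild, by frequency cutoffs and skew-adjointness (`eq_zero_of_weak`, `isMild_of_isSolution`).

G(a(t)) is only weakly continuous in time, so the energy identity is obtained without strong
derivatives: Duhamel profiles are Lipschitz and weakly differentiable (`hasDerivAt_norm_sq_duh`),
and the quadratic Taylor remainder of Q is controlled by the skewness of ∂ₓB^{1/2}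
(`hasDerivAt_Q_mild`). The same identity bounds the growth of the norm, so at a finite maximal time
the full energy norm tends to infinity (`tendsto_norm_of_maximal`). -/

/-- The `L²` Fourier transform (in Mathlib's normalization) of a real function. -/
def Fhat (f : L2R) : L2C := 𝓕 (toComplex f)

lemma toComplex_ae (f : L2R) : toComplex f =ᵐ[volume] fun x => (f x : ℂ) :=
  Complex.ofRealCLM.coeFn_compLp f

lemma continuous_fourierIntegral {G : ℝ → ℂ} (hG : Integrable G) : Continuous (𝓕 G) :=
  VectorFourier.fourierIntegral_continuous Real.continuous_fourierChar
    (innerSL ℝ).continuous₂ hG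

lemma continuous_fourierInvIntegral {G : ℝ → ℂ} (hG : Integrable G) : Continuous (𝓕⁻ G) := by
  have h : (𝓕⁻ G) = fun x => 𝓕 G (-x) := funext fun x => Real.fourierInv_eq_fourier_neg G x
  rw [h]
  exact (continuous_fourierIntegral hG).comp continuous_neg

lemma integral_fourier_flip {G φ : ℝ → ℂ} (hG : Integrable G) (hφ : Integrable φ) :
    ∫ x, 𝓕 G x * φ x = ∫ x, G x * 𝓕 φ x := by
  simpa using! VectorFourier.integral_fourierIntegral_smul_eq_flip (L := innerₗ ℝ)
    Real.continuous_fourierChar continuous_inner hG hφ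

/-- The `L²` Fourier transform of an integrable function is given by the Fourier integral. -/
lemma fourier_ae_eq (G : L2C) (hG : Integrable (G : ℝ → ℂ)) :
    (𝓕 G : L2C) =ᵐ[volume] 𝓕 (G : ℝ → ℂ) := by
  -- Both sides are compared as distributions: each moves its Fourier transform onto a smooth
  -- compactly supported, hence Schwartz, test function.
  refine ae_eq_of_integral_contDiff_smul_eq
    ((Lp.memLp (𝓕 G : L2C)).locallyIntegrable (by norm_num))
    (continuous_fourierIntegral hG).locallyIntegrable fun φ hφ hc => ?_
  have hφ' : ContDiff ℝ ∞ (fun x => (φ x : ℂ)) := Complex.ofRealCLM.contDiff.comp hφ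
  have hc' : HasCompactSupport (fun x => (φ x : ℂ)) := hc.comp_left (g := fun y : ℝ => (y : ℂ)) (by simp)
  set ψ : 𝓢(ℝ, ℂ) := hc'.toSchwartzMap hφ' with hψ
  have hψx : ∀ x, ψ x = (φ x : ℂ) := fun x => rfl
  have h1 := congrArg (fun T => T ψ) (Lp.fourier_toTemperedDistribution_eq G)
  simp only [TemperedDistribution.fourier_apply, Lp.toTemperedDistribution_apply, smul_eq_mul] at h1
  calc ∫ x, φ x • (𝓕 G : L2C) x = ∫ x, ψ x * (𝓕 G : L2C) x := by
        simp [hψx]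
    _ = ∫ x, 𝓕 ψ x * G x := h1.symm
    _ = ∫ x, G x * 𝓕 (ψ : ℝ → ℂ) x := by
        simp_rw [SchwartzMap.fourier_coe, mul_comm]
    _ = ∫ x, 𝓕 (G : ℝ → ℂ) x * ψ x := (integral_fourier_flip hG ψ.integrable).symm
    _ = ∫ x, φ x • 𝓕 (G : ℝ → ℂ) x := by simp [hψx, mul_comm]

lemma fourierInv_ae_eq (G : L2C) (hG : Integrable (G : ℝ → ℂ)) :
    (𝓕⁻ G : L2C) =ᵐ[volume] 𝓕⁻ (G : ℝ → ℂ) := by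
  refine ae_eq_of_integral_contDiff_smul_eq
    ((Lp.memLp (𝓕⁻ G : L2C)).locallyIntegrable (by norm_num))
    (continuous_fourierInvIntegral hG).locallyIntegrable fun φ hφ hc => ?_
  have hφ' : ContDiff ℝ ∞ (fun x => (φ x : ℂ)) := Complex.ofRealCLM.contDiff.comp hφ
  have hc' : HasCompactSupport (fun x => (φ x : ℂ)) := hc.comp_left (g := fun y : ℝ => (y : ℂ)) (by simp)
  set ψ : 𝓢(ℝ, ℂ) := hc'.toSchwartzMap hφ' with hψ
  have hψx : ∀ x, ψ x = (φ x : ℂ) := fun x => rfl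
  have h1 := congrArg (fun T => T ψ) (Lp.fourierInv_toTemperedDistribution_eq G)
  simp only [TemperedDistribution.fourierInv_apply, Lp.toTemperedDistribution_apply,
    smul_eq_mul] at h1
  have h2 : ∫ x, 𝓕⁻ (G : ℝ → ℂ) x * ψ x = ∫ x, G x * 𝓕⁻ (ψ : ℝ → ℂ) x := by
    have := integral_fourier_flip (φ := fun x => ψ (-x)) hG ψ.integrable.comp_neg
    rw [← integral_neg_eq_self] at this
    simp_rw [Real.fourierInv_eq_fourier_comp_neg (ψ : ℝ → ℂ), ← this,
      Real.fourierInv_eq_fourier_neg, neg_neg]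
  calc ∫ x, φ x • (𝓕⁻ G : L2C) x = ∫ x, ψ x * (𝓕⁻ G : L2C) x := by
        simp [hψx]
    _ = ∫ x, 𝓕⁻ ψ x * G x := h1.symm
    _ = ∫ x, G x * 𝓕⁻ (ψ : ℝ → ℂ) x := by
        simp_rw [SchwartzMap.fourierInv_coe, mul_comm]
    _ = ∫ x, 𝓕⁻ (G : ℝ → ℂ) x * ψ x := h2.symm
    _ = ∫ x, φ x • 𝓕⁻ (G : ℝ → ℂ) x := by simp [hψx, mul_comm]

/-! ### Density arguments, and the symmetries of the Fourier transform -/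

/-- A closed property of `L²` functions that holds for integrable ones holds for all. -/
lemma L2C_induction {P : L2C → Prop} (hP : IsClosed {f | P f})
    (h : ∀ f : L2C, Integrable (f : ℝ → ℂ) → P f) (f : L2C) : P f := by
  refine DenseRange.induction_on (p := P)
    (SchwartzMap.denseRange_toLpCLM (F := ℂ) (μ := (volume : Measure ℝ)) (p := 2)
      ENNReal.ofNat_ne_top) f hP fun φ => h _ ?_
  exact (SchwartzMap.integrable φ).congr (φ.coeFn_toLp 2 volume).symm

/-- Complex conjugation on `L²`. -/
def conjL2 : L2C →L[ℝ] L2C := (Complex.conjCLE : ℂ →L[ℝ] ℂ).compLpL 2 volume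

lemma conjL2_ae (f : L2C) : conjL2 f =ᵐ[volume] fun x => (starRingEnd ℂ) (f x) :=
  (Complex.conjCLE : ℂ →L[ℝ] ℂ).coeFn_compLpL f

/-- The reflection `f(-x)` on `L²`. -/
def reflL2 : L2C →ₗᵢ[ℝ] L2C :=
  Lp.compMeasurePreservingₗᵢ ℝ (fun x : ℝ => -x) (Measure.measurePreserving_neg volume)

lemma reflL2_ae (f : L2C) : reflL2 f =ᵐ[volume] fun x => f (-x) :=
  Lp.coeFn_compMeasurePreserving f (Measure.measurePreserving_neg volume)

/-- The translation `f(x + h)` on `L²`. -/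
def shiftC (h : ℝ) : L2C →ₗᵢ[ℝ] L2C :=
  Lp.compMeasurePreservingₗᵢ ℝ (fun x : ℝ => x + h) (measurePreserving_add_right volume h)

lemma shiftC_ae (h : ℝ) (f : L2C) : shiftC h f =ᵐ[volume] fun x => f (x + h) :=
  Lp.coeFn_compMeasurePreserving f (measurePreserving_add_right volume h)

lemma ae_neg_of_ae {P : ℝ → Prop} (h : ∀ᵐ x : ℝ, P x) : ∀ᵐ x : ℝ, P (-x) :=
  (Measure.measurePreserving_neg (volume : Measure ℝ)).quasiMeasurePreserving.ae h

lemma continuous_fourierL2 : Continuous (fun f : L2C => (𝓕 f : L2C)) :=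
  (Lp.fourierTransformₗᵢ ℝ ℂ).continuous

/-- For integrable f, conjugating the Fourier integral reverses the sign of the frequency; both
sides are continuous in f, so density gives the rest. It is used to recognise real functions by
their transforms. -/
lemma fourier_conj (f : L2C) : (𝓕 (conjL2 f) : L2C) = conjL2 (reflL2 (𝓕 f)) := by
  refine L2C_induction (P := fun f => (𝓕 (conjL2 f) : L2C) = conjL2 (reflL2 (𝓕 f))) ?_ ?_ f
  · exact isClosed_eq (continuous_fourierL2.comp conjL2.continuous)
      (conjL2.continuous.comp (reflL2.continuous.comp continuous_fourierL2))
  intro f hf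
  have hc : Integrable (conjL2 f : ℝ → ℂ) :=
    ((Complex.conjCLE : ℂ →L[ℝ] ℂ).integrable_comp hf).congr (conjL2_ae f).symm
  apply Lp.ext
  filter_upwards [fourier_ae_eq _ hc, conjL2_ae (reflL2 (𝓕 f)), reflL2_ae (𝓕 f),
    ae_neg_of_ae (fourier_ae_eq f hf)] with x h1 h2 h3 h4
  rw [h1, h2, h3, h4, Real.fourier_congr_ae (conjL2_ae f), Real.fourier_real_eq_integral_exp_smul,
    Real.fourier_real_eq_integral_exp_smul, ← integral_conj]
  congr 1
  ext v
  simp only [smul_eq_mul, map_mul, ← Complex.exp_conj, Complex.conj_ofReal, Complex.conj_I]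
  congr 2
  push_cast
  ring

/-- A change of variables in the Fourier integral, extended by density; multiplication by the
unimodular factor is an isometry, which makes the identity a closed condition. -/
lemma fourier_shift (h : ℝ) (f : L2C) : (𝓕 (shiftC h f) : L2C) =ᵐ[volume]
    fun η => Complex.exp ((2 * Real.pi * η * h : ℝ) * Complex.I) * (𝓕 f : L2C) η := by
  have hm : ∀ f : L2C, MemLp (fun η : ℝ =>
      Complex.exp ((2 * Real.pi * η * h : ℝ) * Complex.I) * f η) 2 volume := fun f => by
    refine (Lp.memLp f).of_le ?_ (ae_of_all _ fun x => ?_)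
    · exact (Continuous.aestronglyMeasurable (by fun_prop)).mul (Lp.aestronglyMeasurable f)
    · rw [norm_mul, Complex.norm_exp_ofReal_mul_I, one_mul]
  have hcont : Continuous (fun f : L2C => (hm f).toLp _) := by
    refine Isometry.continuous (Isometry.of_dist_eq fun f g => ?_)
    rw [dist_eq_norm, dist_eq_norm, ← MemLp.toLp_sub]
    rw [Lp.norm_def, Lp.norm_def]
    congr 1
    refine eLpNorm_congr_norm_ae ?_
    filter_upwards [MemLp.coeFn_toLp ((hm f).sub (hm g)), Lp.coeFn_sub f g] with x h1 h2
    rw [h1, h2]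
    simp only [Pi.sub_apply]
    rw [← mul_sub, norm_mul, Complex.norm_exp_ofReal_mul_I, one_mul]
  suffices H : (𝓕 (shiftC h f) : L2C) = (hm (𝓕 f)).toLp _ by
    rw [H]; exact MemLp.coeFn_toLp _
  refine L2C_induction (P := fun f => (𝓕 (shiftC h f) : L2C) = (hm (𝓕 f)).toLp _) ?_ ?_ f
  · exact isClosed_eq (continuous_fourierL2.comp (shiftC h).continuous)
      (hcont.comp continuous_fourierL2)
  intro f hf
  have hc : Integrable (shiftC h f : ℝ → ℂ) := (hf.comp_add_right h).congr (shiftC_ae h f).symm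
  apply Lp.ext
  filter_upwards [fourier_ae_eq _ hc, fourier_ae_eq f hf, MemLp.coeFn_toLp (hm (𝓕 f))]
    with x h1 h2 h3
  rw [h1, h3, h2, Real.fourier_congr_ae (shiftC_ae h f), Real.fourier_real_eq_integral_exp_smul,
    Real.fourier_real_eq_integral_exp_smul, ← integral_const_mul,
    ← integral_sub_right_eq_self _ (h : ℝ)]
  congr 1
  ext v
  rw [smul_eq_mul, smul_eq_mul, ← mul_assoc, ← Complex.exp_add, sub_add_cancel]
  congr 2
  push_cast
  ring

/-! ### Fourier multipliers on real square integrable functions -/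

lemma toComplex_eq (f : L2R) :
    toComplex f = (Complex.ofRealCLM.compLpL 2 (volume : Measure ℝ) : L2R →L[ℝ] L2C) f := rfl

lemma Fhat_add (f g : L2R) : Fhat (f + g) = Fhat f + Fhat g := by
  simp only [Fhat, toComplex_eq, map_add]; exact FourierTransform.fourier_add _ _

lemma Fhat_smul (c : ℝ) (f : L2R) : Fhat (c • f) = (c : ℂ) • Fhat f := by
  simp only [Fhat, toComplex_eq, map_smul]
  rw [← FourierTransform.fourier_smul]; rfl

lemma Fhat_neg (f : L2R) : Fhat (-f) = -Fhat f := by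
  rw [← neg_one_smul ℝ f, Fhat_smul]; simp

lemma Fhat_sub (f g : L2R) : Fhat (f - g) = Fhat f - Fhat g := by
  rw [sub_eq_add_neg, Fhat_add, Fhat_neg, sub_eq_add_neg]

lemma inner_toComplex (f g : L2R) :
    inner ℂ (toComplex f) (toComplex g) = ((inner ℝ f g : ℝ) : ℂ) := by
  rw [L2.inner_def, L2.inner_def, ← integral_complex_ofReal]
  refine integral_congr_ae ?_
  filter_upwards [toComplex_ae f, toComplex_ae g] with x hf hg
  simp [hf, hg]

lemma inner_eq_Fhat (f g : L2R) : inner ℝ f g = (inner ℂ (Fhat f) (Fhat g)).re := by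
  rw [Fhat, Fhat, Lp.inner_fourier_eq, inner_toComplex, Complex.ofReal_re]

lemma norm_Fhat (f : L2R) : ‖Fhat f‖ = ‖f‖ := by
  have h := inner_eq_Fhat f f
  rw [real_inner_self_eq_norm_sq, ← RCLike.re_to_complex, inner_self_eq_norm_sq] at h
  exact ((pow_left_inj₀ (norm_nonneg _) (norm_nonneg _) two_ne_zero).1 h).symm

lemma Fhat_injective : Function.Injective Fhat := fun f g h => by
  rw [← sub_eq_zero, ← norm_eq_zero, ← norm_Fhat, Fhat_sub, h, sub_self, norm_zero]

lemma continuous_Fhat : Continuous Fhat :=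
  continuous_fourierL2.comp (Complex.ofRealCLM.compLpL 2 (volume : Measure ℝ)).continuous

lemma Fhat_neg_ae (f : L2R) : ∀ᵐ η : ℝ, Fhat f (-η) = (starRingEnd ℂ) (Fhat f η) := by
  have h : conjL2 (toComplex f) = toComplex f := by
    apply Lp.ext
    filter_upwards [conjL2_ae (toComplex f), toComplex_ae f] with x h1 h2
    rw [h1, h2, Complex.conj_ofReal]
  have h2 := fourier_conj (toComplex f)
  rw [h] at h2
  have h3 : (Fhat f : ℝ → ℂ) =ᵐ[volume] fun x => (starRingEnd ℂ) (Fhat f (-x)) := by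
    have : Fhat f = conjL2 (reflL2 (Fhat f)) := h2
    filter_upwards [conjL2_ae (reflL2 (Fhat f)), reflL2_ae (Fhat f)] with x h4 h5
    rw [← h5, ← h4, ← this]
  filter_upwards [h3] with x hx
  rw [hx, Complex.conj_conj]

/-! ### Multiplier relations with possibly unbounded symbols -/

/-- `g = m(D) f`: the Fourier transforms satisfy `ĝ(ξ) = m(ξ) f̂(ξ)`, for a possibly unbounded
symbol `m`. -/
def IsMul (m : ℝ → ℂ) (f g : L2R) : Prop :=
  (Fhat g : ℝ → ℂ) =ᵐ[volume] fun η => m (2 * Real.pi * η) * Fhat f η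

/-- A Hermitian symbol preserves the Hermitian symmetry of the transform of a real function, so the
inverse transform of the product equals its own conjugate. Being square integrable is then the only
domain condition. -/
lemma exists_isMul {m : ℝ → ℂ} (hherm : ∀ ξ, m (-ξ) = (starRingEnd ℂ) (m ξ)) (f : L2R)
    (h : MemLp (fun η : ℝ => m (2 * Real.pi * η) * Fhat f η) 2 volume) : ∃ g, IsMul m f g := by
  set G : L2C := h.toLp _ with hG
  set k : L2C := 𝓕⁻ G with hk
  have hkG : (𝓕 k : L2C) = G := FourierTransform.fourier_fourierInv_eq G
  have hreal : conjL2 k = k := by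
    apply (Lp.fourierTransformₗᵢ ℝ ℂ).injective
    change (𝓕 (conjL2 k) : L2C) = 𝓕 k
    rw [fourier_conj, hkG]
    apply Lp.ext
    filter_upwards [conjL2_ae (reflL2 G), reflL2_ae G, h.coeFn_toLp, ae_neg_of_ae h.coeFn_toLp,
      Fhat_neg_ae f] with x h1 h2 h3 h4 h5
    rw [h1, h2, h4, h3, h5, mul_neg, hherm, map_mul, Complex.conj_conj, Complex.conj_conj]
  refine ⟨Complex.reCLM.compLp k, ?_⟩
  have hc : toComplex (Complex.reCLM.compLp k) = k := by
    apply Lp.ext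
    have h0 : (conjL2 k : ℝ → ℂ) =ᵐ[volume] k := by rw [hreal]
    filter_upwards [toComplex_ae (Complex.reCLM.compLp k), Complex.reCLM.coeFn_compLp k,
      conjL2_ae k, h0] with x h1 h2 h3 h4
    rw [h1, h2]
    exact Complex.conj_eq_iff_re.1 (h3.symm.trans h4)
  rw [IsMul, Fhat, hc, hkG]
  exact h.coeFn_toLp

namespace IsMul

variable {m n : ℝ → ℂ} {f g h k : L2R}

lemma unique (h₁ : IsMul m f g) (h₂ : IsMul m f h) : g = h :=
  Fhat_injective (Lp.ext (h₁.trans (EventuallyEq.symm h₂)))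

lemma cancel (hm : ∀ ξ, m ξ ≠ 0) (h₁ : IsMul m f g) (h₂ : IsMul m h g) : f = h := by
  refine Fhat_injective (Lp.ext ?_)
  filter_upwards [h₁, h₂] with x h1 h2
  exact mul_left_cancel₀ (hm (2 * Real.pi * x)) (h1.symm.trans h2)

lemma comp (h₁ : IsMul m f g) (h₂ : IsMul n g h) : IsMul (fun ξ => n ξ * m ξ) f h := by
  filter_upwards [h₁, h₂] with x h1 h2
  rw [h2, h1, ← mul_assoc]

lemma congr (h₁ : IsMul m f g) (hmn : ∀ ξ, m ξ = n ξ) : IsMul n f g := by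
  rwa [← funext hmn]

lemma one (f : L2R) : IsMul (fun _ => 1) f f := by
  filter_upwards with x
  rw [one_mul]

lemma inv (hm : ∀ ξ, m ξ ≠ 0) (h₁ : IsMul m f g) : IsMul (fun ξ => (m ξ)⁻¹) g f := by
  filter_upwards [h₁] with x h1
  rw [h1, inv_mul_cancel_left₀ (hm _)]

lemma add (h₁ : IsMul m f g) (h₂ : IsMul m h k) : IsMul m (f + h) (g + k) := by
  rw [IsMul, Fhat_add, Fhat_add]
  filter_upwards [h₁, h₂, Lp.coeFn_add (Fhat f) (Fhat h), Lp.coeFn_add (Fhat g) (Fhat k)]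
    with x h1 h2 h3 h4
  rw [h3, h4, Pi.add_apply, Pi.add_apply, h1, h2, mul_add]

lemma smul (c : ℝ) (h₁ : IsMul m f g) : IsMul m (c • f) (c • g) := by
  rw [IsMul, Fhat_smul, Fhat_smul]
  filter_upwards [h₁, Lp.coeFn_smul (c : ℂ) (Fhat f), Lp.coeFn_smul (c : ℂ) (Fhat g)]
    with x h1 h2 h3
  rw [h2, h3, Pi.smul_apply, Pi.smul_apply, h1, smul_eq_mul, smul_eq_mul]
  ring

lemma neg (h₁ : IsMul m f g) : IsMul m (-f) (-g) := by
  simpa using h₁.smul (-1)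

lemma sub (h₁ : IsMul m f g) (h₂ : IsMul m h k) : IsMul m (f - h) (g - k) := by
  simpa [sub_eq_add_neg] using h₁.add h₂.neg

lemma add_symbol (h₁ : IsMul m f g) (h₂ : IsMul n f h) :
    IsMul (fun ξ => m ξ + n ξ) f (g + h) := by
  rw [IsMul, Fhat_add]
  filter_upwards [h₁, h₂, Lp.coeFn_add (Fhat g) (Fhat h)] with x h1 h2 h3
  rw [h3, Pi.add_apply, h1, h2, add_mul]

lemma neg_symbol (h₁ : IsMul m f g) : IsMul (fun ξ => -m ξ) f (-g) := by
  rw [IsMul, Fhat_neg]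
  filter_upwards [h₁, Lp.coeFn_neg (Fhat g)] with x h1 h2
  rw [h2, Pi.neg_apply, h1, neg_mul]

/-- Plancherel. Two multipliers of the same f are compared, so both symbols may be unbounded. -/
lemma norm_le {C : ℝ} (hC : ∀ ξ, ‖m ξ‖ ≤ C * ‖n ξ‖) (h₁ : IsMul m f g) (h₂ : IsMul n f h) :
    ‖g‖ ≤ C * ‖h‖ := by
  rw [← norm_Fhat g, ← norm_Fhat h]
  refine Lp.norm_le_mul_norm_of_ae_le_mul ?_
  filter_upwards [h₁, h₂] with x h1 h2
  rw [h1, h2, norm_mul, norm_mul, ← mul_assoc]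
  exact mul_le_mul_of_nonneg_right (hC _) (norm_nonneg _)

lemma norm_le' {C : ℝ} (hC : ∀ ξ, ‖m ξ‖ ≤ C) (h₁ : IsMul m f g) : ‖g‖ ≤ C * ‖f‖ :=
  norm_le (by simpa using hC) h₁ (one f)

lemma norm_eq (hC : ∀ ξ, ‖m ξ‖ = 1) (h₁ : IsMul m f g) : ‖g‖ = ‖f‖ := by
  refine le_antisymm ?_ ?_
  · simpa using norm_le' (C := 1) (fun ξ => (hC ξ).le) h₁
  · simpa using norm_le (C := 1) (fun ξ => by simp [hC ξ]) (one f) h₁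

/-- Plancherel turns both sides into one integral. No boundedness is needed, only that f and h lie
in the respective domains. -/
lemma inner_eq (h₁ : IsMul m f g) (h₂ : IsMul n h k)
    (hmn : ∀ ξ, n ξ = (starRingEnd ℂ) (m ξ)) : inner ℝ g h = inner ℝ f k := by
  rw [inner_eq_Fhat, inner_eq_Fhat, L2.inner_def, L2.inner_def]
  congr 1
  refine integral_congr_ae ?_
  filter_upwards [h₁, h₂] with x h1 h2
  rw [h1, h2, hmn]
  simp only [RCLike.inner_apply, map_mul]
  ring

/-- Skew-adjointness for a purely imaginary symbol. -/
lemma inner_eq_neg (h₁ : IsMul m f g) (h₂ : IsMul m h k)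
    (hm : ∀ ξ, (starRingEnd ℂ) (m ξ) = -m ξ) : inner ℝ g h = -inner ℝ f k := by
  rw [inner_eq h₁ h₂.neg_symbol fun ξ => (hm ξ).symm, inner_neg_right]

lemma memLp (h₁ : IsMul m f g) :
    MemLp (fun η : ℝ => m (2 * Real.pi * η) * Fhat f η) 2 volume :=
  (memLp_congr_ae h₁).1 (Lp.memLp _)

/-- This connects the operator `mult` of the statement, with its default value outside the domain,
to the relational calculus used in the proof. -/
lemma mult_eq {a : ℝ → ℝ} (h₁ : IsMul (fun ξ => (a ξ : ℂ)) f g) : mult a f = g := by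
  have h2 : MemLp (fun η : ℝ => ((a (2 * Real.pi * η) : ℝ) : ℂ) * (𝓕 (toComplex f) : L2C) η) 2
    volume := h₁.memLp
  have h3 : h2.toLp _ = Fhat g := Lp.ext (h2.coeFn_toLp.trans (EventuallyEq.symm h₁))
  rw [mult, multC, dif_pos h2, h3, Fhat, FourierTransform.fourierInv_fourier_eq]
  apply Lp.ext
  filter_upwards [Complex.reCLM.coeFn_compLp (toComplex g), toComplex_ae g] with x h4 h5
  rw [h4, h5]
  simp

end IsMul

/-! ### Bounded multiplier operators -/

/-- A bounded measurable symbol whose multiplier preserves real functions. -/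
structure BddSymbol (m : ℝ → ℂ) (C : ℝ) : Prop where
  meas : Measurable m
  herm : ∀ ξ, m (-ξ) = (starRingEnd ℂ) (m ξ)
  bdd : ∀ ξ, ‖m ξ‖ ≤ C

lemma BddSymbol.exists_isMul {m : ℝ → ℂ} {C : ℝ} (hm : BddSymbol m C) (f : L2R) :
    ∃ g, IsMul m f g := by
  refine NonlocalWave.exists_isMul hm.herm f ?_
  refine MemLp.of_le_mul (c := C) (Lp.memLp (Fhat f)) ?_ (ae_of_all _ fun x => ?_)
  · exact ((hm.meas.comp (measurable_const_mul _)).aestronglyMeasurable).mul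
      (Lp.aestronglyMeasurable _)
  · rw [norm_mul]
    exact mul_le_mul_of_nonneg_right (hm.bdd _) (norm_nonneg _)

open Classical in
/-- The bounded operator `m(D)` on real `L²` functions (and `0` if `m` is not a bounded symbol). -/
def Mop (m : ℝ → ℂ) : L2R →L[ℝ] L2R :=
  if h : ∃ C, BddSymbol m C then
    LinearMap.mkContinuous
      { toFun := fun f => (h.choose_spec.exists_isMul f).choose
        map_add' := fun f g => IsMul.unique (h.choose_spec.exists_isMul (f + g)).choose_spec
          ((h.choose_spec.exists_isMul f).choose_spec.add
            (h.choose_spec.exists_isMul g).choose_spec)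
        map_smul' := fun c f => IsMul.unique (h.choose_spec.exists_isMul (c • f)).choose_spec
          ((h.choose_spec.exists_isMul f).choose_spec.smul c) } h.choose
      fun f => IsMul.norm_le' h.choose_spec.bdd (h.choose_spec.exists_isMul f).choose_spec
  else 0

lemma BddSymbol.isMul {m : ℝ → ℂ} {C : ℝ} (hm : BddSymbol m C) (f : L2R) :
    IsMul m f (Mop m f) := by
  have h : ∃ C, BddSymbol m C := ⟨C, hm⟩
  rw [Mop, dif_pos h]
  exact (h.choose_spec.exists_isMul f).choose_spec

lemma BddSymbol.norm_le {m : ℝ → ℂ} {C : ℝ} (hm : BddSymbol m C) (f : L2R) :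
    ‖Mop m f‖ ≤ C * ‖f‖ := (hm.isMul f).norm_le' hm.bdd

lemma IsMul.eq_Mop {m : ℝ → ℂ} {C : ℝ} {f g : L2R} (h : IsMul m f g) (hm : BddSymbol m C) :
    g = Mop m f := h.unique (hm.isMul f)

/-- Multipliers commute with bounded multipliers. -/
lemma IsMul.map_Mop {m n : ℝ → ℂ} {C : ℝ} {f g : L2R} (h : IsMul m f g) (hn : BddSymbol n C) :
    IsMul m (Mop n f) (Mop n g) := by
  filter_upwards [h, hn.isMul f, hn.isMul g] with x h1 h2 h3
  rw [h3, h1, h2]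
  ring

/-! ### Schwartz functions and frequency cutoffs -/

/-- A real Schwartz function regarded as a complex one. -/
def complexify (φ : 𝓢(ℝ, ℝ)) : 𝓢(ℝ, ℂ) := φ.postcompCLM Complex.ofRealCLM

lemma complexify_apply (φ : 𝓢(ℝ, ℝ)) (x : ℝ) : complexify φ x = (φ x : ℂ) := rfl

lemma toComplex_testL2 (φ : 𝓢(ℝ, ℝ)) : toComplex (testL2 φ) = (complexify φ).toLp 2 volume := by
  apply Lp.ext
  filter_upwards [toComplex_ae (testL2 φ), φ.coeFn_toLp 2 volume,
    (complexify φ).coeFn_toLp 2 volume] with x h1 h2 h3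
  rw [h1, h3, complexify_apply, testL2, h2]

lemma Fhat_testL2 (φ : 𝓢(ℝ, ℝ)) : Fhat (testL2 φ) = (𝓕 (complexify φ)).toLp 2 volume := by
  rw [Fhat, toComplex_testL2, SchwartzMap.toLp_fourier_eq]

lemma isMul_testDeriv (φ : 𝓢(ℝ, ℝ)) :
    IsMul (fun ξ => Complex.I * ξ) (testL2 φ) (testDeriv φ) := by
  rw [IsMul, testDeriv, Fhat_testL2, Fhat_testL2]
  have h1 : (complexify (SchwartzMap.derivCLM ℝ ℝ φ) : ℝ → ℂ) = deriv (complexify φ) := by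
    ext x
    rw [complexify_apply, SchwartzMap.derivCLM_apply]
    exact (((φ.hasDerivAt x).ofReal_comp).deriv).symm
  have h2 := Real.fourier_deriv (complexify φ).integrable (complexify φ).differentiable
    (h1 ▸ (complexify (SchwartzMap.derivCLM ℝ ℝ φ)).integrable)
  filter_upwards [(𝓕 (complexify φ)).coeFn_toLp 2 volume,
    (𝓕 (complexify (SchwartzMap.derivCLM ℝ ℝ φ))).coeFn_toLp 2 volume] with x h3 h4
  rw [h3, h4, SchwartzMap.fourier_coe, SchwartzMap.fourier_coe, h1, h2]
  simp only [smul_eq_mul]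
  push_cast
  ring

/-- The Schwartz function ψ is (1 - ∂ₓ²)^k φ. -/
lemma exists_isMul_testL2_pow (φ : 𝓢(ℝ, ℝ)) (k : ℕ) :
    ∃ ψ : 𝓢(ℝ, ℝ), IsMul (fun ξ => ((1 + ξ ^ 2) ^ k : ℝ)) (testL2 φ) (testL2 ψ) := by
  induction k with
  | zero => exact ⟨φ, (IsMul.one _).congr fun ξ => by simp⟩
  | succ k ih =>
    obtain ⟨ψ, hψ⟩ := ih
    have h1 := (isMul_testDeriv ψ).comp (isMul_testDeriv (SchwartzMap.derivCLM ℝ ℝ ψ))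
    have h2 := (IsMul.one (testL2 ψ)).add_symbol h1.neg_symbol
    refine ⟨ψ - SchwartzMap.derivCLM ℝ ℝ (SchwartzMap.derivCLM ℝ ℝ ψ), ?_⟩
    have h3 : testL2 (ψ - SchwartzMap.derivCLM ℝ ℝ (SchwartzMap.derivCLM ℝ ℝ ψ)) =
        testL2 ψ + -testDeriv (SchwartzMap.derivCLM ℝ ℝ ψ) := by
      rw [← sub_eq_add_neg]
      exact map_sub (SchwartzMap.toLpCLM ℝ ℝ 2 volume) ψ _
    rw [h3]
    refine (hψ.comp h2).congr fun ξ => ?_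
    push_cast
    rw [pow_succ]
    linear_combination (-(1 + (ξ : ℂ) ^ 2) ^ k * (ξ : ℂ) ^ 2) * Complex.I_sq

/-- A polynomially bounded symbol may be applied to Schwartz functions. -/
lemma exists_isMul_testL2 {m : ℝ → ℂ} (hmeas : Measurable m)
    (hherm : ∀ ξ, m (-ξ) = (starRingEnd ℂ) (m ξ)) {C : ℝ} {k : ℕ}
    (hC : ∀ ξ, ‖m ξ‖ ≤ C * (1 + ξ ^ 2) ^ k) (φ : 𝓢(ℝ, ℝ)) : ∃ g, IsMul m (testL2 φ) g := by
  obtain ⟨ψ, hψ⟩ := exists_isMul_testL2_pow φ k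
  have hpos : ∀ ξ : ℝ, 0 < (1 + ξ ^ 2) ^ k := fun ξ => by positivity
  have hb : BddSymbol (fun ξ => m ξ / ((1 + ξ ^ 2) ^ k : ℝ)) C := by
    refine ⟨hmeas.div (Complex.measurable_ofReal.comp (by fun_prop)), fun ξ => ?_, fun ξ => ?_⟩
    · simp only [neg_sq, hherm, map_div₀, Complex.conj_ofReal]
    · rw [norm_div, Complex.norm_real, Real.norm_of_nonneg (hpos ξ).le, div_le_iff₀ (hpos ξ)]
      exact hC ξ
  obtain ⟨g, hg⟩ := hb.exists_isMul (testL2 ψ)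
  exact ⟨g, (hψ.comp hg).congr fun ξ =>
    div_mul_cancel₀ _ (Complex.ofReal_ne_zero.2 (hpos ξ).ne')⟩

lemma dense_testL2 : DenseRange testL2 :=
  SchwartzMap.denseRange_toLpCLM (F := ℝ) (μ := (volume : Measure ℝ)) (p := 2)
    ENNReal.ofNat_ne_top

lemma eq_of_inner_testL2 {f g : L2R} (h : ∀ φ, (inner ℝ f (testL2 φ) : ℝ) = inner ℝ g (testL2 φ)) :
    f = g := by
  refine dense_testL2.eq_of_inner_right (𝕜 := ℝ) ?_
  intro φ
  rw [real_inner_comm, h φ, real_inner_comm]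

/-- The smooth frequency cutoff: `1` for `|ξ| ≤ n + 1` and `0` for `|ξ| ≥ n + 2`. -/
def bump (n : ℕ) : ContDiffBump (0 : ℝ) := ⟨n + 1, n + 2, by positivity, by linarith⟩

/-- The frequency cutoff as a symbol. -/
def cutoff (n : ℕ) (ξ : ℝ) : ℂ := (bump n ξ : ℝ)

lemma cutoff_symbol (n : ℕ) : BddSymbol (cutoff n) 1 where
  meas := Complex.measurable_ofReal.comp (bump n).continuous.measurable
  herm ξ := by rw [cutoff, cutoff, (bump n).neg, Complex.conj_ofReal]
  bdd ξ := by
    rw [cutoff, Complex.norm_real, Real.norm_of_nonneg (bump n).nonneg]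
    exact (bump n).le_one

lemma cutoff_one {n : ℕ} {ξ : ℝ} (h : |ξ| ≤ n + 1) : cutoff n ξ = 1 := by
  rw [cutoff, (bump n).one_of_mem_closedBall (by simpa [bump] using h), Complex.ofReal_one]

lemma cutoff_zero {n : ℕ} {ξ : ℝ} (h : (n : ℝ) + 2 ≤ |ξ|) : cutoff n ξ = 0 := by
  rw [cutoff, (bump n).zero_of_le_dist (by simpa [bump] using h), Complex.ofReal_zero]

lemma cutoff_mul_symbol {m : ℝ → ℂ} (hmeas : Measurable m)
    (hherm : ∀ ξ, m (-ξ) = (starRingEnd ℂ) (m ξ)) {C : ℝ} (n : ℕ)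
    (hC : ∀ ξ : ℝ, |ξ| ≤ n + 2 → ‖m ξ‖ ≤ C) : BddSymbol (fun ξ => m ξ * cutoff n ξ) C where
  meas := hmeas.mul (cutoff_symbol n).meas
  herm ξ := by rw [hherm, (cutoff_symbol n).herm, map_mul]
  bdd ξ := by
    rcases le_or_gt (|ξ|) (n + 2) with h | h
    · rw [norm_mul]
      calc ‖m ξ‖ * ‖cutoff n ξ‖ ≤ ‖m ξ‖ * 1 :=
            mul_le_mul_of_nonneg_left ((cutoff_symbol n).bdd ξ) (norm_nonneg _)
        _ ≤ C := by rw [mul_one]; exact hC ξ h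
    · rw [cutoff_zero h.le, mul_zero, norm_zero]
      exact (norm_nonneg _).trans (hC 0 (by rw [abs_zero]; positivity))

/-- The cutoff times a Schwartz transform is smooth with compact support, hence Schwartz, and so is
its inverse transform. Taking the real part changes nothing, since this inverse transform agrees
with the real function supplied by the bounded multiplier. -/
lemma exists_testL2_cutoff (n : ℕ) (φ : 𝓢(ℝ, ℝ)) :
    ∃ ψ : 𝓢(ℝ, ℝ), IsMul (cutoff n) (testL2 φ) (testL2 ψ) := by
  set θ : ℝ → ℂ := fun η => (bump n (2 * Real.pi * η) : ℝ) * 𝓕 (complexify φ) η with hθ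
  have hsm : ContDiff ℝ ∞ θ := by
    refine ContDiff.mul ?_ ((𝓕 (complexify φ)).smooth ⊤)
    exact Complex.ofRealCLM.contDiff.comp ((bump n).contDiff.comp (contDiff_const.mul contDiff_id))
  have hcs : HasCompactSupport θ := by
    refine HasCompactSupport.mul_right ?_
    have := (bump n).hasCompactSupport.comp_homeomorph
      (Homeomorph.mulLeft₀ (2 * Real.pi) Real.two_pi_pos.ne')
    exact this.comp_left (g := fun y : ℝ => (y : ℂ)) (by simp)
  set Θ : 𝓢(ℝ, ℂ) := hcs.toSchwartzMap hsm with hΘ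
  have hΘx : ∀ x, Θ x = θ x := fun x => rfl
  set Ψ : 𝓢(ℝ, ℂ) := 𝓕⁻ Θ with hΨ
  refine ⟨Ψ.postcompCLM Complex.reCLM, ?_⟩
  obtain ⟨g, hg⟩ := (cutoff_symbol n).exists_isMul (testL2 φ)
  have hgΘ : Fhat g = Θ.toLp 2 volume := by
    apply Lp.ext
    filter_upwards [hg, Θ.coeFn_toLp 2 volume, (𝓕 (complexify φ)).coeFn_toLp 2 volume]
      with x h1 h2 h3
    rw [h1, h2, hΘx, Fhat_testL2, h3]
    rfl
  have hgΨ : toComplex g = Ψ.toLp 2 volume := by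
    rw [hΨ, ← SchwartzMap.toLp_fourierInv_eq, ← hgΘ, Fhat, FourierTransform.fourierInv_fourier_eq]
  have : testL2 (Ψ.postcompCLM Complex.reCLM) = g := by
    apply Lp.ext
    have h0 : (toComplex g : ℝ → ℂ) =ᵐ[volume] Ψ := by
      rw [hgΨ]; exact Ψ.coeFn_toLp 2 volume
    filter_upwards [h0, toComplex_ae g, (Ψ.postcompCLM Complex.reCLM).coeFn_toLp 2 volume]
      with x h1 h2 h3
    rw [testL2, h3, SchwartzMap.postcompCLM_apply, ← h1, h2]
    simp
  rw [this]
  exact hg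

/-- Frequency localized identities determine a multiplier relation. -/
lemma isMul_of_cutoff {m : ℝ → ℂ} {f g : L2R}
    (h : ∀ n, IsMul (fun ξ => m ξ * cutoff n ξ) f (Mop (cutoff n) g)) : IsMul m f g := by
  have h1 : ∀ᵐ x : ℝ, ∀ n, (Fhat (Mop (cutoff n) g) : ℝ → ℂ) x =
      m (2 * Real.pi * x) * cutoff n (2 * Real.pi * x) * Fhat f x := ae_all_iff.2 h
  have h2 : ∀ᵐ x : ℝ, ∀ n, (Fhat (Mop (cutoff n) g) : ℝ → ℂ) x =
      cutoff n (2 * Real.pi * x) * Fhat g x :=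
    ae_all_iff.2 fun n => (cutoff_symbol n).isMul g
  filter_upwards [h1, h2] with x h1 h2
  obtain ⟨n, hn⟩ := exists_nat_ge (|2 * Real.pi * x|)
  have hc := cutoff_one (n := n) (ξ := 2 * Real.pi * x) (by linarith)
  have := (h2 n).symm.trans (h1 n)
  rwa [hc, one_mul, mul_one] at this

lemma eq_of_cutoff {f g : L2R} (h : ∀ n, Mop (cutoff n) f = Mop (cutoff n) g) : f = g := by
  refine (IsMul.one f).unique (isMul_of_cutoff fun n => ?_)
  rw [← h]
  exact ((cutoff_symbol n).isMul f).congr fun ξ => (one_mul _).symm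

/-- Weak derivatives in the sense of distributions are multipliers with symbol `iξ`. -/
lemma IsWeakDeriv.isMul {v u : L2R} (h : IsWeakDeriv v u) :
    IsMul (fun ξ => Complex.I * ξ) v u := by
  -- After the cutoff the symbol iξ is bounded, and the cutoff can be moved to the test function,
  -- which stays Schwartz.
  refine isMul_of_cutoff fun n => ?_
  have hs : BddSymbol (fun ξ : ℝ => Complex.I * (ξ : ℂ) * cutoff n ξ) (n + 2) := by
    refine cutoff_mul_symbol (by fun_prop) (fun ξ => by simp) n fun ξ hξ => ?_
    simpa using hξ
  have : Mop (cutoff n) u = Mop (fun ξ : ℝ => Complex.I * (ξ : ℂ) * cutoff n ξ) v := by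
    refine eq_of_inner_testL2 fun φ => ?_
    obtain ⟨ψ, hψ⟩ := exists_testL2_cutoff n φ
    have h1 := ((cutoff_symbol n).isMul u).inner_eq hψ
      (fun ξ => by rw [cutoff, Complex.conj_ofReal])
    have h2 := (hψ.comp (isMul_testDeriv ψ)).neg_symbol
    have h3 := (hs.isMul v).inner_eq h2
      (fun ξ => by simp [cutoff, Complex.conj_ofReal])
    rw [h1, h3, h ψ, inner_neg_right]
  rw [this]
  exact hs.isMul v

/-! ### The symbols of the problem -/

/-- The standing assumptions on the orders and the symbols. -/
structure Admissible (ρ r : ℝ) (l b : ℝ → ℝ) : Prop where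
  nonneg_ρ : 0 ≤ ρ
  nonneg_r : 0 ≤ r
  smoothing : 1 ≤ r + ρ / 2
  embedding : 1 < r + ρ
  ell : IsEllipticSymbol ρ l
  ellB : IsEllipticSymbol (-r) b

/-- The bracket `1 + ξ²`. -/
def br (ξ : ℝ) : ℝ := 1 + ξ ^ 2

lemma one_le_br (ξ : ℝ) : 1 ≤ br ξ := by unfold br; nlinarith [sq_nonneg ξ]

lemma br_pos (ξ : ℝ) : 0 < br ξ := one_pos.trans_le (one_le_br ξ)

lemma br_neg (ξ : ℝ) : br (-ξ) = br ξ := by simp [br]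

lemma measurable_br : Measurable br := by unfold br; fun_prop

lemma abs_le_br (ξ : ℝ) : |ξ| ≤ br ξ ^ (1 / 2 : ℝ) := by
  rw [← Real.sqrt_eq_rpow]
  exact Real.abs_le_sqrt (by unfold br; linarith)

lemma br_rpow_le {s t : ℝ} (h : s ≤ t) (ξ : ℝ) : br ξ ^ s ≤ br ξ ^ t :=
  Real.rpow_le_rpow_of_exponent_le (one_le_br ξ) h

/-- A real symbol comparable to `(1 + ξ²)^s`. -/
structure Comparable (s : ℝ) (k : ℝ → ℝ) : Prop where
  meas : Measurable k
  even : ∀ ξ, k (-ξ) = k ξ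
  bounds : ∃ c > 0, ∃ C > 0, ∀ ξ, c * br ξ ^ s ≤ k ξ ∧ k ξ ≤ C * br ξ ^ s

namespace Comparable

variable {s t : ℝ} {k m : ℝ → ℝ}

lemma pos (h : Comparable s k) (ξ : ℝ) : 0 < k ξ := by
  obtain ⟨c, hc, C, hC, hb⟩ := h.bounds
  exact (mul_pos hc (Real.rpow_pos_of_pos (br_pos ξ) s)).trans_le (hb ξ).1

lemma ne_zero (h : Comparable s k) (ξ : ℝ) : (k ξ : ℂ) ≠ 0 :=
  Complex.ofReal_ne_zero.2 (h.pos ξ).ne'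

lemma rpow (h : Comparable s k) (q : ℝ) : Comparable (s * q) (fun ξ => k ξ ^ q) := by
  refine ⟨h.meas.pow_const q, fun ξ => by rw [h.even], ?_⟩
  obtain ⟨c, hc, C, hC, hb⟩ := h.bounds
  have hbp : ∀ ξ, 0 < br ξ ^ s := fun ξ => Real.rpow_pos_of_pos (br_pos ξ) s
  rcases le_total 0 q with hq | hq
  · refine ⟨c ^ q, by positivity, C ^ q, by positivity, fun ξ => ?_⟩
    rw [Real.rpow_mul (br_pos ξ).le, ← Real.mul_rpow hc.le (hbp ξ).le,
      ← Real.mul_rpow hC.le (hbp ξ).le]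
    exact ⟨Real.rpow_le_rpow (mul_pos hc (hbp ξ)).le (hb ξ).1 hq,
      Real.rpow_le_rpow (h.pos ξ).le (hb ξ).2 hq⟩
  · refine ⟨C ^ q, by positivity, c ^ q, by positivity, fun ξ => ?_⟩
    rw [Real.rpow_mul (br_pos ξ).le, ← Real.mul_rpow hc.le (hbp ξ).le,
      ← Real.mul_rpow hC.le (hbp ξ).le]
    exact ⟨Real.rpow_le_rpow_of_nonpos (h.pos ξ) (hb ξ).2 hq,
      Real.rpow_le_rpow_of_nonpos (mul_pos hc (hbp ξ)) (hb ξ).1 hq⟩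

lemma mul (h : Comparable s k) (h' : Comparable t m) :
    Comparable (s + t) (fun ξ => k ξ * m ξ) := by
  refine ⟨h.meas.mul h'.meas, fun ξ => by rw [h.even, h'.even], ?_⟩
  obtain ⟨c, hc, C, hC, hb⟩ := h.bounds
  obtain ⟨c', hc', C', hC', hb'⟩ := h'.bounds
  refine ⟨c * c', by positivity, C * C', by positivity, fun ξ => ?_⟩
  rw [Real.rpow_add (br_pos ξ), mul_mul_mul_comm, mul_mul_mul_comm C]
  have h1 : 0 ≤ br ξ ^ s := Real.rpow_nonneg (br_pos ξ).le s
  have h2 : 0 ≤ br ξ ^ t := Real.rpow_nonneg (br_pos ξ).le t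
  exact ⟨mul_le_mul (hb ξ).1 (hb' ξ).1 (by positivity) (h.pos ξ).le,
    mul_le_mul (hb ξ).2 (hb' ξ).2 (h'.pos ξ).le (by positivity)⟩

lemma congr_order (h : Comparable s k) (hst : s = t) : Comparable t k := hst ▸ h

lemma norm_le (h : Comparable s k) : ∃ C > 0, ∀ ξ, ‖(k ξ : ℂ)‖ ≤ C * br ξ ^ s := by
  obtain ⟨c, hc, C, hC, hb⟩ := h.bounds
  refine ⟨C, hC, fun ξ => ?_⟩
  rw [Complex.norm_real, Real.norm_of_nonneg (h.pos ξ).le]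
  exact (hb ξ).2

lemma bddSymbol (h : Comparable s k) (hs : s ≤ 0) : ∃ C > 0, BddSymbol (fun ξ => (k ξ : ℂ)) C := by
  obtain ⟨C, hC, hb⟩ := h.norm_le
  refine ⟨C, hC, Complex.measurable_ofReal.comp h.meas,
    fun ξ => by rw [h.even, Complex.conj_ofReal], fun ξ => (hb ξ).trans ?_⟩
  exact mul_le_of_le_one_right hC.le (Real.rpow_le_one_of_one_le_of_nonpos (one_le_br ξ) hs)

end Comparable

lemma IsEllipticSymbol.comparable {k : ℝ} {a : ℝ → ℝ} (h : IsEllipticSymbol k a) :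
    Comparable (k / 2) a := by
  obtain ⟨c, hc, C, hC, hb⟩ := h.bounds
  exact ⟨h.smooth.continuous.measurable, h.even, c ^ 2, by positivity, C ^ 2, by positivity, hb⟩

/-! ### Sobolev spaces in terms of multipliers -/

lemma norm_sq_eq_integral (f : L2R) : ‖f‖ ^ 2 = ∫ η, ‖(Fhat f : ℝ → ℂ) η‖ ^ 2 := by
  rw [← norm_Fhat, ← inner_self_eq_norm_sq (𝕜 := ℂ), L2.inner_def, RCLike.re_to_complex,
    ← Complex.reCLM_apply, ← ContinuousLinearMap.integral_comp_comm _ (L2.integrable_inner _ _)]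
  refine integral_congr_ae (ae_of_all _ fun x => ?_)
  simp only [Complex.reCLM_apply]
  rw [← RCLike.re_to_complex, inner_self_eq_norm_sq]

lemma integrable_norm_sq_Fhat (f : L2R) : Integrable (fun η => ‖(Fhat f : ℝ → ℂ) η‖ ^ 2) :=
  (memLp_two_iff_integrable_sq_norm (Lp.aestronglyMeasurable _)).1 (Lp.memLp _)

lemma memH_iff_Fhat (s : ℝ) (f : L2R) :
    MemH s f ↔ Integrable (fun η => br (2 * Real.pi * η) ^ s * ‖(Fhat f : ℝ → ℂ) η‖ ^ 2) := by
  have hpi : (2 * Real.pi) ≠ 0 := Real.two_pi_pos.ne'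
  rw [MemH, ← integrable_comp_mul_left_iff _ hpi]
  refine iff_of_eq (congrArg (fun F => Integrable F volume) (funext fun η => ?_))
  rw [hat, mul_div_cancel_left₀ _ hpi]
  rfl

lemma normH_eq_Fhat (s : ℝ) (f : L2R) : normH s f =
    Real.sqrt (2 * Real.pi * ∫ η, br (2 * Real.pi * η) ^ s * ‖(Fhat f : ℝ → ℂ) η‖ ^ 2) := by
  have hpi : (2 * Real.pi) ≠ 0 := Real.two_pi_pos.ne'
  have h := Measure.integral_comp_mul_left (fun ξ : ℝ => (1 + ξ ^ 2) ^ s * ‖hat f ξ‖ ^ 2)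
    (2 * Real.pi)
  rw [abs_of_pos (inv_pos.2 Real.two_pi_pos), smul_eq_mul, eq_inv_mul_iff_mul_eq₀ hpi] at h
  rw [normH, ← h]
  congr 2
  refine integral_congr_ae (ae_of_all _ fun η => ?_)
  simp only [hat, mul_div_cancel_left₀ _ hpi]
  rfl

namespace Comparable

variable {s : ℝ} {k : ℝ → ℝ}

/-- The two-sided bounds make the weights k² and (1 + ξ²)^s interchangeable. In this form the energy
spaces become the ranges of M and N on L². -/
lemma memH_iff (h : Comparable (s / 2) k) (f : L2R) :
    MemH s f ↔ ∃ z, IsMul (fun ξ => (k ξ : ℂ)) f z := by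
  obtain ⟨c, hc, C, hC, hb⟩ := h.bounds
  have hsq : ∀ ξ, (br ξ ^ (s / 2)) ^ 2 = br ξ ^ s := fun ξ => by
    rw [← Real.rpow_natCast, ← Real.rpow_mul (br_pos ξ).le]; congr 1; push_cast; ring
  have hm : Measurable (fun η : ℝ => (k (2 * Real.pi * η) : ℂ)) :=
    Complex.measurable_ofReal.comp (h.meas.comp (measurable_const_mul _))
  have hmb : Measurable (fun η : ℝ => br (2 * Real.pi * η) ^ s) :=
    (measurable_br.comp (measurable_const_mul _)).pow_const s
  have hn : ∀ η : ℝ, ‖(k (2 * Real.pi * η) : ℂ) * Fhat f η‖ ^ 2 =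
      k (2 * Real.pi * η) ^ 2 * ‖(Fhat f : ℝ → ℂ) η‖ ^ 2 := fun η => by
    rw [norm_mul, mul_pow, Complex.norm_real, Real.norm_eq_abs, sq_abs]
  rw [memH_iff_Fhat]
  constructor
  · intro hi
    refine exists_isMul (fun ξ => by rw [h.even, Complex.conj_ofReal]) f ?_
    refine (memLp_two_iff_integrable_sq_norm
      (hm.aestronglyMeasurable.mul (Lp.aestronglyMeasurable _))).2 ?_
    refine Integrable.mono' (hi.const_mul (C ^ 2))
      ((hm.aestronglyMeasurable.mul (Lp.aestronglyMeasurable _)).norm.pow 2)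
      (ae_of_all _ fun η => ?_)
    simp only [Pi.mul_apply]
    rw [norm_pow, norm_norm, hn, ← mul_assoc, ← hsq, ← mul_pow C]
    exact mul_le_mul_of_nonneg_right (pow_le_pow_left₀ (h.pos _).le (hb _).2 2) (sq_nonneg _)
  · rintro ⟨z, hz⟩
    have hi := (memLp_two_iff_integrable_sq_norm
      (hm.aestronglyMeasurable.mul (Lp.aestronglyMeasurable _))).1 hz.memLp
    refine Integrable.mono' (hi.const_mul ((c ^ 2)⁻¹))
      (hmb.aestronglyMeasurable.mul ((Lp.aestronglyMeasurable _).norm.pow 2))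
      (ae_of_all _ fun η => ?_)
    simp only [Pi.mul_apply]
    rw [hn, Real.norm_of_nonneg (mul_nonneg (Real.rpow_nonneg (br_pos _).le _) (sq_nonneg _)),
      ← mul_assoc, inv_mul_eq_div]
    refine mul_le_mul_of_nonneg_right ?_ (sq_nonneg _)
    rw [le_div_iff₀ (by positivity), ← hsq, ← mul_pow, mul_comm]
    exact pow_le_pow_left₀ (mul_nonneg hc.le (Real.rpow_nonneg (br_pos _).le _)) (hb _).1 2

lemma normH_equiv (h : Comparable (s / 2) k) : ∃ A > 0, ∀ f z : L2R,
    IsMul (fun ξ => (k ξ : ℂ)) f z → normH s f ≤ A * ‖z‖ ∧ ‖z‖ ≤ A * normH s f := by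
  obtain ⟨c, hc, C, hC, hb⟩ := h.bounds
  have hsq : ∀ ξ, (br ξ ^ (s / 2)) ^ 2 = br ξ ^ s := fun ξ => by
    rw [← Real.rpow_natCast, ← Real.rpow_mul (br_pos ξ).le]; congr 1; push_cast; ring
  set D := 2 * Real.pi
  have hD : 1 ≤ D := by have := Real.pi_gt_three; simp only [D]; linarith
  have hD0 : 0 < D := one_pos.trans_le hD
  -- The factor √(2π) comes from the change of frequency variable ξ = 2πη, in which `normH` is
  -- written.
  refine ⟨max (Real.sqrt D / c) C, lt_max_of_lt_right hC, fun f z hz => ?_⟩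
  have hbr : Comparable (s / 2) (fun ξ => br ξ ^ (s / 2)) :=
    ⟨measurable_br.pow_const _, fun ξ => by rw [br_neg], 1, one_pos, 1, one_pos,
      fun ξ => by simp⟩
  obtain ⟨y, hy⟩ := (hbr.memH_iff f).1 ((h.memH_iff f).2 ⟨z, hz⟩)
  have hyn : normH s f = Real.sqrt D * ‖y‖ := by
    rw [normH_eq_Fhat, Real.sqrt_mul hD0.le, ← Real.sqrt_sq (norm_nonneg y), norm_sq_eq_integral]
    congr 2
    refine integral_congr_ae ?_
    filter_upwards [hy] with x hx
    rw [hx, norm_mul, mul_pow, Complex.norm_real, Real.norm_eq_abs, sq_abs, hsq]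
  have hbn : ∀ ξ, 0 ≤ br ξ ^ (s / 2) := fun ξ => Real.rpow_nonneg (br_pos _).le _
  have h1 : ‖y‖ ≤ c⁻¹ * ‖z‖ := IsMul.norm_le (fun ξ => by
    rw [Complex.norm_real, Complex.norm_real, Real.norm_of_nonneg (hbn ξ),
      Real.norm_of_nonneg (h.pos ξ).le, inv_mul_eq_div, le_div_iff₀ hc, mul_comm]
    exact (hb ξ).1) hy hz
  have h2 : ‖z‖ ≤ C * ‖y‖ := IsMul.norm_le (fun ξ => by
    rw [Complex.norm_real, Complex.norm_real, Real.norm_of_nonneg (hbn ξ),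
      Real.norm_of_nonneg (h.pos ξ).le]
    exact (hb ξ).2) hz hy
  rw [hyn]
  constructor
  · calc Real.sqrt D * ‖y‖ ≤ Real.sqrt D * (c⁻¹ * ‖z‖) := by gcongr
      _ = Real.sqrt D / c * ‖z‖ := by ring
      _ ≤ _ := by gcongr; exact le_max_left _ _
  · calc ‖z‖ ≤ C * ‖y‖ := h2
      _ ≤ C * (Real.sqrt D * ‖y‖) := by
        gcongr
        exact le_mul_of_one_le_left (norm_nonneg _) (Real.one_le_sqrt.2 hD)
      _ ≤ _ := by gcongr; exact le_max_right _ _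

end Comparable

/-! ### The symbols of the first order system -/

/-- The symbol `(b/l)^{1/2}`. -/
def symM (l b : ℝ → ℝ) (ξ : ℝ) : ℝ := (b ξ) ^ (1 / 2 : ℝ) * (l ξ) ^ (-(1 / 2) : ℝ)

/-- The dispersion relation `ω = ξ l^{1/2}`. -/
def omega (l : ℝ → ℝ) (ξ : ℝ) : ℝ := ξ * (l ξ) ^ (1 / 2 : ℝ)

/-- The symbol `iξ b^{1/2}`. -/
def symK (b : ℝ → ℝ) (ξ : ℝ) : ℂ := Complex.I * (ξ * (b ξ) ^ (1 / 2 : ℝ) : ℝ)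

/-- The symbol `iξ b l^{-1/2}`. -/
def symNu (l b : ℝ → ℝ) (ξ : ℝ) : ℂ :=
  Complex.I * (ξ * ((b ξ) ^ (1 / 2 : ℝ) * ((b ξ) ^ (1 / 2 : ℝ) * (l ξ) ^ (-(1 / 2) : ℝ))) : ℝ)

/-- The symbol of the unitary group with generator `iω`. -/
def symS (l : ℝ → ℝ) (t : ℝ) (ξ : ℝ) : ℂ := Complex.exp ((t * omega l ξ : ℝ) * Complex.I)

lemma symNu_eq (l b : ℝ → ℝ) (ξ : ℝ) : symNu l b ξ = symK b ξ * symM l b ξ := by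
  simp only [symNu, symK, symM]; push_cast; ring

lemma rpow_half_mul {y : ℝ} (hy : 0 < y) : y ^ (1 / 2 : ℝ) * y ^ (1 / 2 : ℝ) = y := by
  rw [← Real.rpow_add hy]; norm_num

lemma rpow_half_mul_neg {y : ℝ} (hy : 0 < y) : y ^ (1 / 2 : ℝ) * y ^ (-(1 / 2) : ℝ) = 1 := by
  rw [← Real.rpow_add hy]; norm_num

namespace Admissible

variable {ρ r : ℝ} {l b : ℝ → ℝ} (h : Admissible ρ r l b)
include h

lemma comparable_l : Comparable (ρ / 2) l := h.ell.comparable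

lemma comparable_b : Comparable (-r / 2) b := h.ellB.comparable

lemma comparable_M : Comparable (-(r + ρ) / 4) (symM l b) :=
  ((h.comparable_b.rpow _).mul (h.comparable_l.rpow _)).congr_order (by ring)

lemma comparable_MInv : Comparable (s₀ ρ r / 2)
    (fun ξ => (b ξ) ^ (-(1 / 2) : ℝ) * (l ξ) ^ (1 / 2 : ℝ)) :=
  ((h.comparable_b.rpow _).mul (h.comparable_l.rpow _)).congr_order (by unfold s₀; ring)

lemma comparable_bInv : Comparable ((s₀ ρ r - ρ / 2) / 2) (fun ξ => (b ξ) ^ (-(1 / 2) : ℝ)) :=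
  (h.comparable_b.rpow _).congr_order (by unfold s₀; ring)

lemma comparable_bRoot : Comparable (-r / 4) (fun ξ => (b ξ) ^ (1 / 2 : ℝ)) :=
  (h.comparable_b.rpow _).congr_order (by ring)

lemma comparable_lRoot : Comparable (ρ / 4) (fun ξ => (l ξ) ^ (1 / 2 : ℝ)) :=
  (h.comparable_l.rpow _).congr_order (by ring)

lemma comparable_nu : Comparable (-(2 * r + ρ) / 4)
    (fun ξ => (b ξ) ^ (1 / 2 : ℝ) * ((b ξ) ^ (1 / 2 : ℝ) * (l ξ) ^ (-(1 / 2) : ℝ))) :=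
  ((h.comparable_b.rpow _).mul ((h.comparable_b.rpow _).mul (h.comparable_l.rpow _))).congr_order
    (by ring)

lemma bdd_M : ∃ C > 0, BddSymbol (fun ξ => (symM l b ξ : ℂ)) C :=
  h.comparable_M.bddSymbol (by have := h.embedding; linarith)

lemma bdd_bRoot : ∃ C > 0, BddSymbol (fun ξ => ((b ξ ^ (1 / 2 : ℝ) : ℝ) : ℂ)) C :=
  h.comparable_bRoot.bddSymbol (by have := h.nonneg_r; linarith)

lemma isMul_MInv_iff {u a : L2R} :
    IsMul (fun ξ => (((b ξ) ^ (-(1 / 2) : ℝ) * (l ξ) ^ (1 / 2 : ℝ) : ℝ) : ℂ)) u a ↔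
      IsMul (fun ξ => (symM l b ξ : ℂ)) a u := by
  have e : ∀ ξ, ((((b ξ) ^ (-(1 / 2) : ℝ) * (l ξ) ^ (1 / 2 : ℝ) : ℝ) : ℂ))⁻¹ =
      (symM l b ξ : ℂ) := fun ξ => by
    rw [← Complex.ofReal_inv, mul_inv, ← Real.rpow_neg (h.comparable_b.pos ξ).le,
      ← Real.rpow_neg (h.comparable_l.pos ξ).le, neg_neg, symM]
  constructor
  · exact fun hu => (hu.inv h.comparable_MInv.ne_zero).congr e
  · exact fun hu => (hu.inv h.comparable_M.ne_zero).congr fun ξ => by rw [← e, inv_inv]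

lemma isMul_bInv_iff {w c : L2R} :
    IsMul (fun ξ => (((b ξ) ^ (-(1 / 2) : ℝ) : ℝ) : ℂ)) w c ↔
      IsMul (fun ξ => ((b ξ ^ (1 / 2 : ℝ) : ℝ) : ℂ)) c w := by
  have e : ∀ ξ, ((((b ξ) ^ (-(1 / 2) : ℝ) : ℝ) : ℂ))⁻¹ =
      ((b ξ ^ (1 / 2 : ℝ) : ℝ) : ℂ) := fun ξ => by
    rw [← Complex.ofReal_inv, ← Real.rpow_neg (h.comparable_b.pos ξ).le, neg_neg]
  constructor
  · exact fun hu => (hu.inv h.comparable_bInv.ne_zero).congr e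
  · exact fun hu => (hu.inv h.comparable_bRoot.ne_zero).congr fun ξ => by rw [← e, inv_inv]

lemma measurable_omega : Measurable (omega l) :=
  measurable_id.mul (h.comparable_l.meas.pow_const _)

lemma omega_neg (ξ : ℝ) : omega l (-ξ) = -omega l ξ := by
  rw [omega, omega, h.comparable_l.even, neg_mul]

lemma bdd_S (t : ℝ) : BddSymbol (symS l t) 1 where
  meas := Complex.measurable_exp.comp ((Complex.measurable_ofReal.comp
    (h.measurable_omega.const_mul t)).mul_const _)
  herm ξ := by
    rw [symS, symS, ← Complex.exp_conj, map_mul, Complex.conj_ofReal, Complex.conj_I, h.omega_neg]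
    push_cast
    ring_nf
  bdd ξ := by rw [symS, Complex.norm_exp_ofReal_mul_I]

/-- The symbol is of size |ξ|^{1 - r - ρ/2} at high frequency, so this is where r + ρ/2 ≥ 1 enters.
-/
lemma bdd_nu : ∃ C > 0, BddSymbol (symNu l b) C := by
  obtain ⟨C, hC, hb⟩ := h.comparable_nu.norm_le
  refine ⟨C, hC, ?_, fun ξ => ?_, fun ξ => ?_⟩
  · exact measurable_const.mul (Complex.measurable_ofReal.comp
      (measurable_id.mul h.comparable_nu.meas))
  · rw [symNu, symNu, h.comparable_nu.even ξ, map_mul, Complex.conj_ofReal, Complex.conj_I]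
    push_cast
    ring
  · rw [symNu, norm_mul, Complex.norm_I, one_mul, Complex.ofReal_mul, norm_mul, Complex.norm_real,
      Real.norm_eq_abs]
    calc |ξ| * _ ≤ br ξ ^ (1 / 2 : ℝ) * (C * br ξ ^ (-(2 * r + ρ) / 4)) :=
          mul_le_mul (abs_le_br ξ) (hb ξ) (norm_nonneg _) (Real.rpow_nonneg (br_pos ξ).le _)
      _ = C * br ξ ^ (1 / 2 + -(2 * r + ρ) / 4) := by rw [Real.rpow_add (br_pos ξ)]; ring
      _ ≤ C := mul_le_of_le_one_right hC.le
          (Real.rpow_le_one_of_one_le_of_nonpos (one_le_br ξ)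
            (by have := h.smoothing; linarith))

lemma norm_symK_le : ∃ C > 0, ∀ ξ, ‖symK b ξ‖ ≤ C * br ξ ^ (1 / 2 - r / 4) := by
  obtain ⟨C, hC, hb⟩ := h.comparable_bRoot.norm_le
  refine ⟨C, hC, fun ξ => ?_⟩
  rw [symK, norm_mul, Complex.norm_I, one_mul, Complex.ofReal_mul, norm_mul, Complex.norm_real,
      Real.norm_eq_abs]
  calc |ξ| * _ ≤ br ξ ^ (1 / 2 : ℝ) * (C * br ξ ^ (-r / 4)) :=
        mul_le_mul (abs_le_br ξ) (hb ξ) (norm_nonneg _) (Real.rpow_nonneg (br_pos ξ).le _)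
    _ = C * br ξ ^ (1 / 2 - r / 4) := by
        rw [sub_eq_add_neg, Real.rpow_add (br_pos ξ), neg_div]; ring

lemma symK_herm (ξ : ℝ) : symK b (-ξ) = (starRingEnd ℂ) (symK b ξ) := by
  rw [symK, symK, h.comparable_b.even ξ, map_mul, Complex.conj_ofReal, Complex.conj_I]
  push_cast
  ring

lemma measurable_symK : Measurable (symK b) :=
  measurable_const.mul (Complex.measurable_ofReal.comp
    (measurable_id.mul h.comparable_bRoot.meas))

omit h in
lemma symK_conj (ξ : ℝ) : (starRingEnd ℂ) (symK b ξ) = -symK b ξ := by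
  rw [symK, map_mul, Complex.conj_ofReal, Complex.conj_I, neg_mul]

/-! ### The Sobolev embedding into bounded functions -/

/-- The square of the symbol is of size (1 + ξ²)^{-(r+ρ)/2}, integrable exactly because r + ρ > 1.
Cauchy–Schwarz then yields the embedding into bounded functions. -/
lemma memLp_M : MemLp (fun η : ℝ => (symM l b (2 * Real.pi * η) : ℂ)) 2 volume := by
  obtain ⟨C, hC, hb⟩ := h.comparable_M.norm_le
  have hm : Measurable (fun η : ℝ => (symM l b (2 * Real.pi * η) : ℂ)) :=
    Complex.measurable_ofReal.comp (h.comparable_M.meas.comp (measurable_const_mul _))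
  refine (memLp_two_iff_integrable_sq_norm hm.aestronglyMeasurable).2 ?_
  have h1 : Integrable (fun ξ : ℝ => (1 + ‖ξ‖ ^ 2) ^ (-(r + ρ) / 2)) :=
    integrable_rpow_neg_one_add_norm_sq (by simpa using h.embedding)
  have h2 := (integrable_comp_mul_left_iff (fun ξ : ℝ => (1 + ‖ξ‖ ^ 2) ^ (-(r + ρ) / 2))
    Real.two_pi_pos.ne').2 h1
  refine Integrable.mono' (h2.const_mul (C ^ 2)) (hm.norm.pow_const 2).aestronglyMeasurable
    (ae_of_all _ fun η => ?_)
  rw [norm_pow, norm_norm]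
  refine (pow_le_pow_left₀ (norm_nonneg _) (hb _) 2).trans (le_of_eq ?_)
  rw [mul_pow, ← Real.rpow_natCast (_ ^ _), ← Real.rpow_mul (br_pos _).le, br, Real.norm_eq_abs,
    sq_abs]
  congr 2
  push_cast
  ring

/-- `H^{s₀}(ℝ)` embeds into the bounded functions. -/
lemma sobolev : ∃ C > 0, ∀ a : L2R, ∀ᵐ x : ℝ, |Mop (fun ξ => (symM l b ξ : ℂ)) a x| ≤ C * ‖a‖ := by
  obtain ⟨D, hD, hM⟩ := h.bdd_M
  set N : ℝ := (∫ η : ℝ, ‖(symM l b (2 * Real.pi * η) : ℂ)‖ ^ (2 : ℝ)) ^ (1 / 2 : ℝ) with hN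
  have hN0 : 0 ≤ N := by positivity
  -- The added 1 only serves to make the constant positive.
  refine ⟨N + 1, by positivity, fun a => ?_⟩
  set u := Mop (fun ξ => (symM l b ξ : ℂ)) a with hu
  have hFu : (Fhat u : ℝ → ℂ) =ᵐ[volume] fun η => (symM l b (2 * Real.pi * η) : ℂ) * Fhat a η :=
    hM.isMul a
  have hint : Integrable (Fhat u : ℝ → ℂ) :=
    (h.memLp_M.integrable_mul (Lp.memLp (Fhat a))).congr hFu.symm
  have hinv : (toComplex u : ℝ → ℂ) =ᵐ[volume] 𝓕⁻ (Fhat u : ℝ → ℂ) := by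
    have := fourierInv_ae_eq _ hint
    rwa [Fhat, FourierTransform.fourierInv_fourier_eq] at this
  have hle : ∫ η, ‖(Fhat u : ℝ → ℂ) η‖ ≤ N * ‖a‖ := by
    have h1 : ∫ η, ‖(Fhat u : ℝ → ℂ) η‖ =
        ∫ η, ‖(symM l b (2 * Real.pi * η) : ℂ)‖ * ‖(Fhat a : ℝ → ℂ) η‖ := by
      refine integral_congr_ae ?_
      filter_upwards [hFu] with x hx
      rw [hx, norm_mul]
    have h2 := integral_mul_norm_le_Lp_mul_Lq (μ := volume) (p := 2) (q := 2)
      (Real.HolderConjugate.two_two) (f := fun η : ℝ => (symM l b (2 * Real.pi * η) : ℂ))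
      (g := (Fhat a : ℝ → ℂ)) (by simpa using h.memLp_M) (by simpa using Lp.memLp (Fhat a))
    rw [h1]
    refine h2.trans (le_of_eq ?_)
    congr 1
    rw [← Real.sqrt_eq_rpow, ← Real.sqrt_sq (norm_nonneg a), norm_sq_eq_integral]
    norm_num
  filter_upwards [hinv, toComplex_ae u] with x h1 h2
  have h3 : |u x| = ‖𝓕⁻ (Fhat u : ℝ → ℂ) x‖ := by
    rw [← h1, h2, Complex.norm_real, Real.norm_eq_abs]
  rw [h3, Real.fourierInv_eq]
  refine (norm_integral_le_integral_norm _).trans ?_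
  simp_rw [Circle.norm_smul]
  refine hle.trans ?_
  gcongr
  linarith

end Admissible

/-! ### Difference quotients and fractional derivatives -/

/-- The translation `f(x + h)` of a real function. -/
def shift (h : ℝ) (f : L2R) : L2R :=
  Lp.compMeasurePreserving (fun x : ℝ => x + h) (measurePreserving_add_right volume h) f

lemma shift_ae (h : ℝ) (f : L2R) : shift h f =ᵐ[volume] fun x => f (x + h) :=
  Lp.coeFn_compMeasurePreserving f (measurePreserving_add_right volume h)

lemma isMul_shift_sub (h : ℝ) (f : L2R) :
    IsMul (fun ξ => Complex.exp ((h * ξ : ℝ) * Complex.I) - 1) f (shift h f - f) := by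
  have h1 : toComplex (shift h f) = shiftC h (toComplex f) := by
    apply Lp.ext
    have := (measurePreserving_add_right (volume : Measure ℝ) h).quasiMeasurePreserving.ae
      (toComplex_ae f)
    filter_upwards [toComplex_ae (shift h f), shift_ae h f, shiftC_ae h (toComplex f), this]
      with x h1 h2 h3 h4
    rw [h1, h2, h3, h4]
  rw [IsMul, Fhat_sub]
  filter_upwards [Lp.coeFn_sub (Fhat (shift h f)) (Fhat f), fourier_shift h (toComplex f)]
    with x h2 h3
  rw [h2, Pi.sub_apply, Fhat, h1, h3, Fhat, sub_mul, one_mul, mul_comm h]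

lemma enorm_sq_eq_lintegral (f : L2R) : ‖f‖ₑ ^ 2 = ∫⁻ η, ‖(Fhat f : ℝ → ℂ) η‖ₑ ^ 2 := by
  have h1 : ‖f‖ₑ ^ 2 = ENNReal.ofReal (‖f‖ ^ 2) := by
    rw [ENNReal.ofReal_pow (norm_nonneg _), ofReal_norm]
  rw [h1, norm_sq_eq_integral, ofReal_integral_eq_lintegral_ofReal (integrable_norm_sq_Fhat f)
    (ae_of_all _ fun _ => by positivity)]
  refine lintegral_congr fun η => ?_
  rw [ENNReal.ofReal_pow (norm_nonneg _), ofReal_norm]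

/-- The squared size of the symbol of the difference operator. -/
def diffSym (y : ℝ) : ℝ := ‖Complex.exp (y * Complex.I) - 1‖ ^ 2

lemma diffSym_nonneg (y : ℝ) : 0 ≤ diffSym y := sq_nonneg _

lemma continuous_diffSym : Continuous diffSym := by unfold diffSym; fun_prop

lemma diffSym_neg (y : ℝ) : diffSym (-y) = diffSym y := by
  unfold diffSym
  rw [← Complex.norm_conj (Complex.exp (y * Complex.I) - 1), map_sub, ← Complex.exp_conj, map_mul,
    Complex.conj_ofReal, Complex.conj_I, map_one]
  push_cast
  ring_nf

lemma diffSym_le_sq (y : ℝ) : diffSym y ≤ y ^ 2 := by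
  unfold diffSym
  have := Real.norm_exp_I_mul_ofReal_sub_one_le (x := y)
  rw [mul_comm] at this
  calc _ ≤ ‖y‖ ^ 2 := pow_le_pow_left₀ (norm_nonneg _) this 2
    _ = y ^ 2 := by rw [Real.norm_eq_abs, sq_abs]

lemma diffSym_le_four (y : ℝ) : diffSym y ≤ 4 := by
  unfold diffSym
  have : ‖Complex.exp (y * Complex.I) - 1‖ ≤ 2 := by
    refine (norm_sub_le _ _).trans ?_
    rw [Complex.norm_exp_ofReal_mul_I, norm_one]; norm_num
  nlinarith [norm_nonneg (Complex.exp (y * Complex.I) - 1)]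

lemma lintegral_diffSym_eq (h : ℝ) (f : L2R) :
    ∫⁻ η, ENNReal.ofReal (diffSym (h * (2 * Real.pi * η))) * ‖(Fhat f : ℝ → ℂ) η‖ₑ ^ 2 =
      ‖shift h f - f‖ₑ ^ 2 := by
  rw [enorm_sq_eq_lintegral]
  refine lintegral_congr_ae ?_
  filter_upwards [isMul_shift_sub h f] with x hx
  rw [hx, enorm_mul, mul_pow, diffSym, ENNReal.ofReal_pow (norm_nonneg _), ofReal_norm]

/-- Near 0 the factor |e^{iy} - 1|² is at most y² and σ < 1 suffices; near infinity it is at most 4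
and σ > 0 suffices. -/
lemma integrableOn_diffSym {σ : ℝ} (h0 : 0 < σ) (h1 : σ < 1) :
    IntegrableOn (fun y : ℝ => y ^ (-1 - 2 * σ) * diffSym y) (Ioi 0) := by
  have hmeas : Measurable (fun y : ℝ => y ^ (-1 - 2 * σ) * diffSym y) :=
    (measurable_id.pow_const _).mul continuous_diffSym.measurable
  rw [← Ioc_union_Ioi_eq_Ioi (zero_le_one (α := ℝ))]
  refine IntegrableOn.union ?_ ?_
  · have h2 : IntegrableOn (fun y : ℝ => y ^ (1 - 2 * σ)) (Ioc 0 1) :=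
      (intervalIntegrable_iff_integrableOn_Ioc_of_le zero_le_one).1
        (intervalIntegral.intervalIntegrable_rpow' (by linarith))
    refine Integrable.mono' h2 hmeas.aestronglyMeasurable ?_
    filter_upwards [ae_restrict_mem measurableSet_Ioc] with y hy
    rw [Real.norm_of_nonneg (mul_nonneg (Real.rpow_nonneg hy.1.le _) (diffSym_nonneg y))]
    calc _ ≤ y ^ (-1 - 2 * σ) * y ^ 2 :=
          mul_le_mul_of_nonneg_left (diffSym_le_sq y) (Real.rpow_nonneg hy.1.le _)
      _ = y ^ (1 - 2 * σ) := by
          rw [← Real.rpow_natCast, ← Real.rpow_add hy.1]; congr 1; push_cast; ring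
  · have h2 : IntegrableOn (fun y : ℝ => y ^ (-1 - 2 * σ)) (Ioi 1) :=
      integrableOn_Ioi_rpow_of_lt (by linarith) one_pos
    refine Integrable.mono' (h2.const_mul 4) hmeas.aestronglyMeasurable ?_
    filter_upwards [ae_restrict_mem measurableSet_Ioi] with y hy
    have hy0 : (0 : ℝ) ≤ y := zero_le_one.trans (le_of_lt hy)
    rw [Real.norm_of_nonneg (mul_nonneg (Real.rpow_nonneg hy0 _) (diffSym_nonneg y)), mul_comm]
    exact mul_le_mul_of_nonneg_right (diffSym_le_four y) (Real.rpow_nonneg hy0 _)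

/-- The substitution y = hξ extracts the power of |ξ| and leaves c = ∫₀^∞ y^{-1-2σ} |e^{iy} - 1|²
dy. This is positive since sin y ≠ 0 on (0, π). It is the Fourier form of the Gagliardo seminorm. -/
lemma exists_lintegral_diffSym {σ : ℝ} (h0 : 0 < σ) (h1 : σ < 1) :
    ∃ c : ENNReal, c ≠ 0 ∧ c ≠ ⊤ ∧ ∀ ξ : ℝ,
      ∫⁻ h in Ioi (0 : ℝ), ENNReal.ofReal (h ^ (-1 - 2 * σ)) * ENNReal.ofReal (diffSym (h * ξ)) =
        c * ENNReal.ofReal (|ξ| ^ (2 * σ)) := by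
  set F : ℝ → ℝ := fun y => y ^ (-1 - 2 * σ) * diffSym y with hF
  have hFi := integrableOn_diffSym h0 h1
  have hFnn : ∀ y ∈ Ioi (0 : ℝ), 0 ≤ F y := fun y hy =>
    mul_nonneg (Real.rpow_nonneg (le_of_lt hy) _) (diffSym_nonneg y)
  have hpos : 0 < ∫ y in Ioi (0 : ℝ), F y := by
    rw [setIntegral_pos_iff_support_of_nonneg_ae
      (by filter_upwards [ae_restrict_mem measurableSet_Ioi] with y hy using hFnn y hy) hFi]
    have hsub : Ioo (0 : ℝ) Real.pi ⊆ Function.support F ∩ Ioi 0 := by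
      intro y hy
      refine ⟨?_, hy.1⟩
      rw [Function.mem_support]
      refine (mul_pos (Real.rpow_pos_of_pos hy.1 _) (pow_pos (norm_pos_iff.2 fun h => ?_) 2)).ne'
      have h3 := congrArg Complex.im (sub_eq_zero.1 h)
      rw [Complex.exp_ofReal_mul_I_im, Complex.one_im] at h3
      exact (Real.sin_pos_of_pos_of_lt_pi hy.1 hy.2).ne' h3
    refine lt_of_lt_of_le ?_ (measure_mono hsub)
    rw [Real.volume_Ioo]
    simpa using Real.pi_pos
  refine ⟨ENNReal.ofReal (∫ y in Ioi (0 : ℝ), F y), by simpa using hpos, ENNReal.ofReal_ne_top, ?_⟩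
  have key : ∀ ξ : ℝ, 0 < ξ →
      ∫⁻ h in Ioi (0 : ℝ), ENNReal.ofReal (h ^ (-1 - 2 * σ)) * ENNReal.ofReal (diffSym (h * ξ)) =
        ENNReal.ofReal (∫ y in Ioi (0 : ℝ), F y) * ENNReal.ofReal (|ξ| ^ (2 * σ)) := by
    intro ξ hξ
    have e : ∀ h ∈ Ioi (0 : ℝ), h ^ (-1 - 2 * σ) * diffSym (h * ξ) =
        ξ ^ (1 + 2 * σ) * F (ξ * h) := fun h hh => by
      change _ = ξ ^ (1 + 2 * σ) * ((ξ * h) ^ (-1 - 2 * σ) * diffSym (ξ * h))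
      rw [Real.mul_rpow hξ.le (le_of_lt hh), mul_comm ξ h, ← mul_assoc, ← mul_assoc,
        ← Real.rpow_add hξ]
      have : 1 + 2 * σ + (-1 - 2 * σ) = 0 := by ring
      rw [this, Real.rpow_zero, one_mul]
    have hi : IntegrableOn (fun h => ξ ^ (1 + 2 * σ) * F (ξ * h)) (Ioi 0) := by
      refine Integrable.const_mul ?_ _
      exact (integrableOn_Ioi_comp_mul_left_iff F 0 hξ).2 (by simpa using hFi)
    calc _ = ∫⁻ h in Ioi (0 : ℝ), ENNReal.ofReal (ξ ^ (1 + 2 * σ) * F (ξ * h)) := by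
          refine setLIntegral_congr_fun measurableSet_Ioi fun h hh => ?_
          rw [← ENNReal.ofReal_mul (Real.rpow_nonneg (le_of_lt hh) _), e h hh]
      _ = ENNReal.ofReal (∫ h in Ioi (0 : ℝ), ξ ^ (1 + 2 * σ) * F (ξ * h)) := by
          rw [ofReal_integral_eq_lintegral_ofReal hi]
          filter_upwards [ae_restrict_mem measurableSet_Ioi] with y hy
          exact mul_nonneg (Real.rpow_nonneg hξ.le _) (hFnn _ (mul_pos hξ hy))
      _ = _ := by
          rw [integral_const_mul, integral_comp_mul_left_Ioi F 0 hξ, mul_zero, smul_eq_mul,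
            ← ENNReal.ofReal_mul hpos.le, abs_of_pos hξ]
          congr 1
          rw [← mul_assoc, ← Real.rpow_neg_one, ← Real.rpow_add hξ, mul_comm]
          congr 2
          ring
  intro ξ
  rcases lt_trichotomy ξ 0 with hξ | hξ | hξ
  · have := key (-ξ) (neg_pos.2 hξ)
    simp only [mul_neg, diffSym_neg, abs_neg] at this
    exact this
  · subst hξ
    have h00 : diffSym 0 = 0 := by simp [diffSym]
    have : (0 : ℝ) ^ (2 * σ) = 0 := Real.zero_rpow (by positivity)
    simp [h00, this]
  · exact key ξ hξ

lemma measurable_enorm_Fhat_sq (f : L2R) :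
    AEMeasurable (fun η => ‖(Fhat f : ℝ → ℂ) η‖ₑ ^ 2) volume :=
  (Lp.aestronglyMeasurable (Fhat f)).enorm.pow_const 2

/-- Pointwise domination of differences implies domination of fractional derivatives. -/
lemma lintegral_rpow_le_of_shift_le {f u : L2R} {K : ENNReal} (hKt : K ≠ ⊤)
    (hK : ∀ h, ‖shift h f - f‖ₑ ^ 2 ≤ K * ‖shift h u - u‖ₑ ^ 2) {σ : ℝ} (h0 : 0 < σ) (h1 : σ ≤ 1) :
    ∫⁻ η, ENNReal.ofReal (|2 * Real.pi * η| ^ (2 * σ)) * ‖(Fhat f : ℝ → ℂ) η‖ₑ ^ 2 ≤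
      K * ∫⁻ η, ENNReal.ofReal (|2 * Real.pi * η| ^ (2 * σ)) * ‖(Fhat u : ℝ → ℂ) η‖ₑ ^ 2 := by
  rcases h1.lt_or_eq with h1 | rfl
  -- For σ < 1 the hypothesis is integrated over h > 0 against h^{-1-2σ}. Tonelli and the scaling
  -- formula turn both sides into c times the fractional seminorm.
  · obtain ⟨c, hc0, hct, hc⟩ := exists_lintegral_diffSym h0 h1
    have hmd : Measurable (fun z : ℝ × ℝ =>
        ENNReal.ofReal (z.1 ^ (-1 - 2 * σ)) * ENNReal.ofReal (diffSym (z.1 * (2 * Real.pi * z.2)))) := by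
      have e1 : Measurable (fun z : ℝ × ℝ => ENNReal.ofReal (z.1 ^ (-1 - 2 * σ))) :=
        ENNReal.measurable_ofReal.comp (measurable_fst.pow_const _)
      have e2 : Measurable
          (fun z : ℝ × ℝ => ENNReal.ofReal (diffSym (z.1 * (2 * Real.pi * z.2)))) :=
        ENNReal.measurable_ofReal.comp (continuous_diffSym.measurable.comp (by fun_prop))
      exact e1.mul e2
    have key : ∀ v : L2R,
        c * ∫⁻ η, ENNReal.ofReal (|2 * Real.pi * η| ^ (2 * σ)) * ‖(Fhat v : ℝ → ℂ) η‖ₑ ^ 2 =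
        ∫⁻ h in Ioi (0 : ℝ), ENNReal.ofReal (h ^ (-1 - 2 * σ)) * ‖shift h v - v‖ₑ ^ 2 := fun v => by
      calc _ = ∫⁻ η, ∫⁻ h in Ioi (0 : ℝ), ENNReal.ofReal (h ^ (-1 - 2 * σ)) *
              ENNReal.ofReal (diffSym (h * (2 * Real.pi * η))) * ‖(Fhat v : ℝ → ℂ) η‖ₑ ^ 2 := by
            rw [← lintegral_const_mul' _ _ hct]
            refine lintegral_congr fun η => ?_
            rw [lintegral_mul_const' _ _ (ENNReal.pow_ne_top enorm_ne_top), hc, mul_assoc c]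
        _ = ∫⁻ h in Ioi (0 : ℝ), ∫⁻ η, ENNReal.ofReal (h ^ (-1 - 2 * σ)) *
              ENNReal.ofReal (diffSym (h * (2 * Real.pi * η))) * ‖(Fhat v : ℝ → ℂ) η‖ₑ ^ 2 := by
            rw [lintegral_lintegral_swap]
            exact ((hmd.comp measurable_swap).aemeasurable).mul
              (measurable_enorm_Fhat_sq v).comp_fst
        _ = _ := by
            refine lintegral_congr fun h => ?_
            rw [← lintegral_diffSym_eq, ← lintegral_const_mul' _ _ ENNReal.ofReal_ne_top]
            simp_rw [mul_assoc]
    refine (ENNReal.mul_le_mul_iff_right hc0 hct).1 ?_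
    rw [key f, mul_left_comm, key u]
    calc _ ≤ ∫⁻ h in Ioi (0 : ℝ), K * (ENNReal.ofReal (h ^ (-1 - 2 * σ)) * ‖shift h u - u‖ₑ ^ 2) := by
          refine lintegral_mono fun h => ?_
          rw [mul_left_comm]
          exact mul_le_mul_right (hK h) _
      _ = _ := lintegral_const_mul' _ _ hKt
  -- For σ = 1 the Gagliardo weight is too singular. Difference quotients with steps 1/(n+1) replace
  -- it: Fatou bounds the seminorm of f from above, and |e^{iy} - 1|² ≤ y² handles u.
  · set d : ℕ → ℝ := fun n => 1 / ((n : ℝ) + 1) with hd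
    have hdpos : ∀ n, 0 < d n := fun n => Nat.one_div_pos_of_nat
    have hlim : ∀ ξ : ℝ, Tendsto (fun n => diffSym (d n * ξ) / d n ^ 2) atTop (𝓝 (|ξ| ^ (2 * (1 : ℝ)))) := by
      intro ξ
      have hder : HasDerivAt (fun y : ℝ => Complex.exp ((y * ξ : ℝ) * Complex.I)) (ξ * Complex.I) 0 := by
        have h1 : HasDerivAt (fun y : ℝ => ((y * ξ : ℝ) : ℂ) * Complex.I) (((1 * ξ : ℝ) : ℂ) * Complex.I) 0 :=
          (((hasDerivAt_id (0 : ℝ)).mul_const ξ).ofReal_comp).mul_const Complex.I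
        simpa using h1.cexp
      have h2 := hder.tendsto_slope_zero_right.comp
        (tendsto_nhdsWithin_iff.2 ⟨tendsto_one_div_add_atTop_nhds_zero_nat,
          Eventually.of_forall hdpos⟩)
      have h3 := (h2.norm).pow 2
      convert h3 using 2 with n
      · have e : ‖((n : ℂ) + 1)‖ = (n : ℝ) + 1 := by exact_mod_cast Complex.norm_natCast (n + 1)
        simp [diffSym, hd, mul_pow, div_eq_inv_mul, e]
      · rw [norm_mul, Complex.norm_I, mul_one, Complex.norm_real, Real.norm_eq_abs, mul_one]
        norm_num
    have hmd : ∀ n, Measurable (fun η => ENNReal.ofReal (diffSym (d n * (2 * Real.pi * η)) / d n ^ 2)) :=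
      fun n => ENNReal.measurable_ofReal.comp
        ((continuous_diffSym.measurable.comp (by fun_prop)).div_const _)
    have hn : ∀ (n : ℕ) (v : L2R), ∫⁻ η, ENNReal.ofReal (diffSym (d n * (2 * Real.pi * η)) / d n ^ 2) *
        ‖(Fhat v : ℝ → ℂ) η‖ₑ ^ 2 = ENNReal.ofReal ((d n ^ 2)⁻¹) * ‖shift (d n) v - v‖ₑ ^ 2 := by
      intro n v
      rw [← lintegral_diffSym_eq, ← lintegral_const_mul' _ _ ENNReal.ofReal_ne_top]
      refine lintegral_congr fun η => ?_
      rw [div_eq_inv_mul, ENNReal.ofReal_mul (by positivity), mul_assoc]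
    calc _ = ∫⁻ η, liminf (fun n => ENNReal.ofReal (diffSym (d n * (2 * Real.pi * η)) / d n ^ 2) *
          ‖(Fhat f : ℝ → ℂ) η‖ₑ ^ 2) atTop := by
          refine lintegral_congr fun η => ?_
          refine (Tendsto.liminf_eq ?_).symm
          exact ENNReal.Tendsto.mul_const
            ((ENNReal.continuous_ofReal.tendsto _).comp (hlim _))
            (Or.inr (ENNReal.pow_ne_top enorm_ne_top))
      _ ≤ liminf (fun n => ∫⁻ η, ENNReal.ofReal (diffSym (d n * (2 * Real.pi * η)) / d n ^ 2) *
          ‖(Fhat f : ℝ → ℂ) η‖ₑ ^ 2) atTop :=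
          lintegral_liminf_le' fun n => (hmd n).aemeasurable.mul (measurable_enorm_Fhat_sq f)
      _ ≤ _ := by
          refine liminf_le_of_le (by isBoundedDefault) fun y hy => ?_
          obtain ⟨n, hn'⟩ := hy.exists
          refine hn'.trans ?_
          rw [hn]
          calc _ ≤ ENNReal.ofReal ((d n ^ 2)⁻¹) * (K * ‖shift (d n) u - u‖ₑ ^ 2) :=
                mul_le_mul_right (hK _) _
            _ = K * ∫⁻ η, ENNReal.ofReal (diffSym (d n * (2 * Real.pi * η)) / d n ^ 2) *
                ‖(Fhat u : ℝ → ℂ) η‖ₑ ^ 2 := by rw [hn, mul_left_comm]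
            _ ≤ _ := by
                refine mul_le_mul_right (lintegral_mono fun η => mul_le_mul_left
                  (ENNReal.ofReal_le_ofReal ?_) _) _
                rw [div_le_iff₀ (pow_pos (hdpos n) 2), mul_one, Real.rpow_two, sq_abs, ← mul_pow,
                  mul_comm _ (d n)]
                exact diffSym_le_sq _

/-! ### The nonlinearity -/

lemma rpow_sub_rpow_le {p R x y : ℝ} (hp : 1 < p) (hx : 0 ≤ x) (hxR : x ≤ R) (hy : 0 ≤ y)
    (hyR : y ≤ R) : |x ^ p - y ^ p| ≤ p * R ^ (p - 1) * |x - y| := by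
  have h := (convex_Icc (0 : ℝ) R).norm_image_sub_le_of_norm_hasDerivWithin_le
    (f := fun t : ℝ => t ^ p) (f' := fun t => p * t ^ (p - 1)) (C := p * R ^ (p - 1))
    (fun t ht => (Real.hasDerivAt_rpow_const (Or.inr hp.le)).hasDerivWithinAt)
    (fun t ht => by
      rw [Real.norm_of_nonneg (mul_nonneg (by linarith) (Real.rpow_nonneg ht.1 _))]
      exact mul_le_mul_of_nonneg_left (Real.rpow_le_rpow ht.1 ht.2 (by linarith)) (by linarith))
    ⟨hy, hyR⟩ ⟨hx, hxR⟩
  simpa [Real.norm_eq_abs] using h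

lemma g_of_nonneg {p y : ℝ} (hp : 1 < p) (hy : 0 ≤ y) : g p y = -(y ^ p) := by
  rw [g, abs_of_nonneg hy]
  rcases hy.eq_or_lt with rfl | hy
  · rw [mul_zero, Real.zero_rpow (zero_lt_one.trans hp).ne']
  · rw [← Real.rpow_add_one hy.ne', sub_add_cancel]

lemma g_neg (p y : ℝ) : g p (-y) = -g p y := by simp [g]

lemma g_zero (p : ℝ) : g p 0 = 0 := by simp [g]

/-- For arguments of equal sign this is the mean value inequality for y^p, by oddness; for opposite
signs the comparison passes through 0, where |x - y| = |x| + |y|. -/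
lemma abs_g_sub_le {p R x y : ℝ} (hp : 1 < p) (hx : |x| ≤ R) (hy : |y| ≤ R) :
    |g p x - g p y| ≤ p * R ^ (p - 1) * |x - y| := by
  have hR : 0 ≤ R := (abs_nonneg x).trans hx
  have same : ∀ x y : ℝ, 0 ≤ x → 0 ≤ y → |x| ≤ R → |y| ≤ R →
      |g p x - g p y| ≤ p * R ^ (p - 1) * |x - y| := fun x y h1 h2 h3 h4 => by
    rw [g_of_nonneg hp h1, g_of_nonneg hp h2, ← abs_neg]
    have e : -(-(x ^ p) - -(y ^ p)) = x ^ p - y ^ p := by ring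
    rw [e]
    exact rpow_sub_rpow_le hp h1 (by rwa [abs_of_nonneg h1] at h3) h2
      (by rwa [abs_of_nonneg h2] at h4)
  have opp : ∀ x y : ℝ, 0 ≤ x → 0 ≤ y → |x| ≤ R → |y| ≤ R →
      |g p x + g p y| ≤ p * R ^ (p - 1) * (x + y) := fun x y h1 h2 h3 h4 => by
    have hb : ∀ z : ℝ, 0 ≤ z → |z| ≤ R → |g p z| ≤ p * R ^ (p - 1) * z := fun z hz hzR => by
      have := same z 0 hz le_rfl hzR (by simpa using hR)
      simpa [g_zero, abs_of_nonneg hz] using this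
    calc _ ≤ |g p x| + |g p y| := abs_add_le _ _
      _ ≤ _ := by linarith [hb x h1 h3, hb y h2 h4]
  rcases le_total 0 x with h1 | h1 <;> rcases le_total 0 y with h2 | h2
  · exact same x y h1 h2 hx hy
  · have := opp x (-y) h1 (by linarith) hx (by simpa using hy)
    rw [g_neg, ← sub_eq_add_neg, ← sub_eq_add_neg] at this
    rwa [abs_of_nonneg (by linarith : 0 ≤ x - y)]
  · have := opp y (-x) h2 (by linarith) hy (by simpa using hx)
    rw [g_neg, ← sub_eq_add_neg, ← sub_eq_add_neg] at this
    rwa [abs_sub_comm, abs_sub_comm x, abs_of_nonneg (by linarith : 0 ≤ y - x)]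
  · have := same (-x) (-y) (by linarith) (by linarith) (by simpa using hx) (by simpa using hy)
    rw [g_neg, g_neg] at this
    have e1 : |-g p x - -g p y| = |g p x - g p y| := by rw [← abs_neg]; congr 1; ring
    have e2 : |-x - -y| = |x - y| := by rw [← abs_neg]; congr 1; ring
    rwa [e1, e2] at this

/-- The nonlinearity truncated to `[-R, R]`. -/
def gTrunc (p R y : ℝ) : ℝ := g p (max (-R) (min R y))

/-- The Lipschitz constant of the nonlinearity on `[-R, R]`. -/
def lipConst (p R : ℝ) : NNReal := Real.toNNReal (p * R ^ (p - 1))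

lemma gTrunc_lipschitz {p R : ℝ} (hp : 1 < p) (hR : 0 ≤ R) :
    LipschitzWith (lipConst p R) (gTrunc p R) := by
  have hcl : ∀ y : ℝ, |max (-R) (min R y)| ≤ R := fun y =>
    abs_le.2 ⟨le_max_left _ _, max_le (by linarith) (min_le_left _ _)⟩
  refine LipschitzWith.of_dist_le_mul fun x y => ?_
  rw [Real.dist_eq, Real.dist_eq, lipConst,
    Real.coe_toNNReal _ (mul_nonneg (by linarith) (Real.rpow_nonneg hR _))]
  refine (abs_g_sub_le hp (hcl x) (hcl y)).trans ?_
  refine mul_le_mul_of_nonneg_left ?_ (mul_nonneg (by linarith) (Real.rpow_nonneg hR _))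
  refine (abs_max_sub_max_le_max _ _ _ _).trans ?_
  rw [sub_self, abs_zero, max_eq_right (abs_nonneg _)]
  refine (abs_min_sub_min_le_max _ _ _ _).trans ?_
  rw [sub_self, abs_zero, max_eq_right (abs_nonneg _)]

lemma gTrunc_zero {p R : ℝ} (hR : 0 ≤ R) : gTrunc p R 0 = 0 := by
  rw [gTrunc, min_eq_right hR, max_eq_right (by linarith), g_zero]

lemma gTrunc_eq {p R y : ℝ} (hy : |y| ≤ R) : gTrunc p R y = g p y := by
  rw [gTrunc, min_eq_right (abs_le.1 hy).2, max_eq_right (abs_le.1 hy).1]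

/-! ### Superposition operators on L² -/

open Classical in
/-- The superposition operator `u ↦ φ(u)` on `L²` (and `0` where `φ(u)` is not in `L²`). -/
def nonlin (φ : ℝ → ℝ) (u : L2R) : L2R :=
  if h : MemLp (fun x => φ (u x)) 2 volume then h.toLp _ else 0

lemma nonlin_congr {φ ψ : ℝ → ℝ} {u : L2R} (h : ∀ᵐ x, φ (u x) = ψ (u x)) :
    nonlin φ u = nonlin ψ u := by
  by_cases hφ : MemLp (fun x => φ (u x)) 2 volume
  · have hψ : MemLp (fun x => ψ (u x)) 2 volume := (memLp_congr_ae h).1 hφ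
    rw [nonlin, nonlin, dif_pos hφ, dif_pos hψ]
    exact MemLp.toLp_congr _ _ h
  · have hψ : ¬ MemLp (fun x => ψ (u x)) 2 volume := fun H => hφ ((memLp_congr_ae h).2 H)
    rw [nonlin, nonlin, dif_neg hφ, dif_neg hψ]

lemma nonlin_eq_compLp {φ : ℝ → ℝ} {K : NNReal} (hφ : LipschitzWith K φ) (h0 : φ 0 = 0)
    (u : L2R) : nonlin φ u = hφ.compLp h0 u := by
  have h : MemLp (fun x => φ (u x)) 2 volume := hφ.comp_memLp h0 (Lp.memLp u)
  rw [nonlin, dif_pos h]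
  exact Lp.ext (h.coeFn_toLp.trans (hφ.coeFn_compLp h0 u).symm)

lemma nonlin_ae {φ : ℝ → ℝ} {K : NNReal} (hφ : LipschitzWith K φ) (h0 : φ 0 = 0) (u : L2R) :
    nonlin φ u =ᵐ[volume] fun x => φ (u x) := by
  rw [nonlin_eq_compLp hφ h0]; exact hφ.coeFn_compLp h0 u

lemma norm_nonlin_sub_le {φ : ℝ → ℝ} {K : NNReal} (hφ : LipschitzWith K φ) (h0 : φ 0 = 0)
    (u v : L2R) : ‖nonlin φ u - nonlin φ v‖ ≤ K * ‖u - v‖ := by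
  rw [nonlin_eq_compLp hφ h0, nonlin_eq_compLp hφ h0]; exact hφ.norm_compLp_sub_le h0 u v

lemma norm_nonlin_le {φ : ℝ → ℝ} {K : NNReal} (hφ : LipschitzWith K φ) (h0 : φ 0 = 0)
    (u : L2R) : ‖nonlin φ u‖ ≤ K * ‖u‖ := by
  rw [nonlin_eq_compLp hφ h0]; exact hφ.norm_compLp_le h0 u

lemma shift_nonlin {φ : ℝ → ℝ} {K : NNReal} (hφ : LipschitzWith K φ) (h0 : φ 0 = 0) (h : ℝ)
    (u : L2R) : shift h (nonlin φ u) = nonlin φ (shift h u) := by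
  apply Lp.ext
  filter_upwards [shift_ae h (nonlin φ u), shift_ae h u, nonlin_ae hφ h0 (shift h u),
    (measurePreserving_add_right (volume : Measure ℝ) h).quasiMeasurePreserving.ae
      (nonlin_ae hφ h0 u)] with x h1 h2 h3 h4
  rw [h1, h3, h2, h4]

lemma enorm_shift_nonlin_le {φ : ℝ → ℝ} {K : NNReal} (hφ : LipschitzWith K φ) (h0 : φ 0 = 0)
    (h : ℝ) (u : L2R) :
    ‖shift h (nonlin φ u) - nonlin φ u‖ₑ ^ 2 ≤ (K : ENNReal) ^ 2 * ‖shift h u - u‖ₑ ^ 2 := by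
  rw [shift_nonlin hφ h0, ← mul_pow]
  gcongr
  have := norm_nonlin_sub_le hφ h0 (shift h u) u
  rw [← ofReal_norm, ← ofReal_norm, ← ENNReal.ofReal_coe_nnreal,
    ← ENNReal.ofReal_mul K.coe_nonneg]
  exact ENNReal.ofReal_le_ofReal this

lemma br_rpow_le_add {σ : ℝ} (h0 : 0 ≤ σ) (h1 : σ ≤ 1) (ξ : ℝ) :
    br ξ ^ σ ≤ 2 * (1 + |ξ| ^ (2 * σ)) := by
  have e : |ξ| ^ (2 * σ) = (ξ ^ 2) ^ σ := by
    rw [Real.rpow_mul (abs_nonneg _), Real.rpow_two, sq_abs]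
  have h2 : (2 : ℝ) ^ σ ≤ 2 := by
    simpa using Real.rpow_le_rpow_of_exponent_le (one_le_two (α := ℝ)) h1
  have hn : 0 ≤ (ξ ^ 2) ^ σ := Real.rpow_nonneg (sq_nonneg _) _
  rw [e]
  rcases le_total (ξ ^ 2) 1 with h | h
  · calc br ξ ^ σ ≤ 2 ^ σ := Real.rpow_le_rpow (br_pos ξ).le (by unfold br; linarith) h0
      _ ≤ _ := by linarith
  · calc br ξ ^ σ ≤ (2 * ξ ^ 2) ^ σ :=
          Real.rpow_le_rpow (br_pos ξ).le (by unfold br; linarith) h0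
      _ = 2 ^ σ * (ξ ^ 2) ^ σ := Real.mul_rpow zero_le_two (sq_nonneg _)
      _ ≤ 2 * (ξ ^ 2) ^ σ := by gcongr
      _ ≤ _ := by linarith

lemma add_le_br_rpow {σ : ℝ} (h0 : 0 ≤ σ) (ξ : ℝ) : 1 + |ξ| ^ (2 * σ) ≤ 2 * br ξ ^ σ := by
  have e : |ξ| ^ (2 * σ) = (ξ ^ 2) ^ σ := by
    rw [Real.rpow_mul (abs_nonneg _), Real.rpow_two, sq_abs]
  have h1 : (ξ ^ 2) ^ σ ≤ br ξ ^ σ :=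
    Real.rpow_le_rpow (sq_nonneg _) (by unfold br; linarith) h0
  have h2 : 1 ≤ br ξ ^ σ := Real.one_le_rpow (one_le_br ξ) h0
  rw [e]; linarith

namespace Admissible

variable {ρ r : ℝ} {l b : ℝ → ℝ} (h : Admissible ρ r l b)
include h

/-- For Lipschitz `φ`, the operator `u ↦ ∂ₓ B^{1/2} φ(u)` is bounded on the energy space. -/
lemma exists_nonlin : ∃ C > 0, ∀ (K : NNReal) (φ : ℝ → ℝ), LipschitzWith K φ → φ 0 = 0 →
    ∀ a : L2R, ∃ F, IsMul (symK b) (nonlin φ (Mop (fun ξ => (symM l b ξ : ℂ)) a)) F ∧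
      ‖F‖ ≤ C * K * ‖a‖ := by
  obtain ⟨D, hD, hM⟩ := h.bdd_M
  obtain ⟨E, hE, hκ⟩ := h.norm_symK_le
  -- If r ≥ 2, the operator ∂ₓB^{1/2} has order at most 0 and the L² bound for φ(u) is enough.
  rcases le_or_gt 2 r with hr | hr
  · have hb : BddSymbol (symK b) E := by
      refine ⟨h.measurable_symK, h.symK_herm, fun ξ => (hκ ξ).trans ?_⟩
      exact mul_le_of_le_one_right hE.le
        (Real.rpow_le_one_of_one_le_of_nonpos (one_le_br ξ) (by linarith))
    refine ⟨E * D, by positivity, fun K φ hφ h0 a => ⟨_, hb.isMul _, ?_⟩⟩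
    calc _ ≤ E * (K * (D * ‖a‖)) := by
          refine (hb.norm_le _).trans ?_
          gcongr
          refine (norm_nonlin_le hφ h0 _).trans ?_
          gcongr
          exact hM.norm_le a
      _ = _ := by ring
  obtain ⟨m, hm, hMm⟩ := h.comparable_M.norm_le
  -- The order of ∂ₓB^{1/2}. It lies in (0, 1], the range in which Lipschitz superposition acts on
  -- H^σ.
  set σ : ℝ := 1 - r / 2 with hσ
  have hσ0 : 0 < σ := by linarith
  have hσ1 : σ ≤ 1 := by have := h.nonneg_r; linarith
  refine ⟨2 * E * m, by positivity, fun K φ hφ h0 a => ?_⟩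
  set u := Mop (fun ξ => (symM l b ξ : ℂ)) a with hu
  set f := nonlin φ u with hf
  have hκ2 : ∀ ξ, ‖symK b ξ‖ ^ 2 ≤ 2 * E ^ 2 * (1 + |ξ| ^ (2 * σ)) := fun ξ => by
    calc ‖symK b ξ‖ ^ 2 ≤ (E * br ξ ^ (1 / 2 - r / 4)) ^ 2 :=
          pow_le_pow_left₀ (norm_nonneg _) (hκ ξ) 2
      _ = E ^ 2 * br ξ ^ σ := by
          rw [mul_pow, ← Real.rpow_natCast (_ ^ _), ← Real.rpow_mul (br_pos _).le, hσ]
          congr 2; push_cast; ring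
      _ ≤ E ^ 2 * (2 * (1 + |ξ| ^ (2 * σ))) := by gcongr; exact br_rpow_le_add hσ0.le hσ1 ξ
      _ = _ := by ring
  -- This says that M maps L² into H^σ, i.e. σ ≤ s₀, which is the condition r + ρ/2 ≥ 1.
  have hM2 : ∀ ξ, (1 + |ξ| ^ (2 * σ)) * ‖(symM l b ξ : ℂ)‖ ^ 2 ≤ 2 * m ^ 2 := fun ξ => by
    calc _ ≤ 2 * br ξ ^ σ * (m * br ξ ^ (-(r + ρ) / 4)) ^ 2 :=
          mul_le_mul (add_le_br_rpow hσ0.le ξ) (pow_le_pow_left₀ (norm_nonneg _) (hMm ξ) 2)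
            (by positivity) (by have := Real.rpow_nonneg (br_pos ξ).le σ; positivity)
      _ = 2 * m ^ 2 * br ξ ^ (σ - (r + ρ) / 2) := by
          rw [mul_pow, ← Real.rpow_natCast (_ ^ _), ← Real.rpow_mul (br_pos _).le,
            sub_eq_add_neg, Real.rpow_add (br_pos _)]
          have : -(r + ρ) / 4 * ((2 : ℕ) : ℝ) = -((r + ρ) / 2) := by push_cast; ring
          rw [this]; ring
      _ ≤ _ := mul_le_of_le_one_right (by positivity)
          (Real.rpow_le_one_of_one_le_of_nonpos (one_le_br ξ)
            (by have := h.smoothing; linarith))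
  have split : ∀ v : L2R, ∫⁻ η, ENNReal.ofReal (1 + |2 * Real.pi * η| ^ (2 * σ)) *
      ‖(Fhat v : ℝ → ℂ) η‖ₑ ^ 2 = ‖v‖ₑ ^ 2 +
        ∫⁻ η, ENNReal.ofReal (|2 * Real.pi * η| ^ (2 * σ)) * ‖(Fhat v : ℝ → ℂ) η‖ₑ ^ 2 := by
    intro v
    rw [enorm_sq_eq_lintegral, ← lintegral_add_left' (measurable_enorm_Fhat_sq v)]
    refine lintegral_congr fun η => ?_
    rw [ENNReal.ofReal_add zero_le_one (Real.rpow_nonneg (abs_nonneg _) _), ENNReal.ofReal_one,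
      add_mul, one_mul]
  have hweak : ∫⁻ η, ENNReal.ofReal (1 + |2 * Real.pi * η| ^ (2 * σ)) *
      ‖(Fhat f : ℝ → ℂ) η‖ₑ ^ 2 ≤ (K : ENNReal) ^ 2 *
        ∫⁻ η, ENNReal.ofReal (1 + |2 * Real.pi * η| ^ (2 * σ)) * ‖(Fhat u : ℝ → ℂ) η‖ₑ ^ 2 := by
    rw [split f, split u, mul_add]
    refine add_le_add ?_ (lintegral_rpow_le_of_shift_le (ENNReal.pow_ne_top ENNReal.coe_ne_top)
      (fun t => enorm_shift_nonlin_le hφ h0 t u) hσ0 hσ1)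
    rw [← mul_pow]
    gcongr
    rw [← ofReal_norm, ← ofReal_norm, ← ENNReal.ofReal_coe_nnreal,
      ← ENNReal.ofReal_mul K.coe_nonneg]
    exact ENNReal.ofReal_le_ofReal (norm_nonlin_le hφ h0 u)
  have hstrong : ∫⁻ η, ENNReal.ofReal (1 + |2 * Real.pi * η| ^ (2 * σ)) *
      ‖(Fhat u : ℝ → ℂ) η‖ₑ ^ 2 ≤ ENNReal.ofReal (2 * m ^ 2) * ‖a‖ₑ ^ 2 := by
    rw [enorm_sq_eq_lintegral, ← lintegral_const_mul' _ _ ENNReal.ofReal_ne_top]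
    refine lintegral_mono_ae ?_
    filter_upwards [hM.isMul a] with x hx
    rw [hx, enorm_mul, mul_pow, ← mul_assoc]
    gcongr
    rw [← ofReal_norm, ← ENNReal.ofReal_pow (norm_nonneg _), ← ENNReal.ofReal_mul (by positivity)]
    exact ENNReal.ofReal_le_ofReal (hM2 _)
  have htot : ∫⁻ η, ‖symK b (2 * Real.pi * η) * (Fhat f : ℝ → ℂ) η‖ₑ ^ 2 ≤
      ENNReal.ofReal ((2 * E * m * K * ‖a‖) ^ 2) := by
    calc _ ≤ ENNReal.ofReal (2 * E ^ 2) * ∫⁻ η, ENNReal.ofReal (1 + |2 * Real.pi * η| ^ (2 * σ)) *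
          ‖(Fhat f : ℝ → ℂ) η‖ₑ ^ 2 := by
          rw [← lintegral_const_mul' _ _ ENNReal.ofReal_ne_top]
          refine lintegral_mono fun η => ?_
          rw [enorm_mul, mul_pow, ← mul_assoc]
          gcongr
          rw [← ofReal_norm, ← ENNReal.ofReal_pow (norm_nonneg _),
            ← ENNReal.ofReal_mul (by positivity)]
          exact ENNReal.ofReal_le_ofReal (hκ2 _)
      _ ≤ ENNReal.ofReal (2 * E ^ 2) * ((K : ENNReal) ^ 2 *
          (ENNReal.ofReal (2 * m ^ 2) * ‖a‖ₑ ^ 2)) := by gcongr; exact hweak.trans (by gcongr)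
      _ = _ := by
          rw [← ofReal_norm, ← ENNReal.ofReal_coe_nnreal, ← ENNReal.ofReal_pow (norm_nonneg _),
            ← ENNReal.ofReal_pow K.coe_nonneg, ← ENNReal.ofReal_mul (by positivity),
            ← ENNReal.ofReal_mul (by positivity), ← ENNReal.ofReal_mul (by positivity)]
          congr 1; ring
  have hmem : MemLp (fun η : ℝ => symK b (2 * Real.pi * η) * (Fhat f : ℝ → ℂ) η) 2 volume := by
    refine ⟨((h.measurable_symK.comp (measurable_const_mul _)).aestronglyMeasurable).mul
      (Lp.aestronglyMeasurable _), ?_⟩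
    rw [eLpNorm_lt_top_iff_lintegral_rpow_enorm_lt_top (by norm_num) (by norm_num)]
    simp only [ENNReal.toReal_ofNat, ENNReal.rpow_two]
    exact htot.trans_lt ENNReal.ofReal_lt_top
  obtain ⟨F, hF⟩ := exists_isMul h.symK_herm f hmem
  refine ⟨F, hF, ?_⟩
  have h3 : ‖F‖ₑ ^ 2 ≤ ENNReal.ofReal ((2 * E * m * K * ‖a‖) ^ 2) := by
    rw [enorm_sq_eq_lintegral]
    refine (le_of_eq (lintegral_congr_ae ?_)).trans htot
    filter_upwards [hF] with x hx
    rw [hx]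
  rw [← ofReal_norm, ← ENNReal.ofReal_pow (norm_nonneg _),
    ENNReal.ofReal_le_ofReal_iff (by positivity)] at h3
  exact abs_le_of_sq_le_sq' h3 (by positivity) |>.2

end Admissible

/-! ### The unitary group and Duhamel's formula -/

/-- Dominated convergence on the Fourier side. -/
lemma tendsto_of_Fhat {ι : Type*} {L : Filter ι} [L.IsCountablyGenerated] {F : ι → L2R} {f : L2R}
    {Φ : ι → ℝ → ℂ} {φ : ℝ → ℂ} {G : ℝ → ℝ} (hG : MemLp G 2 volume)
    (hF : ∀ i, (Fhat (F i) : ℝ → ℂ) =ᵐ[volume] Φ i) (hf : (Fhat f : ℝ → ℂ) =ᵐ[volume] φ)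
    (hb : ∀ᶠ i in L, ∀ᵐ η, ‖Φ i η‖ ≤ G η) (hfb : ∀ᵐ η, ‖φ η‖ ≤ G η)
    (hlim : ∀ᵐ η, Tendsto (fun i => Φ i η) L (𝓝 (φ η))) : Tendsto F L (𝓝 f) := by
  rw [tendsto_iff_norm_sub_tendsto_zero]
  have hD : ∀ i, (Fhat (F i - f) : ℝ → ℂ) =ᵐ[volume] fun η => Φ i η - φ η := fun i => by
    rw [Fhat_sub]
    filter_upwards [hF i, hf, Lp.coeFn_sub (Fhat (F i)) (Fhat f)] with x h1 h2 h3
    rw [h3, Pi.sub_apply, h1, h2]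
  have hN : ∀ i, ‖F i - f‖ ^ 2 = ∫ η, ‖Φ i η - φ η‖ ^ 2 := fun i => by
    rw [norm_sq_eq_integral]
    refine integral_congr_ae ?_
    filter_upwards [hD i] with x hx
    rw [hx]
  have h2 : Tendsto (fun i => ∫ η, ‖Φ i η - φ η‖ ^ 2) L (𝓝 (∫ _ : ℝ, (0 : ℝ))) := by
    refine tendsto_integral_filter_of_dominated_convergence (fun η => 4 * G η ^ 2)
      (Eventually.of_forall fun i => ?_) ?_
      (((memLp_two_iff_integrable_sq hG.1).1 hG).const_mul 4) ?_
    · exact (((Lp.aestronglyMeasurable _).congr (hD i)).norm.pow 2)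
    · filter_upwards [hb] with i hi
      filter_upwards [hi, hfb] with x h1 h2
      rw [norm_pow, norm_norm]
      have h3 : ‖Φ i x - φ x‖ ≤ 2 * G x := (norm_sub_le _ _).trans (by linarith)
      calc _ ≤ (2 * G x) ^ 2 := pow_le_pow_left₀ (norm_nonneg _) h3 2
        _ = _ := by ring
    · filter_upwards [hlim] with x hx
      have := ((hx.sub_const (φ x)).norm).pow 2
      simpa using this
  simp_rw [← hN, integral_zero] at h2
  simpa [Real.sqrt_sq] using h2.sqrt

/-- The operator `(b/l)^{1/2}(D)`. -/
def MM (l b : ℝ → ℝ) : L2R →L[ℝ] L2R := Mop (fun ξ => (symM l b ξ : ℂ))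

/-- The unitary group with generator `iω(D)`. -/
def SS (l : ℝ → ℝ) (t : ℝ) : L2R →L[ℝ] L2R := Mop (symS l t)

/-- Duhamel's formula for `z' = e (iω z + F)`, `z(0) = z₀`. -/
def duh (l : ℝ → ℝ) (z₀ : L2R) (e : ℝ) (F : ℝ → L2R) (t : ℝ) : L2R :=
  SS l (e * t) (z₀ + e • ∫ s in (0 : ℝ)..t, SS l (-(e * s)) (F s))

/-- A forcing on `[0, T)` that is locally bounded, and continuous after application of `M`. -/
structure Forcing (l b : ℝ → ℝ) (T : ℝ) (F : ℝ → L2R) : Prop where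
  cont : ContinuousOn (fun s => MM l b (F s)) (Ico 0 T)
  bdd : ∀ t < T, ∃ K, ∀ s ∈ Icc 0 t, ‖F s‖ ≤ K

/-- Separability and the Borel structure are used to obtain measurability of forcings from their
images under M. -/
instance : SecondCountableTopology L2R :=
  haveI : Fact ((2 : ENNReal) ≠ ⊤) := ⟨ENNReal.ofNat_ne_top⟩
  Lp.SecondCountableTopology

instance : MeasurableSpace L2R := borel L2R

instance : BorelSpace L2R := ⟨rfl⟩

namespace Admissible

variable {ρ r : ℝ} {l b : ℝ → ℝ} (h : Admissible ρ r l b)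
include h

lemma isMul_MM (a : L2R) : IsMul (fun ξ => (symM l b ξ : ℂ)) a (MM l b a) := by
  obtain ⟨D, hD, hM⟩ := h.bdd_M
  exact hM.isMul a

lemma isMul_SS (t : ℝ) (a : L2R) : IsMul (symS l t) a (SS l t a) := (h.bdd_S t).isMul a

lemma MM_injective : Function.Injective (MM l b) := fun a a' e =>
  (h.isMul_MM a).cancel h.comparable_M.ne_zero (e ▸ h.isMul_MM a')

lemma inner_MM (f k : L2R) : (inner ℝ (MM l b f) k : ℝ) = inner ℝ f (MM l b k) :=
  (h.isMul_MM f).inner_eq (h.isMul_MM k) fun ξ => by rw [Complex.conj_ofReal]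

/-- M is self-adjoint and injective, so a vector orthogonal to its range is in its kernel. -/
lemma MM_denseRange : DenseRange (MM l b) := by
  have h1 : (LinearMap.range (MM l b : L2R →ₗ[ℝ] L2R)).topologicalClosure = ⊤ := by
    rw [Submodule.topologicalClosure_eq_top_iff, Submodule.eq_bot_iff]
    intro x hx
    have h2 : MM l b x = 0 := by
      rw [← inner_self_eq_zero (𝕜 := ℝ), ← h.inner_MM, real_inner_comm]
      have := (Submodule.mem_orthogonal _ x).1 hx (MM l b (MM l b x)) ⟨MM l b x, rfl⟩
      rwa [real_inner_comm] at this
    exact h.MM_injective (by rw [h2, map_zero])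
  have h3 := Submodule.dense_iff_topologicalClosure_eq_top.2 h1
  exact h3

lemma norm_SS (t : ℝ) (a : L2R) : ‖SS l t a‖ = ‖a‖ :=
  (h.isMul_SS t a).norm_eq fun ξ => by rw [symS, Complex.norm_exp_ofReal_mul_I]

lemma SS_add (s t : ℝ) (a : L2R) : SS l (s + t) a = SS l s (SS l t a) := by
  refine (h.isMul_SS (s + t) a).unique (((h.isMul_SS t a).comp (h.isMul_SS s _)).congr fun ξ => ?_)
  rw [symS, symS, symS, ← Complex.exp_add]
  push_cast
  ring_nf

lemma SS_zero (a : L2R) : SS l 0 a = a :=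
  (h.isMul_SS 0 a).unique ((IsMul.one a).congr fun ξ => by simp [symS])

lemma inner_SS (t : ℝ) (f k : L2R) : (inner ℝ (SS l t f) k : ℝ) = inner ℝ f (SS l (-t) k) :=
  (h.isMul_SS t f).inner_eq (h.isMul_SS (-t) k) fun ξ => by
    rw [symS, symS, ← Complex.exp_conj, map_mul, Complex.conj_ofReal, Complex.conj_I]
    push_cast
    ring_nf

lemma MM_SS (t : ℝ) (a : L2R) : MM l b (SS l t a) = SS l t (MM l b a) :=
  (h.isMul_MM _).unique ((h.isMul_MM a).map_Mop (h.bdd_S t))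

lemma continuous_SS (a : L2R) : Continuous fun t => SS l t a := by
  refine continuous_iff_continuousAt.2 fun t => ?_
  refine tendsto_of_Fhat (G := fun η => ‖(Fhat a : ℝ → ℂ) η‖) (Lp.memLp (Fhat a)).norm
    (fun s => h.isMul_SS s a) (h.isMul_SS t a)
    (Eventually.of_forall fun s => ae_of_all _ fun η => ?_) (ae_of_all _ fun η => ?_)
    (ae_of_all _ fun η => ?_)
  · rw [norm_mul, symS, Complex.norm_exp_ofReal_mul_I, one_mul]
  · rw [norm_mul, symS, Complex.norm_exp_ofReal_mul_I, one_mul]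
  · refine Tendsto.mul_const _ ?_
    have : Continuous fun s : ℝ => symS l s (2 * Real.pi * η) := by unfold symS; fun_prop
    exact this.tendsto t

lemma continuous_SS_uncurry : Continuous fun z : ℝ × L2R => SS l z.1 z.2 := by
  refine continuous_iff_continuousAt.2 fun ⟨t, a⟩ => ?_
  rw [ContinuousAt, tendsto_iff_norm_sub_tendsto_zero]
  have h1 : Tendsto (fun z : ℝ × L2R => ‖z.2 - a‖ + ‖SS l z.1 a - SS l t a‖) (𝓝 (t, a)) (𝓝 0) := by
    have c1 : Continuous fun z : ℝ × L2R => ‖z.2 - a‖ + ‖SS l z.1 a - SS l t a‖ :=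
      ((continuous_snd.sub continuous_const).norm).add
        ((((h.continuous_SS a).comp continuous_fst).sub continuous_const).norm)
    simpa using c1.tendsto (t, a)
  refine squeeze_zero (fun _ => norm_nonneg _) (fun z => ?_) h1
  calc ‖SS l z.1 z.2 - SS l t a‖ = ‖SS l z.1 (z.2 - a) + (SS l z.1 a - SS l t a)‖ := by
        rw [map_sub]; congr 1; abel
    _ ≤ _ := (norm_add_le _ _).trans (by rw [h.norm_SS])

/-- The difference quotients of e^{itω} are bounded by |ω|. Since ψ is in the domain of iω(D),
dominated convergence on the Fourier side gives a derivative in L². -/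
lemma hasDerivAt_SS {ψ χ : L2R} (hψ : IsMul (fun ξ => Complex.I * omega l ξ) ψ χ) (t : ℝ) :
    HasDerivAt (fun s => SS l s ψ) (SS l t χ) t := by
  rw [hasDerivAt_iff_tendsto_slope_zero]
  refine tendsto_of_Fhat (G := fun η => ‖(Fhat χ : ℝ → ℂ) η‖) (Lp.memLp (Fhat χ)).norm
    (Φ := fun s η => ((s⁻¹ : ℝ) : ℂ) * (symS l (t + s) (2 * Real.pi * η) -
      symS l t (2 * Real.pi * η)) * Fhat ψ η)
    (φ := fun η => symS l t (2 * Real.pi * η) * (Complex.I * omega l (2 * Real.pi * η) * Fhat ψ η))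
    (fun s => ?_) ?_ (Eventually.of_forall fun s => ?_) ?_ ?_
  · rw [Fhat_smul]
    have := (h.isMul_SS (t + s) ψ).add_symbol (h.isMul_SS t ψ).neg_symbol
    rw [← sub_eq_add_neg] at this
    filter_upwards [this, Lp.coeFn_smul ((s⁻¹ : ℝ) : ℂ) (Fhat (SS l (t + s) ψ - SS l t ψ))]
      with x h1 h2
    rw [h2, Pi.smul_apply, h1, smul_eq_mul]
    ring
  · filter_upwards [h.isMul_SS t χ, hψ] with x h1 h2
    rw [h1, h2]
  · filter_upwards [hψ] with x hx
    rw [hx, norm_mul _ ((Fhat ψ : ℝ → ℂ) x), norm_mul _ ((Fhat ψ : ℝ → ℂ) x)]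
    refine mul_le_mul_of_nonneg_right ?_ (norm_nonneg _)
    set w := omega l (2 * Real.pi * x)
    have e : symS l (t + s) (2 * Real.pi * x) - symS l t (2 * Real.pi * x) =
        symS l t (2 * Real.pi * x) * (Complex.exp (Complex.I * (s * w : ℝ)) - 1) := by
      rw [symS, symS, mul_sub, ← Complex.exp_add, mul_one]
      congr 2
      push_cast
      ring
    rw [e, norm_mul, norm_mul (symS _ _ _), symS, Complex.norm_exp_ofReal_mul_I, one_mul, norm_mul,
      Complex.norm_I, one_mul, Complex.norm_real, Complex.norm_real]
    rcases eq_or_ne s 0 with rfl | hs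
    · simp
    · calc ‖s⁻¹‖ * ‖Complex.exp (Complex.I * ((s * w : ℝ) : ℂ)) - 1‖ ≤ ‖s⁻¹‖ * ‖s * w‖ := by
            exact mul_le_mul_of_nonneg_left Real.norm_exp_I_mul_ofReal_sub_one_le (norm_nonneg _)
        _ = ‖w‖ := by rw [norm_mul, ← mul_assoc, norm_inv, inv_mul_cancel₀ (norm_ne_zero_iff.2 hs), one_mul]
  · filter_upwards [hψ] with x hx
    rw [norm_mul, symS, Complex.norm_exp_ofReal_mul_I, one_mul, hx]
  · refine ae_of_all _ fun x => ?_
    rw [← mul_assoc]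
    refine Tendsto.mul_const _ ?_
    have hder : HasDerivAt (fun s : ℝ => symS l s (2 * Real.pi * x))
        (symS l t (2 * Real.pi * x) * (Complex.I * omega l (2 * Real.pi * x))) t := by
      have h1 : HasDerivAt (fun s : ℝ => ((s * omega l (2 * Real.pi * x) : ℝ) : ℂ) * Complex.I)
          (((1 * omega l (2 * Real.pi * x) : ℝ) : ℂ) * Complex.I) t :=
        (((hasDerivAt_id t).mul_const _).ofReal_comp).mul_const Complex.I
      refine h1.cexp.congr_deriv ?_
      rw [symS, one_mul, mul_comm Complex.I]
    have := hder.tendsto_slope_zero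
    simpa [Complex.real_smul] using this

/-! ### Properties of Duhamel's formula -/

/-- An injective continuous map between Polish spaces is a measurable embedding (Lusin–Souslin), so
F inherits measurability from M F. Strong continuity of F itself is not available. -/
lemma aestronglyMeasurable_of_MM {s : Set ℝ} (hs : MeasurableSet s) {F : ℝ → L2R}
    (hF : ContinuousOn (fun t => MM l b (F t)) s) :
    AEMeasurable F (volume.restrict s) := by
  have hme : MeasurableEmbedding (MM l b) :=
    (MM l b).continuous.measurableEmbedding h.MM_injective
  exact (hme.aemeasurable_comp_iff (f := F)).1 (hF.aemeasurable hs)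

lemma aestronglyMeasurable_SS {μ : Measure ℝ} {e : ℝ} {F : ℝ → L2R} (hF : AEMeasurable F μ) :
    AEStronglyMeasurable (fun s => SS l (-(e * s)) (F s)) μ := by
  refine AEMeasurable.aestronglyMeasurable ?_
  have h1 : Measurable fun z : ℝ × L2R => SS l z.1 z.2 := h.continuous_SS_uncurry.measurable
  exact Measurable.comp_aemeasurable (g := fun z : ℝ × L2R => SS l z.1 z.2)
    (f := fun s => (-(e * s), F s)) h1 (((measurable_id.const_mul e).neg.aemeasurable).prodMk hF)

lemma _root_.NonlocalWave.Forcing.intervalIntegrable {T : ℝ} {F : ℝ → L2R} (hF : Forcing l b T F)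
    (e : ℝ) {s t : ℝ} (hs : s ∈ Ico 0 T) (ht : t ∈ Ico 0 T) :
    IntervalIntegrable (fun s => SS l (-(e * s)) (F s)) volume s t := by
  have key : ∀ t ∈ Ico 0 T, IntervalIntegrable (fun s => SS l (-(e * s)) (F s)) volume 0 t := by
    intro t ht
    obtain ⟨K, hK⟩ := hF.bdd t ht.2
    rw [intervalIntegrable_iff_integrableOn_Ioc_of_le ht.1]
    have hm : AEMeasurable F (volume.restrict (Ioc 0 t)) :=
      h.aestronglyMeasurable_of_MM measurableSet_Ioc
        (hF.cont.mono fun x hx => ⟨hx.1.le, hx.2.trans_lt ht.2⟩)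
    refine Integrable.mono' (integrable_const K) (h.aestronglyMeasurable_SS hm) ?_
    filter_upwards [ae_restrict_mem measurableSet_Ioc] with x hx
    rw [h.norm_SS]
    exact hK x ⟨hx.1.le, hx.2⟩
  exact (key s hs).symm.trans (key t ht)

lemma duh_zero (z₀ : L2R) (e : ℝ) (F : ℝ → L2R) : duh l z₀ e F 0 = z₀ := by
  simp [duh, h.SS_zero]

/-- M commutes with the group and with the integral. The fixed-point and uniqueness estimates can
therefore be made entirely in the weak norm. -/
lemma MM_duh {T : ℝ} {F : ℝ → L2R} (hF : Forcing l b T F) (z₀ : L2R) (e : ℝ) {t : ℝ}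
    (ht : t ∈ Ico 0 T) :
    MM l b (duh l z₀ e F t) = duh l (MM l b z₀) e (fun s => MM l b (F s)) t := by
  rw [duh, duh, h.MM_SS, map_add, map_smul, ← ContinuousLinearMap.intervalIntegral_comp_comm _
    (hF.intervalIntegrable h e ⟨le_rfl, ht.1.trans_lt ht.2⟩ ht)]
  simp_rw [h.MM_SS]

lemma norm_duh_sub_le {e : ℝ} (he : |e| = 1) {z₀ : L2R} {F₁ F₂ : ℝ → L2R} {t : ℝ} (ht : 0 ≤ t)
    (h1 : IntervalIntegrable (fun s => SS l (-(e * s)) (F₁ s)) volume 0 t)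
    (h2 : IntervalIntegrable (fun s => SS l (-(e * s)) (F₂ s)) volume 0 t)
    {f : ℝ → ℝ} (hf : IntervalIntegrable f volume 0 t)
    (hle : ∀ s ∈ Ioc 0 t, ‖F₁ s - F₂ s‖ ≤ f s) :
    ‖duh l z₀ e F₁ t - duh l z₀ e F₂ t‖ ≤ ∫ s in (0 : ℝ)..t, f s := by
  rw [duh, duh, ← map_sub, h.norm_SS, add_sub_add_left_eq_sub, ← smul_sub, norm_smul,
    Real.norm_eq_abs, he, one_mul, ← intervalIntegral.integral_sub h1 h2]
  refine intervalIntegral.norm_integral_le_of_norm_le ht (ae_of_all _ fun s hs => ?_) hf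
  rw [← map_sub, h.norm_SS]
  exact hle s hs

lemma norm_duh_le {e : ℝ} (he : |e| = 1) {z₀ : L2R} {F : ℝ → L2R} {t : ℝ} (ht : 0 ≤ t)
    {f : ℝ → ℝ} (hf : IntervalIntegrable f volume 0 t) (hle : ∀ s ∈ Ioc 0 t, ‖F s‖ ≤ f s) :
    ‖duh l z₀ e F t‖ ≤ ‖z₀‖ + ∫ s in (0 : ℝ)..t, f s := by
  rw [duh, h.norm_SS]
  refine (norm_add_le _ _).trans (add_le_add_right ?_ _)
  rw [norm_smul, Real.norm_eq_abs, he, one_mul]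
  refine intervalIntegral.norm_integral_le_of_norm_le ht (ae_of_all _ fun s hs => ?_) hf
  rw [h.norm_SS]
  exact hle s hs

/-- The profile `z₀ + e ∫₀ᵗ S(-es) F(s) ds` is locally Lipschitz. -/
lemma norm_profile_sub_le {T : ℝ} {F : ℝ → L2R} (hF : Forcing l b T F) {e : ℝ} (he : |e| = 1)
    {s t K : ℝ} (hs : s ∈ Ico 0 T) (ht : t ∈ Ico 0 T) (hK : ∀ x ∈ uIcc s t, ‖F x‖ ≤ K) :
    ‖e • (∫ x in (0 : ℝ)..t, SS l (-(e * x)) (F x)) -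
      e • (∫ x in (0 : ℝ)..s, SS l (-(e * x)) (F x))‖ ≤ K * |t - s| := by
  have h0 : (0 : ℝ) ∈ Ico 0 T := ⟨le_rfl, ht.1.trans_lt ht.2⟩
  rw [← smul_sub, norm_smul, Real.norm_eq_abs, he, one_mul,
    intervalIntegral.integral_interval_sub_left (hF.intervalIntegrable h e h0 ht)
      (hF.intervalIntegrable h e h0 hs)]
  refine intervalIntegral.norm_integral_le_of_norm_le_const fun x hx => ?_
  rw [h.norm_SS]
  exact hK x (uIoc_subset_uIcc hx)

lemma continuousOn_profile {T : ℝ} {F : ℝ → L2R} (hF : Forcing l b T F) {e : ℝ} (he : |e| = 1) :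
    ContinuousOn (fun t => e • ∫ x in (0 : ℝ)..t, SS l (-(e * x)) (F x)) (Ico 0 T) := by
  intro t ht
  obtain ⟨t', ht1, ht2⟩ := exists_between ht.2
  obtain ⟨K, hK⟩ := hF.bdd t' ht2
  rw [ContinuousWithinAt, tendsto_iff_norm_sub_tendsto_zero]
  have hlim : Tendsto (fun s : ℝ => K * |s - t|) (𝓝[Ico 0 T] t) (𝓝 0) := by
    have c : Continuous fun s : ℝ => K * |s - t| := by fun_prop
    simpa using (c.tendsto t).mono_left nhdsWithin_le_nhds
  refine squeeze_zero' (Eventually.of_forall fun _ => norm_nonneg _) ?_ hlim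
  filter_upwards [self_mem_nhdsWithin, nhdsWithin_le_nhds (Iio_mem_nhds ht1)] with s hs hs'
  refine h.norm_profile_sub_le hF he ht hs fun x hx => hK x ?_
  exact ⟨(le_min ht.1 hs.1).trans hx.1, hx.2.trans (max_le ht1.le (le_of_lt hs'))⟩

lemma continuousOn_duh {T : ℝ} {F : ℝ → L2R} (hF : Forcing l b T F) (z₀ : L2R) {e : ℝ}
    (he : |e| = 1) : ContinuousOn (duh l z₀ e F) (Ico 0 T) :=
  Continuous.comp_continuousOn (g := fun z : ℝ × L2R => SS l z.1 z.2)
    (f := fun t => (e * t, z₀ + e • ∫ x in (0 : ℝ)..t, SS l (-(e * x)) (F x)))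
    h.continuous_SS_uncurry
    ((continuousOn_const.mul continuousOn_id).prodMk
      (continuousOn_const.add (h.continuousOn_profile hF he)))

/-- Strongly bounded sets stay closed in the weak norm: a subsequence of transforms converges almost
everywhere, and Fatou transfers the bound on M⁻¹u to the limit. This makes the domain of the
fixed-point map complete. -/
lemma isClosed_MM_closedBall (R : ℝ) : IsClosed {u : L2R | ∃ a, MM l b a = u ∧ ‖a‖ ≤ R} := by
  refine IsSeqClosed.isClosed fun u v hu huv => ?_
  choose a ha haR using hu
  have hF : Tendsto (fun n => Fhat (u n)) atTop (𝓝 (Fhat v)) :=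
    (continuous_Fhat.tendsto v).comp huv
  obtain ⟨ns, hns, hae⟩ := (tendstoInMeasure_of_tendsto_Lp hF).exists_seq_tendsto_ae
  set m : ℝ → ℂ := fun ξ => ((symM l b ξ : ℂ))⁻¹ with hm
  have hinv : ∀ n, IsMul m (u n) (a n) := fun n =>
    IsMul.inv h.comparable_M.ne_zero (ha n ▸ h.isMul_MM (a n))
  have hmm : Measurable (fun η : ℝ => m (2 * Real.pi * η)) :=
    (Complex.measurable_ofReal.comp (h.comparable_M.meas.comp (measurable_const_mul _))).inv
  have hlim : ∀ᵐ η : ℝ, Tendsto (fun n => (Fhat (a (ns n)) : ℝ → ℂ) η) atTop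
      (𝓝 (m (2 * Real.pi * η) * Fhat v η)) := by
    filter_upwards [hae, ae_all_iff.2 fun n => hinv (ns n)] with x h1 h2
    simp_rw [h2]
    exact h1.const_mul _
  have hle := Lp.eLpNorm_lim_le_liminf_eLpNorm (p := 2) (μ := volume)
    (fun n => Lp.aestronglyMeasurable (Fhat (a (ns n)))) _ hlim
  have hR : 0 ≤ R := (norm_nonneg _).trans (haR 0)
  have hle2 : eLpNorm (fun η : ℝ => m (2 * Real.pi * η) * Fhat v η) 2 volume ≤
      ENNReal.ofReal R := by
    refine hle.trans (liminf_le_of_le (by isBoundedDefault) fun y hy => ?_)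
    obtain ⟨n, hn⟩ := hy.exists
    refine hn.trans ?_
    rw [← Lp.enorm_def, ← ofReal_norm, norm_Fhat]
    exact ENNReal.ofReal_le_ofReal (haR _)
  have hmem : MemLp (fun η : ℝ => m (2 * Real.pi * η) * Fhat v η) 2 volume :=
    ⟨hmm.aestronglyMeasurable.mul (Lp.aestronglyMeasurable _), hle2.trans_lt ENNReal.ofReal_lt_top⟩
  obtain ⟨w, hw⟩ := exists_isMul (fun ξ => by
    simp only [hm]; rw [h.comparable_M.even, map_inv₀, Complex.conj_ofReal]) v hmem
  refine ⟨w, ?_, ?_⟩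
  · exact (h.isMul_MM w).unique ((hw.inv fun ξ => inv_ne_zero (h.comparable_M.ne_zero ξ)).congr
      fun ξ => inv_inv _)
  · have h1 : ‖Fhat w‖ₑ ≤ ENNReal.ofReal R := by
      rw [Lp.enorm_def, eLpNorm_congr_ae hw]; exact hle2
    rw [← ofReal_norm, norm_Fhat] at h1
    exact (ENNReal.ofReal_le_ofReal_iff hR).1 h1

end Admissible

/-! ### Mild solutions -/

/-- The component `a = (z₊ + z₋)/2` of Duhamel's formula with data `(a₀, c₀)`. -/
def solA (l : ℝ → ℝ) (a₀ c₀ : L2R) (F : ℝ → L2R) (t : ℝ) : L2R :=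
  (1 / 2 : ℝ) • (duh l (a₀ + c₀) 1 F t + duh l (a₀ - c₀) (-1) F t)

/-- The component `c = (z₊ - z₋)/2` of Duhamel's formula with data `(a₀, c₀)`. -/
def solC (l : ℝ → ℝ) (a₀ c₀ : L2R) (F : ℝ → L2R) (t : ℝ) : L2R :=
  (1 / 2 : ℝ) • (duh l (a₀ + c₀) 1 F t - duh l (a₀ - c₀) (-1) F t)

/-- A mild solution `a` on `[0, T)` of `a_t = iω c`, `c_t = iω a + G(a)` with data `(a₀, c₀)`. -/
structure IsMild (l : ℝ → ℝ) (G : L2R → L2R) (a₀ c₀ : L2R) (T : ℝ) (a : ℝ → L2R) : Prop where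
  cont : ContinuousOn a (Ico 0 T)
  eq : ∀ t ∈ Ico 0 T, a t = solA l a₀ c₀ (fun s => G (a s)) t

/-- A nonlinearity that is locally bounded, and locally Lipschitz in the weak norm `‖M a‖`. -/
structure LocNonl (l b : ℝ → ℝ) (G : L2R → L2R) : Prop where
  bdd : ∀ R, ∃ K, ∀ a, ‖a‖ ≤ R → ‖G a‖ ≤ K
  lip : ∀ R, ∃ K, ∀ a a', ‖a‖ ≤ R → ‖a'‖ ≤ R →
    ‖MM l b (G a) - MM l b (G a')‖ ≤ K * ‖MM l b a - MM l b a'‖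

lemma IsMild.mono {l : ℝ → ℝ} {G : L2R → L2R} {a₀ c₀ : L2R} {T T' : ℝ} {a : ℝ → L2R}
    (h : IsMild l G a₀ c₀ T a) (hT : T' ≤ T) : IsMild l G a₀ c₀ T' a :=
  ⟨h.cont.mono (Ico_subset_Ico_right hT), fun t ht => h.eq t (Ico_subset_Ico_right hT ht)⟩

lemma duh_congr {l : ℝ → ℝ} {z₀ : L2R} {e : ℝ} {F F' : ℝ → L2R} {t : ℝ} (ht : 0 ≤ t)
    (h : ∀ s ∈ Icc 0 t, F s = F' s) : duh l z₀ e F t = duh l z₀ e F' t := by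
  rw [duh, duh, intervalIntegral.integral_congr (g := fun s => SS l (-(e * s)) (F' s))
    fun s hs => by rw [uIcc_of_le ht] at hs; simp only [h s hs]]

lemma solA_congr {l : ℝ → ℝ} {a₀ c₀ : L2R} {F F' : ℝ → L2R} {t : ℝ} (ht : 0 ≤ t)
    (h : ∀ s ∈ Icc 0 t, F s = F' s) : solA l a₀ c₀ F t = solA l a₀ c₀ F' t := by
  rw [solA, solA, duh_congr ht h, duh_congr ht h]

lemma solC_congr {l : ℝ → ℝ} {a₀ c₀ : L2R} {F F' : ℝ → L2R} {t : ℝ} (ht : 0 ≤ t)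
    (h : ∀ s ∈ Icc 0 t, F s = F' s) : solC l a₀ c₀ F t = solC l a₀ c₀ F' t := by
  rw [solC, solC, duh_congr ht h, duh_congr ht h]

lemma IsMild.congr {l : ℝ → ℝ} {G G' : L2R → L2R} {a₀ c₀ : L2R} {T : ℝ} {a a' : ℝ → L2R}
    (h : IsMild l G a₀ c₀ T a) (ha : ∀ t ∈ Ico 0 T, a' t = a t)
    (hG : ∀ t ∈ Ico 0 T, G' (a t) = G (a t)) : IsMild l G' a₀ c₀ T a' :=
  ⟨h.cont.congr ha, fun t ht => by
    rw [ha t ht, h.eq t ht]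
    refine solA_congr ht.1 fun s hs => ?_
    have hs' : s ∈ Ico 0 T := ⟨hs.1, hs.2.trans_lt ht.2⟩
    simp only [ha s hs', hG s hs']⟩

/-- Grönwall's inequality in integral form, with zero data. -/
lemma gronwall_zero {f : ℝ → ℝ} {t K : ℝ} (ht : 0 ≤ t) (hf : ContinuousOn f (Icc 0 t))
    (h0 : ∀ s ∈ Icc 0 t, 0 ≤ f s) (hle : ∀ s ∈ Icc 0 t, f s ≤ K * ∫ x in (0 : ℝ)..s, f x) :
    ∀ s ∈ Icc 0 t, f s = 0 := by
  -- Constant extension beyond [0, t] makes the primitive differentiable at the endpoints too.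
  set g : ℝ → ℝ := IccExtend ht ((Icc 0 t).domRestrict f) with hg
  have hgc : Continuous g := hf.domRestrict.Icc_extend'
  have hgf : ∀ s ∈ Icc 0 t, g s = f s := fun s hs => IccExtend_of_mem ht _ hs
  have hint : ∀ s ∈ Icc 0 t, ∫ x in (0 : ℝ)..s, f x = ∫ x in (0 : ℝ)..s, g x := fun s hs => by
    refine intervalIntegral.integral_congr fun x hx => ?_
    rw [uIcc_of_le hs.1] at hx
    exact (hgf x ⟨hx.1, hx.2.trans hs.2⟩).symm
  have hd : ∀ s, HasDerivAt (fun s => ∫ x in (0 : ℝ)..s, g x) (g s) s := fun s =>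
    intervalIntegral.integral_hasDerivAt_right (hgc.intervalIntegrable _ _)
      hgc.stronglyMeasurable.stronglyMeasurableAtFilter hgc.continuousAt
  have hnn : ∀ s ∈ Icc 0 t, 0 ≤ ∫ x in (0 : ℝ)..s, g x := fun s hs =>
    intervalIntegral.integral_nonneg hs.1 fun x hx => by
      rw [hgf x ⟨hx.1, hx.2.trans hs.2⟩]; exact h0 x ⟨hx.1, hx.2.trans hs.2⟩
  have hz := eq_zero_of_abs_deriv_le_mul_abs_self_of_eq_zero_right (K := K)
    (f := fun s => ∫ x in (0 : ℝ)..s, g x) (f' := g) (a := 0) (b := t)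
    (fun s _ => (hd s).continuousAt.continuousWithinAt) (fun s _ => (hd s).hasDerivWithinAt)
    intervalIntegral.integral_same fun s hs => by
      have hs' : s ∈ Icc 0 t := ⟨hs.1, hs.2.le⟩
      rw [Real.norm_of_nonneg (hnn s hs'), hgf s hs', Real.norm_of_nonneg (h0 s hs'), ← hint s hs']
      exact hle s hs'
  intro s hs
  refine le_antisymm ?_ (h0 s hs)
  have := hle s hs
  rwa [hint s hs, hz s hs, mul_zero] at this

namespace Admissible

variable {ρ r : ℝ} {l b : ℝ → ℝ} (h : Admissible ρ r l b)
include h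

omit h in
-- The Lipschitz bound on G holds only after application of M, so this is as much continuity as
-- G(a(·)) is known to have; hence the form of `Forcing`.
lemma _root_.NonlocalWave.LocNonl.forcing {G : L2R → L2R} (hG : LocNonl l b G) {T : ℝ}
    {a : ℝ → L2R} (ha : ContinuousOn a (Ico 0 T)) : Forcing l b T (fun s => G (a s)) where
  cont := by
    refine Continuous.comp_continuousOn (g := fun a => MM l b (G a)) ?_ ha
    refine continuous_iff_continuousAt.2 fun a => ?_
    obtain ⟨K, hK⟩ := hG.lip (‖a‖ + 1)
    rw [ContinuousAt, tendsto_iff_norm_sub_tendsto_zero]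
    have hlim : Tendsto (fun x => K * ‖MM l b x - MM l b a‖) (𝓝 a) (𝓝 0) := by
      have c : Continuous fun x => K * ‖MM l b x - MM l b a‖ := by fun_prop
      simpa using c.tendsto a
    refine squeeze_zero' (Eventually.of_forall fun _ => norm_nonneg _) ?_ hlim
    filter_upwards [Metric.ball_mem_nhds a one_pos] with x hx
    refine hK x a ?_ (by linarith)
    have := norm_le_norm_add_norm_sub' x a
    rw [mem_ball_iff_norm] at hx
    linarith
  bdd t ht := by
    obtain ⟨R, hR⟩ := (isCompact_Icc (a := (0 : ℝ)) (b := t)).exists_bound_of_continuousOn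
      (ha.mono fun s hs => ⟨hs.1, hs.2.trans_lt ht⟩)
    obtain ⟨K, hK⟩ := hG.bdd R
    exact ⟨K, fun s hs => hK _ (hR s hs)⟩

lemma MM_solA {T : ℝ} {F : ℝ → L2R} (hF : Forcing l b T F) (a₀ c₀ : L2R) {t : ℝ}
    (ht : t ∈ Ico 0 T) :
    MM l b (solA l a₀ c₀ F t) = solA l (MM l b a₀) (MM l b c₀) (fun s => MM l b (F s)) t := by
  rw [solA, solA, map_smul, map_add, h.MM_duh hF _ _ ht, h.MM_duh hF _ _ ht, map_add, map_sub]

lemma continuousOn_solA {T : ℝ} {F : ℝ → L2R} (hF : Forcing l b T F) (a₀ c₀ : L2R) :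
    ContinuousOn (solA l a₀ c₀ F) (Ico 0 T) :=
  ((h.continuousOn_duh hF (a₀ + c₀) (e := 1) (by simp)).add
    (h.continuousOn_duh hF (a₀ - c₀) (e := -1) (by simp))).const_smul (1 / 2 : ℝ)

lemma continuousOn_solC {T : ℝ} {F : ℝ → L2R} (hF : Forcing l b T F) (a₀ c₀ : L2R) :
    ContinuousOn (solC l a₀ c₀ F) (Ico 0 T) :=
  ((h.continuousOn_duh hF (a₀ + c₀) (e := 1) (by simp)).sub
    (h.continuousOn_duh hF (a₀ - c₀) (e := -1) (by simp))).const_smul (1 / 2 : ℝ)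

lemma intervalIntegrable_MM {T : ℝ} {F : ℝ → L2R} (hF : Forcing l b T F) (e : ℝ) {t : ℝ}
    (ht : t ∈ Ico 0 T) :
    IntervalIntegrable (fun s => SS l (-(e * s)) (MM l b (F s))) volume 0 t := by
  have h0 : (0 : ℝ) ∈ Ico 0 T := ⟨le_rfl, ht.1.trans_lt ht.2⟩
  have h1 := hF.intervalIntegrable h e h0 ht
  have h2 : (fun s => SS l (-(e * s)) (MM l b (F s))) =
      fun s => MM l b (SS l (-(e * s)) (F s)) := funext fun s => (h.MM_SS _ _).symm
  rw [h2]
  exact ⟨(MM l b).integrable_comp h1.1, (MM l b).integrable_comp h1.2⟩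

lemma norm_MM_solA_sub_le {T : ℝ} {F₁ F₂ : ℝ → L2R} (h1 : Forcing l b T F₁)
    (h2 : Forcing l b T F₂) (a₀ c₀ : L2R) {t : ℝ} (ht : t ∈ Ico 0 T)
    {f : ℝ → ℝ} (hf : IntervalIntegrable f volume 0 t)
    (hle : ∀ s ∈ Ioc 0 t, ‖MM l b (F₁ s) - MM l b (F₂ s)‖ ≤ f s) :
    ‖MM l b (solA l a₀ c₀ F₁ t) - MM l b (solA l a₀ c₀ F₂ t)‖ ≤ ∫ s in (0 : ℝ)..t, f s := by
  rw [h.MM_solA h1 _ _ ht, h.MM_solA h2 _ _ ht, solA, solA, ← smul_sub, norm_smul]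
  have k := fun (z : L2R) {e : ℝ} (he : |e| = 1) => h.norm_duh_sub_le he (z₀ := z) ht.1
    (h.intervalIntegrable_MM h1 e ht) (h.intervalIntegrable_MM h2 e ht) hf hle
  have k1 := k (MM l b a₀ + MM l b c₀) (e := 1) (by simp)
  have k2 := k (MM l b a₀ - MM l b c₀) (e := -1) (by simp)
  have e1 := norm_add_le
    (duh l (MM l b a₀ + MM l b c₀) 1 (fun s => MM l b (F₁ s)) t -
      duh l (MM l b a₀ + MM l b c₀) 1 (fun s => MM l b (F₂ s)) t)
    (duh l (MM l b a₀ - MM l b c₀) (-1) (fun s => MM l b (F₁ s)) t -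
      duh l (MM l b a₀ - MM l b c₀) (-1) (fun s => MM l b (F₂ s)) t)
  rw [← add_sub_add_comm] at e1
  rw [Real.norm_of_nonneg (by norm_num)]
  linarith

lemma norm_sol_le {F : ℝ → L2R} (a₀ c₀ : L2R) {t : ℝ} (ht : 0 ≤ t)
    {f : ℝ → ℝ} (hf : IntervalIntegrable f volume 0 t) (hle : ∀ s ∈ Ioc 0 t, ‖F s‖ ≤ f s) :
    ‖solA l a₀ c₀ F t‖ ≤ ‖a₀‖ + ‖c₀‖ + ∫ s in (0 : ℝ)..t, f s := by
  have k1 := h.norm_duh_le (e := 1) (by simp) (z₀ := a₀ + c₀) ht hf hle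
  have k2 := h.norm_duh_le (e := -1) (by simp) (z₀ := a₀ - c₀) ht hf hle
  rw [solA, norm_smul, Real.norm_of_nonneg (by norm_num)]
  have e1 := norm_add_le (duh l (a₀ + c₀) 1 F t) (duh l (a₀ - c₀) (-1) F t)
  have e2 := norm_add_le a₀ c₀
  have e3 := norm_sub_le a₀ c₀
  linarith

/-- Mild solutions are unique. -/
lemma isMild_unique {G : L2R → L2R} (hG : LocNonl l b G) {a₀ c₀ : L2R} {T : ℝ} {a a' : ℝ → L2R}
    (ha : IsMild l G a₀ c₀ T a) (ha' : IsMild l G a₀ c₀ T a') {t : ℝ} (ht : t ∈ Ico 0 T) :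
    a t = a' t := by
  have hsub : Icc 0 t ⊆ Ico 0 T := fun s hs => ⟨hs.1, hs.2.trans_lt ht.2⟩
  obtain ⟨R, hR⟩ := isCompact_Icc.exists_bound_of_continuousOn (ha.cont.mono hsub)
  obtain ⟨R', hR'⟩ := isCompact_Icc.exists_bound_of_continuousOn (ha'.cont.mono hsub)
  obtain ⟨K, hK⟩ := hG.lip (max R R')
  have hf : ContinuousOn (fun s => ‖MM l b (a s) - MM l b (a' s)‖) (Icc 0 t) :=
    (((MM l b).continuous.comp_continuousOn (ha.cont.mono hsub)).sub
      ((MM l b).continuous.comp_continuousOn (ha'.cont.mono hsub))).norm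
  -- Grönwall is applied to the weak norm of the difference; injectivity of M then recovers equality
  -- of the solutions.
  have hz := gronwall_zero (K := K) ht.1 hf (fun _ _ => norm_nonneg _) (fun s hs => by
    have hfs : ContinuousOn (fun s => ‖MM l b (a s) - MM l b (a' s)‖) (uIcc 0 s) := by
      rw [uIcc_of_le hs.1]; exact hf.mono (Icc_subset_Icc_right hs.2)
    rw [ha.eq s (hsub hs), ha'.eq s (hsub hs), ← intervalIntegral.integral_const_mul]
    refine h.norm_MM_solA_sub_le (hG.forcing ha.cont) (hG.forcing ha'.cont) a₀ c₀ (hsub hs)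
      (hfs.intervalIntegrable.const_mul K) fun x hx => ?_
    have hx' : x ∈ Icc 0 t := ⟨hx.1.le, hx.2.trans hs.2⟩
    exact hK _ _ ((hR x hx').trans (le_max_left _ _)) ((hR' x hx').trans (le_max_right _ _)))
    t ⟨ht.1, le_rfl⟩
  exact h.MM_injective (sub_eq_zero.1 (norm_eq_zero.1 hz))

/-- A globally Lipschitz problem has mild solutions on every interval. -/
lemma exists_isMild {G : L2R → L2R} {K : ℝ} (hK : 0 ≤ K) (hb : ∀ a, ‖G a‖ ≤ K * ‖a‖)
    (hl : ∀ a a', ‖MM l b (G a) - MM l b (G a')‖ ≤ K * ‖MM l b a - MM l b a'‖)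
    (a₀ c₀ : L2R) {T : ℝ} (hT : 0 ≤ T) : ∃ a, IsMild l G a₀ c₀ T a := by
  -- With the time weight e^{-lam·t}, the Lipschitz constant K of the integral operator is divided
  -- by lam, and K / lam ≤ 1/2.
  set lam : ℝ := 2 * K + 1 with hlam
  have hlam0 : 0 < lam := by positivity
  set R : ℝ := ‖a₀‖ + ‖c₀‖ with hR
  have hR0 : 0 ≤ R := by positivity
  set B : Set L2R := {u : L2R | ∃ a, MM l b a = u ∧ ‖a‖ ≤ R} with hB
  have hB0 : (0 : L2R) ∈ B := ⟨0, map_zero _, by simpa using hR0⟩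
  have hinv : ∀ u : L2R, ∃ a, ‖a‖ ≤ R ∧ (u ∈ B → MM l b a = u) := fun u => by
    by_cases hu : u ∈ B
    · obtain ⟨a, h1, h2⟩ := hu; exact ⟨a, h2, fun _ => h1⟩
    -- Off the image of the ball the value 0 is a harmless default: it keeps the bound R valid for
    -- every argument.
    · exact ⟨0, by simpa using hR0, fun h => absurd h hu⟩
  choose inv hinvR hinvM using hinv
  set D : Set C(Icc (0 : ℝ) T, L2R) := {q | ∀ t, q t ∈ B} with hD
  have hDc : IsClosed D := by
    have : D = ⋂ t : Icc (0 : ℝ) T, (fun q : C(Icc (0 : ℝ) T, L2R) => q t) ⁻¹' B := by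
      ext q; simp [hD]
    rw [this]
    exact isClosed_iInter fun t =>
      (h.isClosed_MM_closedBall R).preimage (continuous_eval_const t)
  -- A path q stores e^{-lam·t} M a(t); A undoes the weight and M, and extends the path constantly
  -- in q outside [0, T].
  set A : C(Icc (0 : ℝ) T, L2R) → ℝ → L2R := fun q t =>
    Real.exp (lam * t) • inv (q (projIcc 0 T hT t)) with hA
  have hAM : ∀ q ∈ D, ∀ t, MM l b (A q t) = Real.exp (lam * t) • q (projIcc 0 T hT t) :=
    fun q hq t => by rw [hA, map_smul, hinvM _ (hq _)]
  have hAn : ∀ q t, ‖A q t‖ ≤ R * Real.exp (lam * t) := fun q t => by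
    rw [hA, norm_smul, Real.norm_of_nonneg (Real.exp_pos _).le, mul_comm]
    exact mul_le_mul_of_nonneg_right (hinvR _) (Real.exp_pos _).le
  -- The interval [0, T+1) is used so that the closed interval [0, T] lies inside the half-open one.
  have hF : ∀ q ∈ D, Forcing l b (T + 1) (fun s => G (A q s)) := fun q hq => by
    constructor
    · refine Continuous.continuousOn (continuous_iff_continuousAt.2 fun t => ?_)
      rw [ContinuousAt, tendsto_iff_norm_sub_tendsto_zero]
      have c : Continuous fun s => K * ‖MM l b (A q s) - MM l b (A q t)‖ := by
        simp_rw [hAM q hq]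
        exact continuous_const.mul ((((by fun_prop : Continuous fun s => Real.exp (lam * s)).smul
          (q.continuous.comp continuous_projIcc)).sub continuous_const).norm)
      refine squeeze_zero (fun _ => norm_nonneg _) (fun s => hl _ _) ?_
      simpa using c.tendsto t
    · intro t _
      refine ⟨K * (R * Real.exp (lam * t)), fun s hs => (hb _).trans ?_⟩
      refine mul_le_mul_of_nonneg_left ((hAn q s).trans ?_) hK
      have := hs.2
      gcongr
  have hIT : ∀ t : Icc (0 : ℝ) T, (t : ℝ) ∈ Ico 0 (T + 1) := fun t =>
    ⟨t.2.1, t.2.2.trans_lt (by linarith)⟩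
  have hexpint : ∀ t : ℝ, ∫ s in (0 : ℝ)..t, Real.exp (lam * s) = (Real.exp (lam * t) - 1) / lam :=
    fun t => by
      rw [intervalIntegral.integral_comp_mul_left (fun x => Real.exp x) hlam0.ne', integral_exp]
      simp [div_eq_inv_mul]
  have hexpi : ∀ C t : ℝ, IntervalIntegrable (fun s => C * Real.exp (lam * s)) volume 0 t :=
    fun C t => (by fun_prop : Continuous fun s => C * Real.exp (lam * s)).intervalIntegrable _ _
  have hKl : K / lam ≤ 1 / 2 := by rw [div_le_iff₀ hlam0, hlam]; linarith
  -- The map preserves D because R + K R (e^{lam·t} - 1)/lam ≤ R e^{lam·t}.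
  set Φ : D → D := fun q => ⟨⟨fun t : Icc (0 : ℝ) T => Real.exp (-(lam * t)) •
      MM l b (solA l a₀ c₀ (fun s => G (A q.1 s)) t), by
        refine Continuous.smul (by fun_prop :
          Continuous fun t : Icc (0 : ℝ) T => Real.exp (-(lam * t))) ((MM l b).continuous.comp ?_)
        exact (h.continuousOn_solA (hF q.1 q.2) a₀ c₀).comp_continuous continuous_subtype_val hIT⟩,
      fun t => ⟨Real.exp (-(lam * t)) • solA l a₀ c₀ (fun s => G (A q.1 s)) t, map_smul _ _ _, by
        rw [norm_smul, Real.norm_of_nonneg (Real.exp_pos _).le, Real.exp_neg, inv_mul_le_iff₀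
          (Real.exp_pos _)]
        refine (h.norm_sol_le a₀ c₀ t.2.1 (hexpi (K * R) t) fun s _ => (hb _).trans ?_).trans ?_
        · rw [mul_assoc]; exact mul_le_mul_of_nonneg_left (hAn _ _) hK
        · rw [intervalIntegral.integral_const_mul, hexpint]
          have e1 : 1 ≤ Real.exp (lam * t) := Real.one_le_exp (mul_nonneg hlam0.le t.2.1)
          have e2 : K * R * ((Real.exp (lam * t) - 1) / lam) =
            K / lam * (R * (Real.exp (lam * t) - 1)) := by ring
          have e3 : K / lam * (R * (Real.exp (lam * t) - 1)) ≤ 1 * (R * (Real.exp (lam * t) - 1)) :=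
            mul_le_mul_of_nonneg_right (hKl.trans (by norm_num))
              (mul_nonneg hR0 (by linarith))
          rw [e2]
          linarith⟩⟩ with hΦ
  have hcon : ContractingWith (1 / 2) Φ := by
    refine ⟨by rw [← NNReal.coe_lt_coe]; norm_num, LipschitzWith.of_dist_le_mul fun q q' => ?_⟩
    rw [Subtype.dist_eq, Subtype.dist_eq, ContinuousMap.dist_le (by positivity)]
    intro t
    change dist (Real.exp (-(lam * t)) • MM l b (solA l a₀ c₀ (fun s => G (A q.1 s)) t))
      (Real.exp (-(lam * t)) • MM l b (solA l a₀ c₀ (fun s => G (A q'.1 s)) t)) ≤ _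
    rw [dist_eq_norm, ← smul_sub, norm_smul, Real.norm_of_nonneg (Real.exp_pos _).le, Real.exp_neg,
      inv_mul_le_iff₀ (Real.exp_pos _)]
    refine (h.norm_MM_solA_sub_le (hF q.1 q.2) (hF q'.1 q'.2) a₀ c₀ (hIT t)
      (hexpi (K * dist q.1 q'.1) t) fun s hs => (hl _ _).trans ?_).trans ?_
    · rw [hAM _ q.2, hAM _ q'.2, ← smul_sub, norm_smul, Real.norm_of_nonneg (Real.exp_pos _).le,
        mul_assoc, mul_comm (dist _ _), ← dist_eq_norm]
      exact mul_le_mul_of_nonneg_left (mul_le_mul_of_nonneg_left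
        (ContinuousMap.dist_apply_le_dist _) (Real.exp_pos _).le) hK
    · rw [intervalIntegral.integral_const_mul, hexpint]
      have e2 : K * dist q.1 q'.1 * ((Real.exp (lam * t) - 1) / lam) =
        K / lam * (dist q.1 q'.1 * (Real.exp (lam * t) - 1)) := by ring
      have e1 : 1 ≤ Real.exp (lam * t) := Real.one_le_exp (mul_nonneg hlam0.le t.2.1)
      have d0 : 0 ≤ dist q.1 q'.1 := dist_nonneg
      have e3 : K / lam * (dist q.1 q'.1 * (Real.exp (lam * t) - 1)) ≤
          1 / 2 * (dist q.1 q'.1 * (Real.exp (lam * t) - 1)) :=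
        mul_le_mul_of_nonneg_right hKl (mul_nonneg d0 (by linarith))
      rw [e2]
      push_cast
      linarith
  have : CompleteSpace D := hDc.completeSpace_coe
  have : Nonempty D := ⟨⟨0, fun t => hB0⟩⟩
  set q := ContractingWith.fixedPoint Φ hcon with hq
  have hfix : Φ q = q := hcon.fixedPoint_isFixedPt
  have key : ∀ t ∈ Ico 0 T, A q.1 t = solA l a₀ c₀ (fun s => G (A q.1 s)) t := by
    intro t ht
    -- The fixed-point equation is known only after applying M and is lifted by injectivity.
    apply h.MM_injective
    rw [hAM _ q.2, projIcc_of_mem hT ⟨ht.1, ht.2.le⟩]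
    have h1 : q.1 ⟨t, ht.1, ht.2.le⟩ = Real.exp (-(lam * t)) •
        MM l b (solA l a₀ c₀ (fun s => G (A q.1 s)) t) := by
      conv_lhs => rw [← hfix]
      rfl
    rw [h1, smul_smul, ← Real.exp_add, add_neg_cancel, Real.exp_zero, one_smul]
  refine ⟨A q.1, ContinuousOn.congr ?_ key, key⟩
  exact (h.continuousOn_solA (hF q.1 q.2) a₀ c₀).mono (Ico_subset_Ico_right (by linarith))

end Admissible

/-! ### The nonlinearity in the energy variables -/

open Classical in
/-- The operator `∂ₓ B^{1/2}` on its domain (and `0` elsewhere). -/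
def kappaOp (b : ℝ → ℝ) (f : L2R) : L2R := if h : ∃ F, IsMul (symK b) f F then h.choose else 0

/-- The nonlinearity `a ↦ ∂ₓ B^{1/2} φ(M a)`. -/
def force (l b : ℝ → ℝ) (φ : ℝ → ℝ) (a : L2R) : L2R := kappaOp b (nonlin φ (MM l b a))

lemma isMul_force_of_exists {l b φ : ℝ → ℝ} {a : L2R}
    (h : ∃ F, IsMul (symK b) (nonlin φ (MM l b a)) F) :
    IsMul (symK b) (nonlin φ (MM l b a)) (force l b φ a) := by
  rw [force, kappaOp, dif_pos h]; exact h.choose_spec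

lemma force_congr {l b φ ψ : ℝ → ℝ} {a : L2R}
    (h : nonlin φ (MM l b a) = nonlin ψ (MM l b a)) : force l b φ a = force l b ψ a := by
  rw [force, force, h]

lemma Q_eq_inner {p R : ℝ} (hp : 1 < p) (hR : 0 ≤ R) {u : L2R} (hu : ∀ᵐ x, |u x| ≤ R) :
    Q p u = -inner ℝ (nonlin (gTrunc p R) u) u := by
  rw [Q, L2.inner_def, ← integral_neg]
  refine integral_congr_ae ?_
  filter_upwards [hu, nonlin_ae (gTrunc_lipschitz hp hR) (gTrunc_zero hR) u] with x h1 h2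
  rw [h2, gTrunc_eq h1, g]
  simp only [RCLike.inner_apply, conj_trivial]
  rcases eq_or_ne (u x) 0 with h0 | h0
  · rw [h0, abs_zero, Real.zero_rpow (by linarith)]; simp
  · have e : |u x| ^ (p + 1) = |u x| ^ (p - 1) * |u x| ^ 2 := by
      rw [← Real.rpow_natCast |u x| 2, ← Real.rpow_add (abs_pos.2 h0)]
      congr 1; push_cast; ring
    rw [e, sq_abs]; ring

namespace Admissible

variable {ρ r : ℝ} {l b : ℝ → ℝ} (h : Admissible ρ r l b)
include h

lemma exists_bound : ∃ C > 0, ∀ (R : ℝ) (a : L2R), ‖a‖ ≤ R → ∀ᵐ x, |MM l b a x| ≤ C * R := by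
  obtain ⟨C, hC, hs⟩ := h.sobolev
  exact ⟨C, hC, fun R a ha => (hs a).mono fun x hx => hx.trans (by gcongr)⟩

lemma exists_isMul_force_of_lipschitz {φ : ℝ → ℝ} {K : NNReal} (hφ : LipschitzWith K φ)
    (h0 : φ 0 = 0) (a : L2R) : ∃ F, IsMul (symK b) (nonlin φ (MM l b a)) F := by
  obtain ⟨C, hC, H⟩ := h.exists_nonlin
  obtain ⟨F, hF, _⟩ := H K φ hφ h0 a
  exact ⟨F, hF⟩

lemma exists_norm_force_le : ∃ C > 0, ∀ (K : NNReal) (φ : ℝ → ℝ), LipschitzWith K φ → φ 0 = 0 →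
    ∀ a : L2R, ‖force l b φ a‖ ≤ C * K * ‖a‖ := by
  obtain ⟨C, hC, H⟩ := h.exists_nonlin
  refine ⟨C, hC, fun K φ hφ h0 a => ?_⟩
  obtain ⟨F, hF, hFC⟩ := H K φ hφ h0 a
  rwa [(isMul_force_of_exists ⟨F, hF⟩).unique hF]

/-- Applying M turns the possibly unbounded ∂ₓB^{1/2} into a bounded operator. -/
lemma MM_of_isMul_symK {f F : L2R} (hF : IsMul (symK b) f F) :
    MM l b F = Mop (symNu l b) f := by
  obtain ⟨C, hC, hν⟩ := h.bdd_nu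
  refine IsMul.eq_Mop ((hF.comp (h.isMul_MM F)).congr fun ξ => ?_) hν
  rw [symNu_eq, mul_comm]

/-- After M the derivative is gone, so the L² Lipschitz estimate for superposition suffices; a bound
in the strong norm would need control of φ'. -/
lemma exists_norm_MM_force_sub_le : ∃ C > 0, ∀ (K : NNReal) (φ : ℝ → ℝ), LipschitzWith K φ →
    φ 0 = 0 → ∀ a a' : L2R, ‖MM l b (force l b φ a) - MM l b (force l b φ a')‖ ≤
      C * K * ‖MM l b a - MM l b a'‖ := by
  obtain ⟨C, hC, hν⟩ := h.bdd_nu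
  refine ⟨C, hC, fun K φ hφ h0 a a' => ?_⟩
  rw [h.MM_of_isMul_symK (isMul_force_of_exists (h.exists_isMul_force_of_lipschitz hφ h0 a)),
    h.MM_of_isMul_symK (isMul_force_of_exists (h.exists_isMul_force_of_lipschitz hφ h0 a')),
    ← map_sub, mul_assoc]
  exact (hν.norm_le _).trans (by gcongr; exact norm_nonlin_sub_le hφ h0 _ _)

omit h in
lemma _root_.NonlocalWave.nonlin_g_eq {p R : ℝ} {u : L2R} (hu : ∀ᵐ x, |u x| ≤ R) :
    nonlin (g p) u = nonlin (gTrunc p R) u :=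
  nonlin_congr (hu.mono fun _ hx => (gTrunc_eq hx).symm)

/-- The true and the truncated nonlinearities agree on balls. -/
lemma exists_force_eq (p : ℝ) : ∃ C > 0, ∀ (R : ℝ) (a : L2R), ‖a‖ ≤ R →
    nonlin (g p) (MM l b a) = nonlin (gTrunc p (C * R)) (MM l b a) ∧
    force l b (g p) a = force l b (gTrunc p (C * R)) a := by
  obtain ⟨C, hC, H⟩ := h.exists_bound
  refine ⟨C, hC, fun R a ha => ?_⟩
  have e := nonlin_g_eq (p := p) (H R a ha)
  exact ⟨e, force_congr e⟩

lemma nonlin_g_ae {p : ℝ} (hp : 1 < p) (a : L2R) :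
    nonlin (g p) (MM l b a) =ᵐ[volume] fun x => g p (MM l b a x) := by
  obtain ⟨C, hC, H⟩ := h.exists_bound
  have hR : 0 ≤ C * ‖a‖ := by positivity
  rw [nonlin_g_eq (H _ a le_rfl)]
  filter_upwards [H _ a le_rfl, nonlin_ae (gTrunc_lipschitz hp hR) (gTrunc_zero hR) (MM l b a)]
    with x h1 h2
  rw [h2, gTrunc_eq h1]

lemma isMul_force {p : ℝ} (hp : 1 < p) (a : L2R) :
    IsMul (symK b) (nonlin (g p) (MM l b a)) (force l b (g p) a) := by
  obtain ⟨C, hC, H⟩ := h.exists_bound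
  have hR : 0 ≤ C * ‖a‖ := by positivity
  refine isMul_force_of_exists ?_
  rw [nonlin_g_eq (H _ a le_rfl)]
  exact h.exists_isMul_force_of_lipschitz (gTrunc_lipschitz hp hR) (gTrunc_zero hR) a

/-- On the ball ‖a‖ ≤ R the Sobolev bound gives |M a| ≤ C R almost everywhere. There g coincides
with its truncation, for which global estimates hold. -/
lemma locNonl_force {p : ℝ} (hp : 1 < p) : LocNonl l b (force l b (g p)) := by
  obtain ⟨C, hC, H⟩ := h.exists_force_eq p
  obtain ⟨C₁, hC₁, H₁⟩ := h.exists_norm_force_le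
  obtain ⟨C₂, hC₂, H₂⟩ := h.exists_norm_MM_force_sub_le
  constructor
  · intro R
    refine ⟨C₁ * lipConst p (C * R) * R, fun a ha => ?_⟩
    have hR : 0 ≤ C * R := mul_nonneg hC.le ((norm_nonneg a).trans ha)
    rw [(H R a ha).2]
    exact (H₁ _ _ (gTrunc_lipschitz hp hR) (gTrunc_zero hR) a).trans (by gcongr)
  · intro R
    refine ⟨C₂ * lipConst p (C * R), fun a a' ha ha' => ?_⟩
    have hR : 0 ≤ C * R := mul_nonneg hC.le ((norm_nonneg a).trans ha)
    rw [(H R a ha).2, (H R a' ha').2]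
    exact H₂ _ _ (gTrunc_lipschitz hp hR) (gTrunc_zero hR) a a'

/-- The truncated problem has mild solutions on every interval. -/
lemma exists_isMild_trunc {p R : ℝ} (hp : 1 < p) (hR : 0 ≤ R) (a₀ c₀ : L2R) {T : ℝ} (hT : 0 ≤ T) :
    ∃ a, IsMild l (force l b (gTrunc p R)) a₀ c₀ T a := by
  obtain ⟨C₁, hC₁, H₁⟩ := h.exists_norm_force_le
  obtain ⟨C₂, hC₂, H₂⟩ := h.exists_norm_MM_force_sub_le
  refine h.exists_isMild (K := max C₁ C₂ * lipConst p R) (by positivity) (fun a => ?_)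
    (fun a a' => ?_) a₀ c₀ hT
  · exact (H₁ _ _ (gTrunc_lipschitz hp hR) (gTrunc_zero hR) a).trans
      (by gcongr; exact le_max_left _ _)
  · exact (H₂ _ _ (gTrunc_lipschitz hp hR) (gTrunc_zero hR) a a').trans
      (by gcongr; exact le_max_right _ _)

lemma locNonl_trunc {p R : ℝ} (hp : 1 < p) (hR : 0 ≤ R) :
    LocNonl l b (force l b (gTrunc p R)) := by
  obtain ⟨C₁, hC₁, H₁⟩ := h.exists_norm_force_le
  obtain ⟨C₂, hC₂, H₂⟩ := h.exists_norm_MM_force_sub_le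
  exact ⟨fun R' => ⟨C₁ * lipConst p R * R', fun a ha =>
    (H₁ _ _ (gTrunc_lipschitz hp hR) (gTrunc_zero hR) a).trans (by gcongr)⟩,
    fun R' => ⟨C₂ * lipConst p R, fun a a' _ _ =>
      H₂ _ _ (gTrunc_lipschitz hp hR) (gTrunc_zero hR) a a'⟩⟩

lemma Q_MM {p : ℝ} (hp : 1 < p) (a : L2R) :
    Q p (MM l b a) = -inner ℝ (nonlin (g p) (MM l b a)) (MM l b a) := by
  obtain ⟨C, hC, H⟩ := h.exists_bound
  rw [nonlin_g_eq (H _ a le_rfl)]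
  exact Q_eq_inner hp (by positivity) (H _ a le_rfl)

lemma continuous_nonlin_MM {p : ℝ} (hp : 1 < p) :
    Continuous fun a : L2R => nonlin (g p) (MM l b a) := by
  obtain ⟨C, hC, H⟩ := h.exists_force_eq p
  refine continuous_iff_continuousAt.2 fun a => ?_
  have hR : 0 ≤ C * (‖a‖ + 1) := by positivity
  have hc : Continuous fun a' => nonlin (gTrunc p (C * (‖a‖ + 1))) (MM l b a') := by
    refine Continuous.comp (g := fun u => nonlin (gTrunc p (C * (‖a‖ + 1))) u)
      (LipschitzWith.continuous (K := lipConst p (C * (‖a‖ + 1))) ?_) (MM l b).continuous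
    exact LipschitzWith.of_dist_le_mul fun u v => by
      rw [dist_eq_norm, dist_eq_norm]
      exact norm_nonlin_sub_le (gTrunc_lipschitz hp hR) (gTrunc_zero hR) u v
  refine hc.continuousAt.congr ?_
  filter_upwards [Metric.ball_mem_nhds a one_pos] with x hx
  refine ((H (‖a‖ + 1) x ?_).1).symm
  have := norm_le_norm_add_norm_sub' x a
  rw [mem_ball_iff_norm] at hx
  linarith

lemma continuous_Q_MM {p : ℝ} (hp : 1 < p) : Continuous fun a : L2R => Q p (MM l b a) := by
  simp_rw [h.Q_MM hp]
  exact ((h.continuous_nonlin_MM hp).inner (MM l b).continuous).neg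

end Admissible

/-! ### Weak derivatives in time -/

section Abstract

variable {E : Type*} [NormedAddCommGroup E] [InnerProductSpace ℝ E]

/-- Product rule: `B` is strongly differentiable, `A` is continuous and weakly differentiable. -/
lemma hasDerivAt_inner_of_weak {A B : ℝ → E} {B' : E} {D t : ℝ} (hA : ContinuousAt A t)
    (hAw : HasDerivAt (fun s => (inner ℝ (A s) (B t) : ℝ)) D t) (hB : HasDerivAt B B' t) :
    HasDerivAt (fun s => (inner ℝ (A s) (B s) : ℝ)) (D + inner ℝ (A t) B') t := by
  -- The product is split as ⟨A(s), B(t)⟩ + ⟨A(s), B(s) - B(t)⟩; the second term needs only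
  -- continuity of A.
  have h1 : HasDerivAt (fun s => (inner ℝ (A s) (B s - B t) : ℝ)) (inner ℝ (A t) B') t := by
    rw [hasDerivAt_iff_tendsto_slope] at hB ⊢
    refine ((hA.tendsto.mono_left nhdsWithin_le_nhds).inner hB).congr fun s => ?_
    simp only [slope_def_module, sub_self, inner_zero_right, sub_zero, inner_smul_right, smul_eq_mul]
  refine (hAw.add h1).congr_of_eventuallyEq (Eventually.of_forall fun s => ?_)
  simp only [Pi.add_apply, inner_sub_right]; ring

/-- The square of the norm of a Lipschitz, weakly differentiable curve. -/
lemma hasDerivAt_norm_sq_of_weak {A : ℝ → E} {D K t : ℝ}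
    (hA : ∀ᶠ s in 𝓝 t, ‖A s - A t‖ ≤ K * |s - t|)
    (hAw : HasDerivAt (fun s => (inner ℝ (A s) (A t) : ℝ)) D t) :
    HasDerivAt (fun s => ‖A s‖ ^ 2) (2 * D) t := by
  -- By polarization ‖A(s)‖² = 2⟨A(s), A(t)⟩ - ‖A(t)‖² + ‖A(s) - A(t)‖², and the last term is O((s -
  -- t)²) by the Lipschitz bound.
  have h1 : HasDerivAt (fun s => ‖A s - A t‖ ^ 2) 0 t := by
    rw [hasDerivAt_iff_isLittleO]
    have h2 : (fun s => ‖A s - A t‖ ^ 2) =O[𝓝 t] fun s => (s - t) ^ 2 := by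
      refine Asymptotics.IsBigO.of_bound (K ^ 2) ?_
      filter_upwards [hA] with s hs
      rw [norm_pow, norm_norm, norm_pow, Real.norm_eq_abs, ← mul_pow]
      exact pow_le_pow_left₀ (norm_nonneg _) hs 2
    have h3 : (fun s : ℝ => (s - t) ^ 2) =o[𝓝 t] fun s => (s - t) ^ 1 :=
      (Asymptotics.isLittleO_pow_pow (𝕜 := ℝ) (m := 1) (n := 2) (by norm_num)).comp_tendsto
        (k := fun s : ℝ => s - t) (l' := 𝓝 t) (by
          have : Continuous fun s : ℝ => s - t := by fun_prop
          simpa using this.tendsto t)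
    simpa using h2.trans_isLittleO h3
  have h4 := ((hAw.const_mul 2).sub_const (‖A t‖ ^ 2)).add h1
  rw [add_zero] at h4
  refine h4.congr_of_eventuallyEq (Eventually.of_forall fun s => ?_)
  simp only [Pi.add_apply]
  rw [norm_sub_sq_real]; ring

/-- A curve whose weak derivative against a total set is a continuous curve is differentiable. -/
lemma hasDerivAt_of_weak [CompleteSpace E] {ι : Type*} {ψ : ι → E}
    (hψ : ∀ f k : E, (∀ i, (inner ℝ f (ψ i) : ℝ) = inner ℝ k (ψ i)) → f = k) {s : Set ℝ}
    (hs : IsOpen s) (hs' : s.OrdConnected) {A A' : ℝ → E} (hA' : ContinuousOn A' s)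
    (hd : ∀ i, ∀ t ∈ s, HasDerivAt (fun τ => (inner ℝ (A τ) (ψ i) : ℝ)) (inner ℝ (A' t) (ψ i)) t)
    {t : ℝ} (ht : t ∈ s) : HasDerivAt A (A' t) t := by
  have hint : ∀ τ ∈ s, IntervalIntegrable A' volume t τ := fun τ hτ =>
    (hA'.mono (hs'.uIcc_subset ht hτ)).intervalIntegrable
  have key : ∀ τ ∈ s, A τ = A t + ∫ x in t..τ, A' x := fun τ hτ => by
    refine hψ _ _ fun i => ?_
    have h1 := intervalIntegral.integral_eq_sub_of_hasDerivAt (a := t) (b := τ)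
      (fun x hx => hd i x (hs'.uIcc_subset ht hτ hx))
      (ContinuousOn.intervalIntegrable
        ((hA'.mono (hs'.uIcc_subset ht hτ)).inner continuousOn_const))
    have h2 := ContinuousLinearMap.intervalIntegral_comp_comm (innerSL ℝ (ψ i)) (hint τ hτ)
    simp only [innerSL_apply_apply] at h2
    have h3 : ∀ x, (inner ℝ (ψ i) (A' x) : ℝ) = inner ℝ (A' x) (ψ i) := fun x =>
      real_inner_comm _ _
    simp_rw [h3] at h2
    rw [inner_add_left, real_inner_comm (ψ i) (∫ x in t..τ, A' x), ← h2]
    linarith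
  have hcont : ContinuousAt A' t := hA'.continuousAt (hs.mem_nhds ht)
  have h1 : HasDerivAt (fun τ => A t + ∫ x in t..τ, A' x) (A' t) t := by
    refine (intervalIntegral.integral_hasDerivAt_right IntervalIntegrable.refl ?_ hcont).const_add _
    exact hA'.stronglyMeasurableAtFilter hs t ht
  refine h1.congr_of_eventuallyEq ?_
  filter_upwards [hs.mem_nhds ht] with τ hτ using key τ hτ

end Abstract

namespace Admissible

variable {ρ r : ℝ} {l b : ℝ → ℝ} (h : Admissible ρ r l b)
include h

/-- A forcing is weakly continuous. -/
lemma tendsto_inner_forcing {T : ℝ} {F : ℝ → L2R} (hF : Forcing l b T F) {t : ℝ}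
    (ht : t ∈ Ioo 0 T) {θ : ℝ → L2R} (hθ : ContinuousAt θ t) :
    ContinuousAt (fun s => (inner ℝ (F s) (θ s) : ℝ)) t := by
  obtain ⟨t', ht1, ht2⟩ := exists_between ht.2
  obtain ⟨K, hK⟩ := hF.bdd t' ht2
  have hK0 : 0 ≤ K := (norm_nonneg _).trans (hK t ⟨ht.1.le, ht1.le⟩)
  have hcM : ContinuousAt (fun s => MM l b (F s)) t := hF.cont.continuousAt (Ico_mem_nhds ht.1 ht.2)
  rw [Metric.continuousAt_iff']
  intro ε hε
  -- θ(t) is approximated by M η. Since ⟨F, M η⟩ = ⟨M F, η⟩ is continuous, only errors controlled by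
  -- the bound K on F remain.
  obtain ⟨η, hη⟩ := (h.MM_denseRange).exists_dist_lt (θ t) (ε := ε / (4 * (K + 1))) (by positivity)
  have h1 : ∀ᶠ s in 𝓝 t, ‖θ s - θ t‖ < ε / (4 * (K + 1)) := by
    have := Metric.continuousAt_iff'.1 hθ (ε / (4 * (K + 1))) (by positivity)
    simpa only [dist_eq_norm] using this
  have h2 : ∀ᶠ s in 𝓝 t, |(inner ℝ (MM l b (F s)) η : ℝ) - inner ℝ (MM l b (F t)) η| < ε / 4 := by
    have hc : ContinuousAt (fun s => (inner ℝ (MM l b (F s)) η : ℝ)) t :=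
      hcM.inner continuousAt_const
    have := Metric.continuousAt_iff'.1 hc (ε / 4) (by positivity)
    simpa only [Real.dist_eq] using this
  filter_upwards [h1, h2, Ioo_mem_nhds ht.1 ht1] with s hs1 hs2 hs3
  rw [dist_eq_norm] at hη
  have hFs := hK s ⟨hs3.1.le, hs3.2.le⟩
  have hFt := hK t ⟨ht.1.le, ht1.le⟩
  have e : (inner ℝ (F s) (θ s) : ℝ) - inner ℝ (F t) (θ t) = inner ℝ (F s) (θ s - θ t) +
      (inner ℝ (F s) (θ t - MM l b η) - inner ℝ (F t) (θ t - MM l b η)) +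
      (inner ℝ (MM l b (F s)) η - inner ℝ (MM l b (F t)) η) := by
    rw [h.inner_MM, h.inner_MM]
    simp only [inner_sub_right]; ring
  have b1 : |(inner ℝ (F s) (θ s - θ t) : ℝ)| ≤ K * (ε / (4 * (K + 1))) :=
    (abs_real_inner_le_norm _ _).trans (mul_le_mul hFs hs1.le (norm_nonneg _) hK0)
  have b2 : |(inner ℝ (F s) (θ t - MM l b η) : ℝ)| ≤ K * (ε / (4 * (K + 1))) :=
    (abs_real_inner_le_norm _ _).trans (mul_le_mul hFs hη.le (norm_nonneg _) hK0)
  have b3 : |(inner ℝ (F t) (θ t - MM l b η) : ℝ)| ≤ K * (ε / (4 * (K + 1))) :=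
    (abs_real_inner_le_norm _ _).trans (mul_le_mul hFt hη.le (norm_nonneg _) hK0)
  have b4 : K * (ε / (4 * (K + 1))) ≤ ε / 4 := by
    rw [← mul_div_assoc, div_le_div_iff₀ (by positivity) (by positivity)]; nlinarith
  rw [Real.dist_eq, e]
  refine (abs_add_le _ _).trans_lt ?_
  have b5 := abs_add_le (inner ℝ (F s) (θ s - θ t) : ℝ)
    (inner ℝ (F s) (θ t - MM l b η) - inner ℝ (F t) (θ t - MM l b η))
  have b6 := abs_sub (inner ℝ (F s) (θ t - MM l b η) : ℝ) (inner ℝ (F t) (θ t - MM l b η))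
  linarith

/-- The profile is weakly differentiable. -/
lemma hasDerivAt_inner_profile {T : ℝ} {F : ℝ → L2R} (hF : Forcing l b T F) (z₀ : L2R) (e : ℝ)
    {t : ℝ} (ht : t ∈ Ioo 0 T) (η : L2R) :
    HasDerivAt (fun s => (inner ℝ (z₀ + e • ∫ x in (0 : ℝ)..s, SS l (-(e * x)) (F x)) η : ℝ))
      (e * inner ℝ (F t) (SS l (e * t) η)) t := by
  have h0 : (0 : ℝ) ∈ Ico 0 T := ⟨le_rfl, ht.1.trans ht.2⟩
  have hcs : ∀ s ∈ Ioo 0 T, ContinuousAt (fun s => (inner ℝ (F s) (SS l (e * s) η) : ℝ)) s :=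
    fun s hs => h.tendsto_inner_forcing hF hs
      (((h.continuous_SS η).comp (continuous_const.mul continuous_id)).continuousAt)
  have hinn : ∀ x, (inner ℝ (SS l (-(e * x)) (F x)) η : ℝ) = inner ℝ (F x) (SS l (e * x) η) :=
    fun x => by rw [h.inner_SS, neg_neg]
  have hcon : ContinuousOn (fun s => (inner ℝ (F s) (SS l (e * s) η) : ℝ)) (Ioo 0 T) :=
    fun s hs => (hcs s hs).continuousWithinAt
  have hi : ∀ s ∈ Ico 0 T, inner ℝ (∫ x in (0 : ℝ)..s, SS l (-(e * x)) (F x)) η =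
      ∫ x in (0 : ℝ)..s, (inner ℝ (F x) (SS l (e * x) η) : ℝ) := fun s hs => by
    have := ContinuousLinearMap.intervalIntegral_comp_comm (innerSL ℝ η)
      (hF.intervalIntegrable h e h0 hs)
    simp only [innerSL_apply_apply] at this
    rw [real_inner_comm, ← this]
    refine intervalIntegral.integral_congr fun x _ => ?_
    simp only [← hinn, real_inner_comm]
  have hii : IntervalIntegrable (fun x => (inner ℝ (F x) (SS l (e * x) η) : ℝ)) volume 0 t := by
    have h1 := hF.intervalIntegrable h e h0 ⟨ht.1.le, ht.2⟩
    have h2 : (fun x => (inner ℝ (F x) (SS l (e * x) η) : ℝ)) =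
        fun x => innerSL ℝ η (SS l (-(e * x)) (F x)) := funext fun x => by
      rw [← hinn, innerSL_apply_apply, real_inner_comm]
    rw [h2]
    exact ⟨(innerSL ℝ η).integrable_comp h1.1, (innerSL ℝ η).integrable_comp h1.2⟩
  have hd : HasDerivAt (fun s => ∫ x in (0 : ℝ)..s, (inner ℝ (F x) (SS l (e * x) η) : ℝ))
      (inner ℝ (F t) (SS l (e * t) η)) t :=
    intervalIntegral.integral_hasDerivAt_right hii
      (hcon.stronglyMeasurableAtFilter isOpen_Ioo t ht) (hcs t ht)
  refine ((hd.const_mul e).const_add (inner ℝ z₀ η)).congr_of_eventuallyEq ?_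
  filter_upwards [Ioo_mem_nhds ht.1 ht.2] with s hs
  rw [inner_add_left, real_inner_smul_left, hi s ⟨hs.1.le, hs.2⟩]

/-- Unitarity moves the group to ψ: the product of the weakly differentiable profile with S(-et)ψ
remains, and the latter is strongly differentiable because ψ is in the domain of iω(D). -/
lemma hasDerivAt_inner_duh {T : ℝ} {F : ℝ → L2R} (hF : Forcing l b T F) (z₀ : L2R) {e : ℝ}
    (he : |e| = 1) {ψ χ : L2R} (hψ : IsMul (fun ξ => Complex.I * omega l ξ) ψ χ) {t : ℝ}
    (ht : t ∈ Ioo 0 T) :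
    HasDerivAt (fun s => (inner ℝ (duh l z₀ e F s) ψ : ℝ))
      (e * inner ℝ (F t) ψ - e * inner ℝ (duh l z₀ e F t) χ) t := by
  have hB : HasDerivAt (fun s => SS l (-(e * s)) ψ) ((-e) • SS l (-(e * t)) χ) t := by
    have h1 : HasDerivAt (fun s : ℝ => -(e * s)) (-e) t := by
      simpa using (hasDerivAt_id t).const_mul (-e)
    exact (h.hasDerivAt_SS hψ (-(e * t))).scomp t h1
  have hA : ContinuousAt (fun s => z₀ + e • ∫ x in (0 : ℝ)..s, SS l (-(e * x)) (F x)) t :=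
    continuousAt_const.add
      ((h.continuousOn_profile hF he).continuousAt (Ico_mem_nhds ht.1 ht.2))
  have key := hasDerivAt_inner_of_weak hA (h.hasDerivAt_inner_profile hF z₀ e ht _) hB
  refine (key.congr_deriv ?_).congr_of_eventuallyEq (Eventually.of_forall fun s => ?_)
  · rw [real_inner_smul_right, duh, h.inner_SS _ _ χ, ← h.SS_add, add_neg_cancel, h.SS_zero]
    ring
  · simp only [duh]
    rw [h.inner_SS]

/-- Energy identity for Duhamel's formula. -/
lemma hasDerivAt_norm_sq_duh {T : ℝ} {F : ℝ → L2R} (hF : Forcing l b T F) (z₀ : L2R) {e : ℝ}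
    (he : |e| = 1) {t : ℝ} (ht : t ∈ Ioo 0 T) :
    HasDerivAt (fun s => ‖duh l z₀ e F s‖ ^ 2) (2 * (e * inner ℝ (F t) (duh l z₀ e F t))) t := by
  obtain ⟨t', ht1, ht2⟩ := exists_between ht.2
  obtain ⟨K, hK⟩ := hF.bdd t' ht2
  -- By unitarity the norm is that of the profile, which is Lipschitz although the Duhamel curve
  -- itself need not be.
  have := hasDerivAt_norm_sq_of_weak (K := K)
    (A := fun s => z₀ + e • ∫ x in (0 : ℝ)..s, SS l (-(e * x)) (F x)) (t := t) ?_
    (h.hasDerivAt_inner_profile hF z₀ e ht _)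
  · refine this.congr_of_eventuallyEq (Eventually.of_forall fun s => ?_)
    simp only [duh, h.norm_SS]
  · filter_upwards [Ioo_mem_nhds ht.1 ht1] with s hs
    rw [add_sub_add_left_eq_sub]
    refine h.norm_profile_sub_le hF he ⟨ht.1.le, ht.2⟩ ⟨hs.1.le, hs.2.trans ht2⟩ fun x hx =>
      hK x ⟨(le_min ht.1.le hs.1.le).trans hx.1, hx.2.trans (max_le ht1.le hs.2.le)⟩

lemma hasDerivAt_inner_solA {T : ℝ} {F : ℝ → L2R} (hF : Forcing l b T F) (a₀ c₀ : L2R)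
    {ψ χ : L2R} (hψ : IsMul (fun ξ => Complex.I * omega l ξ) ψ χ) {t : ℝ} (ht : t ∈ Ioo 0 T) :
    HasDerivAt (fun s => (inner ℝ (solA l a₀ c₀ F s) ψ : ℝ)) (-inner ℝ (solC l a₀ c₀ F t) χ) t := by
  have h1 := h.hasDerivAt_inner_duh hF (a₀ + c₀) (e := 1) (by simp) hψ ht
  have h2 := h.hasDerivAt_inner_duh hF (a₀ - c₀) (e := -1) (by simp) hψ ht
  refine (((h1.add h2).const_mul (1 / 2)).congr_deriv ?_).congr_of_eventuallyEq
    (Eventually.of_forall fun s => ?_)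
  · rw [solC, real_inner_smul_left, inner_sub_left]; ring
  · simp only [solA, real_inner_smul_left, inner_add_left, Pi.add_apply]

lemma hasDerivAt_inner_solC {T : ℝ} {F : ℝ → L2R} (hF : Forcing l b T F) (a₀ c₀ : L2R)
    {ψ χ : L2R} (hψ : IsMul (fun ξ => Complex.I * omega l ξ) ψ χ) {t : ℝ} (ht : t ∈ Ioo 0 T) :
    HasDerivAt (fun s => (inner ℝ (solC l a₀ c₀ F s) ψ : ℝ))
      (-inner ℝ (solA l a₀ c₀ F t) χ + inner ℝ (F t) ψ) t := by
  have h1 := h.hasDerivAt_inner_duh hF (a₀ + c₀) (e := 1) (by simp) hψ ht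
  have h2 := h.hasDerivAt_inner_duh hF (a₀ - c₀) (e := -1) (by simp) hψ ht
  refine (((h1.sub h2).const_mul (1 / 2)).congr_deriv ?_).congr_of_eventuallyEq
    (Eventually.of_forall fun s => ?_)
  · rw [solA, real_inner_smul_left, inner_add_left]; ring
  · simp only [solC, real_inner_smul_left, inner_sub_left, Pi.sub_apply]

omit h in
lemma _root_.NonlocalWave.norm_sq_sol (l : ℝ → ℝ) (a₀ c₀ : L2R) (F : ℝ → L2R) (t : ℝ) :
    ‖solA l a₀ c₀ F t‖ ^ 2 + ‖solC l a₀ c₀ F t‖ ^ 2 =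
      1 / 2 * (‖duh l (a₀ + c₀) 1 F t‖ ^ 2 + ‖duh l (a₀ - c₀) (-1) F t‖ ^ 2) := by
  rw [solA, solC, norm_smul, norm_smul, mul_pow, mul_pow, norm_add_sq_real, norm_sub_sq_real,
    Real.norm_of_nonneg (by norm_num)]
  ring

lemma hasDerivAt_norm_sq_sol {T : ℝ} {F : ℝ → L2R} (hF : Forcing l b T F) (a₀ c₀ : L2R)
    {t : ℝ} (ht : t ∈ Ioo 0 T) :
    HasDerivAt (fun s => ‖solA l a₀ c₀ F s‖ ^ 2 + ‖solC l a₀ c₀ F s‖ ^ 2)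
      (2 * inner ℝ (F t) (solC l a₀ c₀ F t)) t := by
  have h1 := h.hasDerivAt_norm_sq_duh hF (a₀ + c₀) (e := 1) (by simp) ht
  have h2 := h.hasDerivAt_norm_sq_duh hF (a₀ - c₀) (e := -1) (by simp) ht
  refine (((h1.add h2).const_mul (1 / 2)).congr_deriv ?_).congr_of_eventuallyEq
    (Eventually.of_forall fun s => ?_)
  · rw [solC, real_inner_smul_right, inner_sub_right]; ring
  · simp only [norm_sq_sol, Pi.add_apply]

lemma solA_zero (a₀ c₀ : L2R) (F : ℝ → L2R) : solA l a₀ c₀ F 0 = a₀ := by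
  rw [solA, h.duh_zero, h.duh_zero, add_add_sub_cancel, ← two_smul ℝ, smul_smul]; norm_num

lemma solC_zero (a₀ c₀ : L2R) (F : ℝ → L2R) : solC l a₀ c₀ F 0 = c₀ := by
  rw [solC, h.duh_zero, h.duh_zero, add_sub_sub_cancel, ← two_smul ℝ, smul_smul]; norm_num

end Admissible

/-! ### Locally bounded symbols and weak skew systems -/

/-- A locally bounded Hermitian symbol. -/
structure LocSymbol (m : ℝ → ℂ) : Prop where
  meas : Measurable m
  herm : ∀ ξ, m (-ξ) = (starRingEnd ℂ) (m ξ)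
  bdd : ∀ R : ℝ, ∃ C : ℝ, ∀ ξ, |ξ| ≤ R → ‖m ξ‖ ≤ C

namespace LocSymbol

variable {m n : ℝ → ℂ}

lemma mul (hm : LocSymbol m) (hn : LocSymbol n) : LocSymbol (fun ξ => m ξ * n ξ) where
  meas := hm.meas.mul hn.meas
  herm ξ := by rw [hm.herm, hn.herm, map_mul]
  bdd R := by
    obtain ⟨C, hC⟩ := hm.bdd R
    obtain ⟨D, hD⟩ := hn.bdd R
    refine ⟨C * D, fun ξ hξ => ?_⟩
    rw [norm_mul]
    exact mul_le_mul (hC ξ hξ) (hD ξ hξ) (norm_nonneg _) ((norm_nonneg _).trans (hC ξ hξ))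

lemma bddSymbol (hm : LocSymbol m) (k : ℕ) : ∃ C, BddSymbol (fun ξ => m ξ * cutoff k ξ) C := by
  obtain ⟨C, hC⟩ := hm.bdd (k + 2)
  exact ⟨C, cutoff_mul_symbol hm.meas hm.herm k hC⟩

lemma isMul_cutoff (hm : LocSymbol m) (k : ℕ) (f : L2R) :
    IsMul (fun ξ => m ξ * cutoff k ξ) f (Mop (fun ξ => m ξ * cutoff k ξ) f) := by
  obtain ⟨C, hC⟩ := hm.bddSymbol k
  exact hC.isMul f

end LocSymbol

lemma locSymbol_deriv : LocSymbol (fun ξ => Complex.I * ξ) where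
  meas := by fun_prop
  herm ξ := by simp
  bdd R := ⟨R, fun ξ hξ => by simpa using hξ⟩

lemma Comparable.locSymbol {s : ℝ} {k : ℝ → ℝ} (hk : Comparable s k) :
    LocSymbol (fun ξ => (k ξ : ℂ)) where
  meas := Complex.measurable_ofReal.comp hk.meas
  herm ξ := by rw [hk.even, Complex.conj_ofReal]
  bdd R := by
    obtain ⟨C, hC, hb⟩ := hk.norm_le
    refine ⟨C * (1 + R ^ 2) ^ |s|, fun ξ hξ => (hb ξ).trans ?_⟩
    refine mul_le_mul_of_nonneg_left ((br_rpow_le (le_abs_self s) ξ).trans ?_) hC.le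
    refine Real.rpow_le_rpow (br_pos ξ).le ?_ (abs_nonneg s)
    have := pow_le_pow_left₀ (abs_nonneg ξ) hξ 2
    rw [sq_abs] at this
    unfold br; linarith

/-- The operator `b^{1/2}(D)`. -/
def NN (b : ℝ → ℝ) : L2R →L[ℝ] L2R := Mop (fun ξ => ((b ξ ^ (1 / 2 : ℝ) : ℝ) : ℂ))

lemma cutoff_conj (n : ℕ) (ξ : ℝ) : (starRingEnd ℂ) (cutoff n ξ) = cutoff n ξ := by
  rw [cutoff, Complex.conj_ofReal]

namespace Admissible

variable {ρ r : ℝ} {l b : ℝ → ℝ} (h : Admissible ρ r l b)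
include h

lemma isMul_NN (a : L2R) : IsMul (fun ξ => ((b ξ ^ (1 / 2 : ℝ) : ℝ) : ℂ)) a (NN b a) := by
  obtain ⟨D, hD, hM⟩ := h.bdd_bRoot
  exact hM.isMul a

lemma NN_injective : Function.Injective (NN b) := fun a a' e =>
  (h.isMul_NN a).cancel h.comparable_bRoot.ne_zero (e ▸ h.isMul_NN a')

lemma inner_NN (f k : L2R) : (inner ℝ (NN b f) k : ℝ) = inner ℝ f (NN b k) :=
  (h.isMul_NN f).inner_eq (h.isMul_NN k) fun ξ => by rw [Complex.conj_ofReal]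

lemma locSymbol_omega : LocSymbol (fun ξ => Complex.I * omega l ξ) := by
  have := locSymbol_deriv.mul h.comparable_lRoot.locSymbol
  refine (funext fun ξ => ?_ : (fun ξ : ℝ => Complex.I * (ξ : ℂ) * ((l ξ ^ (1 / 2 : ℝ) : ℝ) : ℂ)) =
    fun ξ => Complex.I * omega l ξ) ▸ this
  rw [omega]; push_cast; ring

omit h in
lemma omega_conj (ξ : ℝ) : (starRingEnd ℂ) (Complex.I * (omega l ξ : ℂ)) =
    -(Complex.I * omega l ξ) := by
  rw [map_mul, Complex.conj_I, Complex.conj_ofReal, neg_mul]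

/-- If `⟪α, m(D)φ⟫' = -⟪γ, iω m(D)φ⟫` for all Schwartz `φ`, then the frequency-truncated curve is
differentiable in `L²`. -/
lemma hasDerivAt_cutoff {s : ℝ} {m : ℝ → ℝ} (hm : Comparable s m) (hs : s ≤ 0) {T : ℝ}
    {α γ : ℝ → L2R} (hγ : ContinuousOn γ (Ico 0 T))
    (hw : ∀ (φ : 𝓢(ℝ, ℝ)) (χ : L2R),
      IsMul (fun ξ => Complex.I * omega l ξ) (Mop (fun ξ => (m ξ : ℂ)) (testL2 φ)) χ →
      ∀ t ∈ Ioo 0 T, HasDerivAt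
        (fun τ => (inner ℝ (α τ) (Mop (fun ξ => (m ξ : ℂ)) (testL2 φ)) : ℝ))
        (-inner ℝ (γ t) χ) t) (n : ℕ) {t : ℝ} (ht : t ∈ Ioo 0 T) :
    HasDerivAt (fun τ => Mop (cutoff n) (Mop (cutoff n) (α τ)))
      (Mop (cutoff n) (Mop (fun ξ => Complex.I * omega l ξ * cutoff n ξ) (γ t))) t := by
  obtain ⟨C, hC, hmb⟩ := hm.bddSymbol hs
  have hmω := h.locSymbol_omega.mul hm.locSymbol
  have hminv : LocSymbol (fun ξ => ((m ξ ^ (-1 : ℝ) : ℝ) : ℂ)) := (hm.rpow (-1)).locSymbol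
  -- Tests of the form m(D)φ only see m(D)α, so that quantity is differentiated first; the
  -- multiplier m⁻¹ is bounded after a second cutoff and removes m. This is why the cutoff appears
  -- twice.
  have step : HasDerivAt (fun τ => Mop (fun ξ => (m ξ : ℂ) * cutoff n ξ) (α τ))
      (Mop (fun ξ => Complex.I * omega l ξ * m ξ * cutoff n ξ) (γ t)) t := by
    refine hasDerivAt_of_weak (ψ := testL2) (fun f k => eq_of_inner_testL2) isOpen_Ioo
      ordConnected_Ioo (A' := fun t => Mop (fun ξ => Complex.I * omega l ξ * m ξ * cutoff n ξ) (γ t))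
      ?_ (fun φ τ hτ => ?_) ht
    · exact (ContinuousLinearMap.continuous _).comp_continuousOn
        (hγ.mono Ioo_subset_Ico_self)
    · obtain ⟨ψ, hψ⟩ := exists_testL2_cutoff n φ
      have h1 : IsMul (fun ξ => (m ξ : ℂ) * cutoff n ξ) (testL2 φ)
          (Mop (fun ξ => (m ξ : ℂ)) (testL2 ψ)) := hψ.comp (hmb.isMul _)
      have h2 := hmω.isMul_cutoff n (testL2 φ)
      have h3 : IsMul (fun ξ => Complex.I * omega l ξ) (Mop (fun ξ => (m ξ : ℂ)) (testL2 ψ))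
          (Mop (fun ξ => Complex.I * omega l ξ * m ξ * cutoff n ξ) (testL2 φ)) := by
        filter_upwards [h1, h2] with x e1 e2
        rw [e2, e1]; ring
      have h4 := hw ψ _ h3 τ hτ
      have h5 : ∀ a : L2R, (inner ℝ (Mop (fun ξ => (m ξ : ℂ) * cutoff n ξ) a) (testL2 φ) : ℝ) =
          inner ℝ a (Mop (fun ξ => (m ξ : ℂ)) (testL2 ψ)) := fun a =>
        (hm.locSymbol.isMul_cutoff n a).inner_eq h1 fun ξ => by
          rw [map_mul, Complex.conj_ofReal, cutoff_conj]
      simp_rw [h5]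
      refine h4.congr_deriv ?_
      refine ((hmω.isMul_cutoff n (γ τ)).inner_eq_neg h2 fun ξ => ?_).symm
      rw [map_mul, map_mul, omega_conj, cutoff_conj, Complex.conj_ofReal]; ring
  have hinv : ∀ ξ, ((m ξ ^ (-1 : ℝ) : ℝ) : ℂ) * (m ξ : ℂ) = 1 := fun ξ => by
    rw [Real.rpow_neg_one, Complex.ofReal_inv, inv_mul_cancel₀ (hm.ne_zero ξ)]
  have key := (Mop (fun ξ => ((m ξ ^ (-1 : ℝ) : ℝ) : ℂ) * cutoff n ξ)).hasFDerivAt.comp_hasDerivAt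
    t step
  have e1 : ∀ a : L2R, Mop (fun ξ => ((m ξ ^ (-1 : ℝ) : ℝ) : ℂ) * cutoff n ξ)
      (Mop (fun ξ => (m ξ : ℂ) * cutoff n ξ) a) = Mop (cutoff n) (Mop (cutoff n) a) := fun a => by
    refine (((hm.locSymbol.isMul_cutoff n a).comp (hminv.isMul_cutoff n _)).congr fun ξ => ?_).unique
      (((cutoff_symbol n).isMul a).comp ((cutoff_symbol n).isMul _))
    linear_combination (cutoff n ξ * cutoff n ξ) * hinv ξ
  have e2 : ∀ a : L2R, Mop (fun ξ => ((m ξ ^ (-1 : ℝ) : ℝ) : ℂ) * cutoff n ξ)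
      (Mop (fun ξ => Complex.I * omega l ξ * m ξ * cutoff n ξ) a) =
      Mop (cutoff n) (Mop (fun ξ => Complex.I * omega l ξ * cutoff n ξ) a) := fun a => by
    refine (((hmω.isMul_cutoff n a).comp (hminv.isMul_cutoff n _)).congr fun ξ => ?_).unique
      ((h.locSymbol_omega.isMul_cutoff n a).comp ((cutoff_symbol n).isMul _))
    linear_combination (Complex.I * omega l ξ * cutoff n ξ * cutoff n ξ) * hinv ξ
  rw [e2] at key
  exact key.congr_of_eventuallyEq (Eventually.of_forall fun τ => (e1 _).symm)

/-- Uniqueness for the weak homogeneous system `α' = iω γ`, `γ' = iω α`. -/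
lemma eq_zero_of_weak {s s' : ℝ} {m m' : ℝ → ℝ} (hm : Comparable s m) (hs : s ≤ 0)
    (hm' : Comparable s' m') (hs' : s' ≤ 0) {T : ℝ} {α γ : ℝ → L2R}
    (hα : ContinuousOn α (Ico 0 T)) (hγ : ContinuousOn γ (Ico 0 T)) (hα0 : α 0 = 0) (hγ0 : γ 0 = 0)
    (hw : ∀ (φ : 𝓢(ℝ, ℝ)) (χ : L2R),
      IsMul (fun ξ => Complex.I * omega l ξ) (Mop (fun ξ => (m ξ : ℂ)) (testL2 φ)) χ →
      ∀ t ∈ Ioo 0 T, HasDerivAt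
        (fun τ => (inner ℝ (α τ) (Mop (fun ξ => (m ξ : ℂ)) (testL2 φ)) : ℝ)) (-inner ℝ (γ t) χ) t)
    (hw' : ∀ (φ : 𝓢(ℝ, ℝ)) (χ : L2R),
      IsMul (fun ξ => Complex.I * omega l ξ) (Mop (fun ξ => (m' ξ : ℂ)) (testL2 φ)) χ →
      ∀ t ∈ Ioo 0 T, HasDerivAt
        (fun τ => (inner ℝ (γ τ) (Mop (fun ξ => (m' ξ : ℂ)) (testL2 φ)) : ℝ)) (-inner ℝ (α t) χ) t)
    {t : ℝ} (ht : t ∈ Ico 0 T) : α t = 0 ∧ γ t = 0 := by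
  have key : ∀ n, Mop (cutoff n) (Mop (cutoff n) (α t)) = 0 ∧
      Mop (cutoff n) (Mop (cutoff n) (γ t)) = 0 := fun n => by
    set P : L2R → L2R := fun f => Mop (cutoff n) (Mop (cutoff n) f) with hP
    set W : L2R → L2R := fun f =>
      Mop (cutoff n) (Mop (fun ξ => Complex.I * omega l ξ * cutoff n ξ) f) with hW
    have hPc : Continuous P := (Mop (cutoff n)).continuous.comp (Mop (cutoff n)).continuous
    -- Skew-adjointness of iω(D): the cross terms cancel and the truncated L² norm of (α, γ) is
    -- conserved.
    have hsk : ∀ f k, (inner ℝ (P f) (W k) : ℝ) + inner ℝ (P k) (W f) = 0 := fun f k => by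
      have hPW : ∀ f, IsMul (fun ξ => Complex.I * omega l ξ) (P f) (W f) := fun f => by
        filter_upwards [((cutoff_symbol n).isMul f).comp ((cutoff_symbol n).isMul _),
          (h.locSymbol_omega.isMul_cutoff n f).comp ((cutoff_symbol n).isMul _)] with x e1 e2
        rw [e1, e2]; ring
      have := (hPW f).inner_eq_neg (hPW k) omega_conj
      rw [real_inner_comm (W f) (P k), this]; ring
    have hd : ∀ τ ∈ Ioo 0 T, HasDerivAt (fun τ => ‖P (α τ)‖ ^ 2 + ‖P (γ τ)‖ ^ 2) 0 τ :=
      fun τ hτ => by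
        have h1 := (h.hasDerivAt_cutoff hm hs hγ hw n hτ).norm_sq
        have h2 := (h.hasDerivAt_cutoff hm' hs' hα hw' n hτ).norm_sq
        refine (h1.add h2).congr_deriv ?_
        rw [← mul_add]
        exact mul_eq_zero_of_right _ (hsk (α τ) (γ τ))
    have hc : ContinuousOn (fun τ => ‖P (α τ)‖ ^ 2 + ‖P (γ τ)‖ ^ 2) (Icc 0 t) := by
      have hsub : Icc 0 t ⊆ Ico 0 T := fun x hx => ⟨hx.1, hx.2.trans_lt ht.2⟩
      exact ((hPc.comp_continuousOn (hα.mono hsub)).norm.pow 2).add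
        ((hPc.comp_continuousOn (hγ.mono hsub)).norm.pow 2)
    have h0 : ‖P (α t)‖ ^ 2 + ‖P (γ t)‖ ^ 2 = 0 := by
      rcases ht.1.eq_or_lt with rfl | ht0
      · simp [hP, hα0, hγ0]
      · obtain ⟨x, hx, hx'⟩ := exists_hasDerivAt_eq_slope _ (fun _ => (0 : ℝ)) ht0 hc
          fun τ hτ => hd τ ⟨hτ.1, hτ.2.trans ht.2⟩
        rw [eq_div_iff (by linarith), zero_mul, eq_comm, sub_eq_zero] at hx'
        rw [hx']
        simp [hP, hα0, hγ0]
    have h1 := sq_nonneg ‖P (α t)‖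
    have h2 := sq_nonneg ‖P (γ t)‖
    exact ⟨norm_eq_zero.1 (pow_eq_zero_iff two_ne_zero |>.1 (by linarith)),
      norm_eq_zero.1 (pow_eq_zero_iff two_ne_zero |>.1 (by linarith))⟩
  -- The cutoff is self-adjoint, so ‖χf‖² = ⟨f, χ²f⟩.
  have fin : ∀ f : L2R, (∀ n, Mop (cutoff n) (Mop (cutoff n) f) = 0) → f = 0 := fun f hf =>
    eq_of_cutoff fun n => by
      rw [map_zero, ← inner_self_eq_zero (𝕜 := ℝ), ((cutoff_symbol n).isMul f).inner_eq
        ((cutoff_symbol n).isMul _) (fun ξ => (cutoff_conj n ξ).symm), hf n, inner_zero_right]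
  exact ⟨fin _ fun n => (key n).1, fin _ fun n => (key n).2⟩

/-- If `⟪f, ψ⟫ = -⟪k, iωψ⟫` for all `ψ` in the domain of `iω(D)`, then `f = iω(D) k`. -/
lemma isMul_omega_of_weak {f k : L2R} (hw : ∀ ψ χ, IsMul (fun ξ => Complex.I * omega l ξ) ψ χ →
    (inner ℝ f ψ : ℝ) = -inner ℝ k χ) : IsMul (fun ξ => Complex.I * omega l ξ) k f := by
  refine isMul_of_cutoff fun n => ?_
  have hs := h.locSymbol_omega.isMul_cutoff n
  suffices e : Mop (cutoff n) f = Mop (fun ξ => Complex.I * omega l ξ * cutoff n ξ) k by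
    rw [e]; exact hs k
  refine ext_inner_right ℝ fun φ => ?_
  have h1 : IsMul (fun ξ => Complex.I * omega l ξ) (Mop (cutoff n) φ)
      (Mop (fun ξ => Complex.I * omega l ξ * cutoff n ξ) φ) := by
    filter_upwards [(cutoff_symbol n).isMul φ, hs φ] with x e1 e2
    rw [e1, e2]; ring
  rw [((cutoff_symbol n).isMul f).inner_eq ((cutoff_symbol n).isMul φ)
    (fun ξ => (cutoff_conj n ξ).symm), hw _ _ h1, (hs k).inner_eq_neg (hs φ) fun ξ => ?_]
  rw [map_mul, omega_conj, cutoff_conj]; ring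

end Admissible

/-! ### Mild solutions and distributional solutions -/

namespace Comparable

variable {s : ℝ} {k : ℝ → ℝ}

lemma continuousInH (hk : Comparable (s / 2) k) {T : ℝ} {u a : ℝ → L2R}
    (hua : ∀ t ∈ Ico 0 T, IsMul (fun ξ => (k ξ : ℂ)) (u t) (a t)) (ha : ContinuousOn a (Ico 0 T)) :
    ContinuousInH s T u := by
  obtain ⟨A, hA, hn⟩ := hk.normH_equiv
  refine ⟨fun t ht => (hk.memH_iff _).2 ⟨_, hua t ht⟩, fun t ht => ?_⟩
  have h1 : Tendsto (fun τ => A * ‖a τ - a t‖) (𝓝[Ico 0 T] t) (𝓝 0) := by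
    simpa using ((tendsto_iff_norm_sub_tendsto_zero.1 (ha t ht)).const_mul A)
  refine squeeze_zero' (Eventually.of_forall fun _ => Real.sqrt_nonneg _) ?_ h1
  filter_upwards [self_mem_nhdsWithin] with τ hτ
  exact (hn _ _ ((hua τ hτ).sub (hua t ht))).1

lemma continuousOn_of_continuousInH (hk : Comparable (s / 2) k) {T : ℝ} {u a : ℝ → L2R}
    (hua : ∀ t ∈ Ico 0 T, IsMul (fun ξ => (k ξ : ℂ)) (u t) (a t)) (hu : ContinuousInH s T u) :
    ContinuousOn a (Ico 0 T) := by
  obtain ⟨A, hA, hn⟩ := hk.normH_equiv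
  intro t ht
  have h1 := (hu.2 t ht).const_mul A
  rw [mul_zero] at h1
  refine tendsto_iff_norm_sub_tendsto_zero.2
    (squeeze_zero' (Eventually.of_forall fun _ => norm_nonneg _) ?_ h1)
  filter_upwards [self_mem_nhdsWithin] with τ hτ
  exact (hn _ _ ((hua τ hτ).sub (hua t ht))).2

end Comparable

namespace Admissible

variable {ρ r : ℝ} {l b : ℝ → ℝ} (h : Admissible ρ r l b)
include h

lemma isMul_MInv_MM (a : L2R) :
    IsMul (fun ξ => (((b ξ) ^ (-(1 / 2) : ℝ) * (l ξ) ^ (1 / 2 : ℝ) : ℝ) : ℂ)) (MM l b a) a :=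
  h.isMul_MInv_iff.2 (h.isMul_MM a)

lemma isMul_bInv_NN (c : L2R) :
    IsMul (fun ξ => (((b ξ) ^ (-(1 / 2) : ℝ) : ℝ) : ℂ)) (NN b c) c :=
  h.isMul_bInv_iff.2 (h.isMul_NN c)

lemma memH_MM (a : L2R) : MemH (s₀ ρ r) (MM l b a) :=
  (h.comparable_MInv.memH_iff _).2 ⟨a, h.isMul_MInv_MM a⟩

lemma memH_NN (c : L2R) : MemH (s₀ ρ r - ρ / 2) (NN b c) :=
  (h.comparable_bInv.memH_iff _).2 ⟨c, h.isMul_bInv_NN c⟩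

lemma exists_MM_eq {u : L2R} (hu : MemH (s₀ ρ r) u) : ∃ a, MM l b a = u := by
  obtain ⟨a, ha⟩ := (h.comparable_MInv.memH_iff u).1 hu
  exact ⟨a, (h.isMul_MM a).unique (h.isMul_MInv_iff.1 ha)⟩

lemma exists_NN_eq {w : L2R} (hw : MemH (s₀ ρ r - ρ / 2) w) : ∃ c, NN b c = w := by
  obtain ⟨c, hc⟩ := (h.comparable_bInv.memH_iff w).1 hw
  exact ⟨c, (h.isMul_NN c).unique (h.isMul_bInv_iff.1 hc)⟩

lemma b_half_mul (ξ : ℝ) :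
    (((b ξ ^ (1 / 2 : ℝ) : ℝ) : ℂ)) * ((b ξ ^ (1 / 2 : ℝ) : ℝ) : ℂ) = (b ξ : ℂ) := by
  rw [← Complex.ofReal_mul, rpow_half_mul (h.comparable_b.pos ξ)]

/-- With the next identity this is the algebra of the change of variables: iω M = N ∂ₓ turns u_t =
w_x into a_t = iω c, and M L ∂ₓ = iω N handles the linear part of the other equation. -/
lemma omega_mul_symM (ξ : ℝ) : Complex.I * (omega l ξ : ℂ) * (symM l b ξ : ℂ) =
    ((b ξ ^ (1 / 2 : ℝ) : ℝ) : ℂ) * (Complex.I * ξ) := by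
  have e : (((l ξ ^ (1 / 2 : ℝ) : ℝ) : ℂ)) * ((l ξ ^ (-(1 / 2) : ℝ) : ℝ) : ℂ) = 1 := by
    rw [← Complex.ofReal_mul, rpow_half_mul_neg (h.comparable_l.pos ξ), Complex.ofReal_one]
  rw [omega, symM]
  push_cast
  linear_combination (Complex.I * ξ * ((b ξ ^ (1 / 2 : ℝ) : ℝ) : ℂ)) * e

lemma symM_mul_l (ξ : ℝ) : (symM l b ξ : ℂ) * (l ξ : ℂ) * (Complex.I * ξ) =
    Complex.I * (omega l ξ : ℂ) * ((b ξ ^ (1 / 2 : ℝ) : ℝ) : ℂ) := by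
  have e : (((l ξ ^ (-(1 / 2) : ℝ) : ℝ) : ℂ)) * (l ξ : ℂ) = ((l ξ ^ (1 / 2 : ℝ) : ℝ) : ℂ) := by
    rw [← Complex.ofReal_mul]
    congr 1
    nth_rw 2 [← rpow_half_mul (h.comparable_l.pos ξ)]
    rw [← mul_assoc, mul_comm (l ξ ^ (-(1 / 2) : ℝ)), rpow_half_mul_neg (h.comparable_l.pos ξ),
      one_mul]
  rw [omega, symM]
  push_cast
  linear_combination (Complex.I * ξ * ((b ξ ^ (1 / 2 : ℝ) : ℝ) : ℂ)) * e

lemma isMul_omega_MM (φ : 𝓢(ℝ, ℝ)) :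
    IsMul (fun ξ => Complex.I * omega l ξ) (MM l b (testL2 φ)) (NN b (testDeriv φ)) := by
  filter_upwards [h.isMul_MM (testL2 φ), h.isMul_NN (testDeriv φ), isMul_testDeriv φ]
    with x e1 e2 e3
  rw [e2, e3, e1]
  linear_combination -((Fhat (testL2 φ) : ℝ → ℂ) x) * h.omega_mul_symM (2 * Real.pi * x)

/-- The equation for `w`, tested with `φ`, in the energy variables. -/
lemma exists_omega_NN (φ : 𝓢(ℝ, ℝ)) : ∃ χ, IsMul (fun ξ => Complex.I * omega l ξ)
      (NN b (testL2 φ)) χ ∧ ∀ p > 1, ∀ a : L2R, -inner ℝ (MM l b a) (mult l (testDeriv φ))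
        - ∫ x : ℝ, g p (MM l b a x) * mult b (testDeriv φ) x =
      -inner ℝ a χ + inner ℝ (force l b (g p) a) (NN b (testL2 φ)) := by
  obtain ⟨C, hC, hl⟩ := h.comparable_l.norm_le
  -- An integer power of 1 + ξ² bounding l is needed to apply L to the Schwartz function φ'.
  obtain ⟨k, hk⟩ := exists_nat_ge (ρ / 2)
  obtain ⟨lφ, hlφ⟩ := exists_isMul_testL2 (C := C) (k := k) h.comparable_l.locSymbol.meas
    h.comparable_l.locSymbol.herm (fun ξ => (hl ξ).trans (by
      rw [← Real.rpow_natCast]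
      exact mul_le_mul_of_nonneg_left (br_rpow_le hk ξ) hC.le)) (SchwartzMap.derivCLM ℝ ℝ φ)
  obtain ⟨D, hD, hbb⟩ := h.comparable_b.bddSymbol (by have := h.nonneg_r; linarith)
  have hbφ := hbb.isMul (testDeriv φ)
  set bφ := Mop (fun ξ => (b ξ : ℂ)) (testDeriv φ) with hbφdef
  refine ⟨MM l b lφ, ?_, fun p hp a => ?_⟩
  · filter_upwards [h.isMul_NN (testL2 φ), h.isMul_MM lφ, hlφ, isMul_testDeriv φ]
      with x e1 e2 e3 e4
    change (Fhat lφ : ℝ → ℂ) x = _ * Fhat (testDeriv φ) x at e3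
    rw [e2, e3, e1, e4]
    linear_combination ((Fhat (testL2 φ) : ℝ → ℂ) x) * h.symM_mul_l (2 * Real.pi * x)
  · have h1 : mult l (testDeriv φ) = lφ := hlφ.mult_eq
    rw [h1, hbφ.mult_eq, h.inner_MM]
    -- ∂ₓB^{1/2} N = B ∂ₓ; skew-adjointness then moves the operator from the nonlinear force to the
    -- test function.
    have h2 : IsMul (symK b) (NN b (testL2 φ)) bφ := by
      filter_upwards [h.isMul_NN (testL2 φ), hbφ, isMul_testDeriv φ] with x e1 e2 e3
      rw [e2, e3, e1, ← h.b_half_mul, symK]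
      push_cast
      ring
    rw [(h.isMul_force hp a).inner_eq_neg h2 symK_conj, sub_eq_add_neg]
    congr 2
    rw [L2.inner_def]
    refine integral_congr_ae ?_
    filter_upwards [h.nonlin_g_ae hp a] with x hx
    rw [hx]
    simp [mul_comm]

/-- A mild solution gives a distributional solution. -/
lemma isSolution_of_isMild {p : ℝ} (hp : 1 < p) {a₀ c₀ : L2R} {T : ℝ} (hT : 0 < T) {a : ℝ → L2R}
    (ha : IsMild l (force l b (g p)) a₀ c₀ T a) :
    IsSolution ρ r l b p (MM l b a₀) (NN b c₀) T (fun t => MM l b (a t))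
      (fun t => NN b (solC l a₀ c₀ (fun s => force l b (g p) (a s)) t)) := by
  have hF := (h.locNonl_force hp).forcing ha.cont
  have h0 : (0 : ℝ) ∈ Ico 0 T := ⟨le_rfl, hT⟩
  refine ⟨?_, ?_, ?_, ?_, fun φ t ht => ?_, fun φ t ht => ?_⟩
  · exact h.comparable_MInv.continuousInH (fun t _ => h.isMul_MInv_MM _) ha.cont
  · exact h.comparable_bInv.continuousInH (fun t _ => h.isMul_bInv_NN _)
      (h.continuousOn_solC hF a₀ c₀)
  · simp only [ha.eq 0 h0, h.solA_zero]
  · simp only [h.solC_zero]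
  · simp_rw [h.inner_MM, h.inner_NN]
    refine (h.hasDerivAt_inner_solA hF a₀ c₀ (h.isMul_omega_MM φ) ht).congr_of_eventuallyEq ?_
    filter_upwards [Ioo_mem_nhds ht.1 ht.2] with τ hτ
    rw [ha.eq τ ⟨hτ.1.le, hτ.2⟩]
  · obtain ⟨χ, hχ, he⟩ := h.exists_omega_NN φ
    simp_rw [h.inner_NN]
    refine (h.hasDerivAt_inner_solC hF a₀ c₀ hχ ht).congr_deriv ?_
    rw [he p hp, ← ha.eq t ⟨ht.1.le, ht.2⟩]

/-- A distributional solution is mild in the energy variables. -/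
lemma isMild_of_isSolution {p : ℝ} (hp : 1 < p) {a₀ c₀ : L2R} {T : ℝ} (hT : 0 < T)
    {u w : ℝ → L2R} (hs : IsSolution ρ r l b p (MM l b a₀) (NN b c₀) T u w) :
    ∃ a, IsMild l (force l b (g p)) a₀ c₀ T a ∧ ∀ t ∈ Ico 0 T, u t = MM l b (a t) ∧
      w t = NN b (solC l a₀ c₀ (fun s => force l b (g p) (a s)) t) := by
  have h0 : (0 : ℝ) ∈ Ico 0 T := ⟨le_rfl, hT⟩
  have hex : ∀ t, ∃ a c, t ∈ Ico 0 T → MM l b a = u t ∧ NN b c = w t := fun t => by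
    by_cases ht : t ∈ Ico 0 T
    · obtain ⟨a, ha⟩ := h.exists_MM_eq (hs.cont_u.1 t ht)
      obtain ⟨c, hc⟩ := h.exists_NN_eq (hs.cont_w.1 t ht)
      exact ⟨a, c, fun _ => ⟨ha, hc⟩⟩
    · exact ⟨0, 0, fun H => absurd H ht⟩
  choose a c hac using hex
  have ha : ContinuousOn a (Ico 0 T) := h.comparable_MInv.continuousOn_of_continuousInH
    (fun t ht => by rw [← (hac t ht).1]; exact h.isMul_MInv_MM _) hs.cont_u
  have hc : ContinuousOn c (Ico 0 T) := h.comparable_bInv.continuousOn_of_continuousInH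
    (fun t ht => by rw [← (hac t ht).2]; exact h.isMul_bInv_NN _) hs.cont_w
  have hF := (h.locNonl_force hp).forcing ha
  set F := fun s => force l b (g p) (a s) with hFdef
  -- The forcing is frozen as F = G(a): subtracting the Duhamel pair driven by the same F leaves a
  -- weak homogeneous system with zero data.
  have key := fun {t : ℝ} (ht : t ∈ Ico 0 T) => h.eq_zero_of_weak (T := T)
    (α := fun t => a t - solA l a₀ c₀ F t) (γ := fun t => c t - solC l a₀ c₀ F t)
    h.comparable_M (by have := h.embedding; linarith) h.comparable_bRoot
    (by have := h.nonneg_r; linarith) (ha.sub (h.continuousOn_solA hF a₀ c₀))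
    (hc.sub (h.continuousOn_solC hF a₀ c₀)) ?_ ?_ ?_ ?_ ht
  · refine ⟨a, ⟨ha, fun t ht => sub_eq_zero.1 (key ht).1⟩, fun t ht => ⟨(hac t ht).1.symm, ?_⟩⟩
    rw [← sub_eq_zero.1 (key ht).2, (hac t ht).2]
  · have : MM l b (a 0) = MM l b a₀ := by rw [(hac 0 h0).1, hs.init_u]
    simp only [h.solA_zero, h.MM_injective this, sub_self]
  · have : NN b (c 0) = NN b c₀ := by rw [(hac 0 h0).2, hs.init_w]
    simp only [h.solC_zero, h.NN_injective this, sub_self]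
  · intro φ χ hχ t ht
    have h1 : χ = NN b (testDeriv φ) := hχ.unique (h.isMul_omega_MM φ)
    have h2 := hs.eq_u φ t ht
    have h3 : HasDerivAt (fun τ => (inner ℝ (a τ) (MM l b (testL2 φ)) : ℝ))
        (-inner ℝ (c t) (NN b (testDeriv φ))) t := by
      rw [← h.inner_NN, (hac t ⟨ht.1.le, ht.2⟩).2]
      refine h2.congr_of_eventuallyEq ?_
      filter_upwards [Ioo_mem_nhds ht.1 ht.2] with τ hτ
      rw [← h.inner_MM, (hac τ ⟨hτ.1.le, hτ.2⟩).1]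
    have h4 := h3.sub (h.hasDerivAt_inner_solA hF a₀ c₀ hχ ht)
    refine (h4.congr_deriv ?_).congr_of_eventuallyEq (Eventually.of_forall fun τ => ?_)
    · rw [← h1, inner_sub_left]; ring
    · exact inner_sub_left _ _ _
  · intro φ χ hχ t ht
    obtain ⟨χ', hχ', he⟩ := h.exists_omega_NN φ
    have h1 : χ = χ' := hχ.unique hχ'
    have h2 := hs.eq_w φ t ht
    have h3 : HasDerivAt (fun τ => (inner ℝ (c τ) (NN b (testL2 φ)) : ℝ))
        (-inner ℝ (a t) χ + inner ℝ (F t) (NN b (testL2 φ))) t := by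
      rw [h1, hFdef, ← he p hp, (hac t ⟨ht.1.le, ht.2⟩).1]
      refine h2.congr_of_eventuallyEq ?_
      filter_upwards [Ioo_mem_nhds ht.1 ht.2] with τ hτ
      rw [← h.inner_NN, (hac τ ⟨hτ.1.le, hτ.2⟩).2]
    have h4 := h3.sub (h.hasDerivAt_inner_solC hF a₀ c₀ hχ ht)
    refine (h4.congr_deriv ?_).congr_of_eventuallyEq (Eventually.of_forall fun τ => ?_)
    · rw [inner_sub_left]
      simp only [NN]
      ring
    · exact inner_sub_left _ _ _

end Admissible

/-! ### Conservation of energy -/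

/-- Taylor's formula for `|y|^{p+1}`. -/
lemma abs_rpow_taylor {p R x y : ℝ} (hp : 1 < p) (hx : |x| ≤ R) (hy : |y| ≤ R) :
    |(|y| ^ (p + 1) - |x| ^ (p + 1) + (p + 1) * (g p x * (y - x)))| ≤
      (p + 1) * (p * R ^ (p - 1)) * (y - x) ^ 2 := by
  have hR : 0 ≤ R := (abs_nonneg x).trans hx
  -- Adding the linear term makes the derivative (p+1)(g(x) - g(z)), which the Lipschitz bound on g
  -- controls.
  have hd : ∀ z : ℝ, HasDerivAt (fun z => |z| ^ (p + 1) + (p + 1) * g p x * z)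
      ((p + 1) * (g p x - g p z)) z := fun z => by
    refine ((hasDerivAt_abs_rpow z (by linarith : 1 < p + 1)).add
      ((hasDerivAt_id z).const_mul ((p + 1) * g p x))).congr_deriv ?_
    rw [g, g, show p + 1 - 2 = p - 1 by ring]; ring
  have hK : 0 ≤ p * R ^ (p - 1) := mul_nonneg (by linarith) (Real.rpow_nonneg hR _)
  have := (convex_uIcc x y).norm_image_sub_le_of_norm_hasDerivWithin_le
    (f := fun z => |z| ^ (p + 1) + (p + 1) * g p x * z) (C := (p + 1) * (p * R ^ (p - 1)) * |y - x|)
    (fun z _ => (hd z).hasDerivWithinAt) (fun z hz => ?_) left_mem_uIcc right_mem_uIcc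
  · rw [Real.norm_eq_abs, Real.norm_eq_abs] at this
    refine le_trans (le_of_eq ?_) (this.trans (le_of_eq ?_))
    · congr 1; ring
    · rw [← sq_abs (y - x)]; ring
  · have hz2 := abs_le.1 hx
    have hz3 := abs_le.1 hy
    have hzR : |z| ≤ R := abs_le.2 ⟨(le_min hz2.1 hz3.1).trans hz.1, hz.2.trans (max_le hz2.2 hz3.2)⟩
    rw [Real.norm_eq_abs, abs_mul, abs_of_pos (by linarith : 0 < p + 1), mul_assoc]
    refine mul_le_mul_of_nonneg_left ((abs_g_sub_le hp hx hzR).trans ?_) (by linarith)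
    refine mul_le_mul_of_nonneg_left ?_ hK
    rw [abs_sub_comm]
    exact abs_sub_left_of_mem_uIcc hz

lemma integrable_abs_rpow {p R : ℝ} (hp : 1 < p) {u : L2R} (hu : ∀ᵐ x, |u x| ≤ R) :
    Integrable (fun x => |u x| ^ (p + 1)) := by
  have hm := Lp.aestronglyMeasurable u
  refine Integrable.mono' (((memLp_two_iff_integrable_sq hm).1 (Lp.memLp u)).const_mul
    (R ^ (p - 1))) ((hm.aemeasurable.abs.pow_const _).aestronglyMeasurable) ?_
  filter_upwards [hu] with x hx
  rw [Real.norm_of_nonneg (Real.rpow_nonneg (abs_nonneg _) _)]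
  rcases eq_or_ne (u x) 0 with h0 | h0
  · rw [h0, abs_zero, Real.zero_rpow (by linarith)]; simp
  · have e : |u x| ^ (p + 1) = |u x| ^ (p - 1) * u x ^ 2 := by
      rw [← sq_abs, ← Real.rpow_natCast |u x| 2, ← Real.rpow_add (abs_pos.2 h0)]
      congr 1; push_cast; ring
    rw [e]
    exact mul_le_mul_of_nonneg_right (Real.rpow_le_rpow (abs_nonneg _) hx (by linarith))
      (sq_nonneg _)

lemma norm_sq_eq_integral_sq (u : L2R) : ‖u‖ ^ 2 = ∫ x, u x ^ 2 := by
  rw [← real_inner_self_eq_norm_sq, L2.inner_def]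
  refine integral_congr_ae (ae_of_all _ fun x => ?_)
  simp [pow_two]

/-- The pointwise Taylor estimate is integrated; a bounded L² function has |u|^{p+1} integrable, so
the terms may be separated. -/
lemma abs_Q_sub_le {p R : ℝ} (hp : 1 < p) {u v N : L2R} (hu : ∀ᵐ x, |u x| ≤ R)
    (hv : ∀ᵐ x, |v x| ≤ R) (hN : N =ᵐ[volume] fun x => g p (u x)) :
    |Q p v - Q p u + (p + 1) * inner ℝ N (v - u)| ≤
      (p + 1) * (p * R ^ (p - 1)) * ‖v - u‖ ^ 2 := by
  have e : Q p v - Q p u + (p + 1) * inner ℝ N (v - u) = ∫ x, (|v x| ^ (p + 1) - |u x| ^ (p + 1) +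
      (p + 1) * inner ℝ (N x) ((v - u : L2R) x)) := by
    rw [integral_add, integral_sub (integrable_abs_rpow hp hv) (integrable_abs_rpow hp hu),
      integral_const_mul, L2.inner_def]
    · rfl
    · exact (integrable_abs_rpow hp hv).sub (integrable_abs_rpow hp hu)
    · exact (L2.integrable_inner N (v - u)).const_mul _
  rw [e, norm_sq_eq_integral_sq, ← integral_const_mul, ← Real.norm_eq_abs]
  refine norm_integral_le_of_norm_le
    (((memLp_two_iff_integrable_sq (Lp.aestronglyMeasurable _)).1 (Lp.memLp (v - u))).const_mul _) ?_
  filter_upwards [hu, hv, hN, Lp.coeFn_sub v u] with x h1 h2 h3 h4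
  rw [h3, h4, Pi.sub_apply, Real.norm_eq_abs]
  have := abs_rpow_taylor hp h1 h2
  simpa [mul_comm (v x - u x)] using this

/-- The velocity component of a mild solution. -/
def velocity (l b : ℝ → ℝ) (p : ℝ) (a₀ c₀ : L2R) (a : ℝ → L2R) (t : ℝ) : L2R :=
  solC l a₀ c₀ (fun s => force l b (g p) (a s)) t

namespace Admissible

variable {ρ r : ℝ} {l b : ℝ → ℝ} (h : Admissible ρ r l b)
include h

lemma BInvSqrt_NN (c : L2R) : BInvSqrt b (NN b c) = c := (h.isMul_bInv_NN c).mult_eq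

lemma BInvSqrtLSqrt_MM (a : L2R) : BInvSqrtLSqrt l b (MM l b a) = a := (h.isMul_MInv_MM a).mult_eq

lemma energy_eq (p : ℝ) (a c : L2R) : energy l b p (MM l b a) (NN b c) =
    1 / 2 * ‖c‖ ^ 2 + 1 / 2 * ‖a‖ ^ 2 - 1 / (p + 1) * Q p (MM l b a) := by
  rw [energy, h.BInvSqrt_NN, h.BInvSqrtLSqrt_MM]

lemma two_mul_I (a : L2R) : 2 * I l b (MM l b a) = ‖a‖ ^ 2 := by
  rw [I, h.BInvSqrtLSqrt_MM, norm_sq_eq_integral_sq]; ring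

section Mild

variable {p : ℝ} (hp : 1 < p) {a₀ c₀ : L2R} {T : ℝ} {a : ℝ → L2R}
  (ha : IsMild l (force l b (g p)) a₀ c₀ T a)
include hp ha

lemma continuousOn_velocity : ContinuousOn (velocity l b p a₀ c₀ a) (Ico 0 T) :=
  h.continuousOn_solC ((h.locNonl_force hp).forcing ha.cont) a₀ c₀

lemma hasDerivAt_inner_mild {ψ χ : L2R} (hψ : IsMul (fun ξ => Complex.I * omega l ξ) ψ χ) {t : ℝ}
    (ht : t ∈ Ioo 0 T) : HasDerivAt (fun s => (inner ℝ (a s) ψ : ℝ))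
      (-inner ℝ (velocity l b p a₀ c₀ a t) χ) t := by
  refine (h.hasDerivAt_inner_solA ((h.locNonl_force hp).forcing ha.cont) a₀ c₀ hψ
    ht).congr_of_eventuallyEq ?_
  filter_upwards [Ioo_mem_nhds ht.1 ht.2] with τ hτ
  rw [ha.eq τ ⟨hτ.1.le, hτ.2⟩]

lemma hasDerivAt_inner_velocity {ψ χ : L2R} (hψ : IsMul (fun ξ => Complex.I * omega l ξ) ψ χ)
    {t : ℝ} (ht : t ∈ Ioo 0 T) :
    HasDerivAt (fun s => (inner ℝ (velocity l b p a₀ c₀ a s) ψ : ℝ))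
      (-inner ℝ (a t) χ + inner ℝ (force l b (g p) (a t)) ψ) t := by
  refine (h.hasDerivAt_inner_solC ((h.locNonl_force hp).forcing ha.cont) a₀ c₀ hψ
    ht).congr_deriv ?_
  rw [← ha.eq t ⟨ht.1.le, ht.2⟩]

lemma hasDerivAt_norm_sq_mild {t : ℝ} (ht : t ∈ Ioo 0 T) :
    HasDerivAt (fun s => ‖a s‖ ^ 2 + ‖velocity l b p a₀ c₀ a s‖ ^ 2)
      (2 * inner ℝ (force l b (g p) (a t)) (velocity l b p a₀ c₀ a t)) t := by
  refine (h.hasDerivAt_norm_sq_sol ((h.locNonl_force hp).forcing ha.cont) a₀ c₀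
    ht).congr_of_eventuallyEq ?_
  filter_upwards [Ioo_mem_nhds ht.1 ht.2] with τ hτ
  rw [← ha.eq τ ⟨hτ.1.le, hτ.2⟩]
  rfl

lemma intervalIntegrable_velocity {s t : ℝ} (hs : s ∈ Ico 0 T) (ht : t ∈ Ico 0 T) :
    IntervalIntegrable (velocity l b p a₀ c₀ a) volume s t :=
  ((h.continuousOn_velocity hp ha).mono (ordConnected_Ico.uIcc_subset hs ht)).intervalIntegrable

omit hp in
lemma mild_zero (hT : 0 < T) : a 0 = a₀ := by
  rw [ha.eq 0 ⟨le_rfl, hT⟩, h.solA_zero]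

/-- The integrated form of `a' = iω c`. -/
lemma isMul_omega_integral {s t : ℝ} (hs : s ∈ Ico 0 T) (ht : t ∈ Ico 0 T) :
    IsMul (fun ξ => Complex.I * omega l ξ) (∫ x in s..t, velocity l b p a₀ c₀ a x) (a t - a s) := by
  have key : ∀ t ∈ Ico 0 T, IsMul (fun ξ => Complex.I * omega l ξ)
      (∫ x in (0 : ℝ)..t, velocity l b p a₀ c₀ a x) (a t - a 0) := fun t ht => by
    refine h.isMul_omega_of_weak fun ψ χ hψ => ?_
    have hsub : Icc 0 t ⊆ Ico 0 T := fun x hx => ⟨hx.1, hx.2.trans_lt ht.2⟩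
    have hcv : ContinuousOn (fun x => -(inner ℝ (velocity l b p a₀ c₀ a x) χ : ℝ)) (uIcc 0 t) := by
      rw [uIcc_of_le ht.1]
      exact (((h.continuousOn_velocity hp ha).mono hsub).inner continuousOn_const).neg
    have h1 := intervalIntegral.integral_eq_sub_of_hasDerivAt_of_le ht.1
      (((ha.cont.mono hsub).inner (continuousOn_const (c := ψ))))
      (fun x hx => h.hasDerivAt_inner_mild hp ha hψ ⟨hx.1, hx.2.trans ht.2⟩)
      hcv.intervalIntegrable
    have h2 := ContinuousLinearMap.intervalIntegral_comp_comm (innerSL ℝ χ)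
      (h.intervalIntegrable_velocity hp ha ⟨le_rfl, ht.1.trans_lt ht.2⟩ ht)
    simp only [innerSL_apply_apply] at h2
    rw [inner_sub_left, ← h1, real_inner_comm χ, ← h2, intervalIntegral.integral_neg]
    simp_rw [real_inner_comm χ]
  have h0 : (0 : ℝ) ∈ Ico 0 T := ⟨le_rfl, ht.1.trans_lt ht.2⟩
  have := (key t ht).sub (key s hs)
  rwa [sub_sub_sub_cancel_right, intervalIntegral.integral_interval_sub_left
    (h.intervalIntegrable_velocity hp ha h0 ht) (h.intervalIntegrable_velocity hp ha h0 hs)] at this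

/-- Since M iω(D) = ∂ₓB^{1/2}, an increment of u = M a is ∂ₓB^{1/2} of the displacement ∫ c. -/
lemma isMul_symK_integral {s t : ℝ} (hs : s ∈ Ico 0 T) (ht : t ∈ Ico 0 T) :
    IsMul (symK b) (∫ x in s..t, velocity l b p a₀ c₀ a x) (MM l b (a t) - MM l b (a s)) := by
  rw [← map_sub]
  refine ((h.isMul_omega_integral hp ha hs ht).comp (h.isMul_MM _)).congr fun ξ => ?_
  have := h.omega_mul_symM ξ
  rw [mul_comm, this, symK]; push_cast; ring

lemma hasDerivAt_integral_velocity {s t : ℝ} (hs : s ∈ Ico 0 T) (ht : t ∈ Ioo 0 T) :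
    HasDerivAt (fun τ => ∫ x in s..τ, velocity l b p a₀ c₀ a x) (velocity l b p a₀ c₀ a t) t :=
  intervalIntegral.integral_hasDerivAt_right
    (h.intervalIntegrable_velocity hp ha hs ⟨ht.1.le, ht.2⟩)
    (((h.continuousOn_velocity hp ha).mono Ioo_subset_Ico_self).stronglyMeasurableAtFilter
      isOpen_Ioo t ht)
    ((h.continuousOn_velocity hp ha).continuousAt (Ico_mem_nhds ht.1 ht.2))

/-- Neither a nor M a is known to be strongly differentiable. What helps is that the increment of u
equals ∂ₓB^{1/2} J with J = ∫ c differentiable. Skew-adjointness throws the derivative onto the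
nonlinearity in the linear term and onto u itself in the quadratic remainder. -/
lemma hasDerivAt_Q_mild {t : ℝ} (ht : t ∈ Ioo 0 T) :
    HasDerivAt (fun s => Q p (MM l b (a s)))
      ((p + 1) * inner ℝ (force l b (g p) (a t)) (velocity l b p a₀ c₀ a t)) t := by
  have htI : t ∈ Ico 0 T := ⟨ht.1.le, ht.2⟩
  have hac : ContinuousAt a t := ha.cont.continuousAt (Ico_mem_nhds ht.1 ht.2)
  obtain ⟨C, hC, H⟩ := h.exists_bound
  obtain ⟨Cν, hCν, hν⟩ := h.bdd_nu
  set c := velocity l b p a₀ c₀ a with hc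
  set N := nonlin (g p) (MM l b (a t)) with hN
  set J : ℝ → L2R := fun s => ∫ x in t..s, c x with hJ
  have hJd : HasDerivAt J (c t) t := h.hasDerivAt_integral_velocity hp ha htI ht
  have hJ0 : J t = 0 := intervalIntegral.integral_same
  have hlin : ∀ s ∈ Ico 0 T, (inner ℝ N (MM l b (a s) - MM l b (a t)) : ℝ) =
      -inner ℝ (force l b (g p) (a t)) (J s) := fun s hs => by
    rw [(h.isMul_force hp (a t)).inner_eq_neg (h.isMul_symK_integral hp ha htI hs) symK_conj,
      neg_neg]
  -- ‖Δu‖² = ⟨∂ₓB^{1/2} J, Δu⟩ = -⟨J, ∂ₓB^{1/2} M Δa⟩, and ∂ₓB^{1/2} M is bounded.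
  have hquad : ∀ s ∈ Ico 0 T, ‖MM l b (a s) - MM l b (a t)‖ ^ 2 ≤
      Cν * ‖a s - a t‖ * ‖J s‖ := fun s hs => by
    have h1 := h.isMul_symK_integral hp ha htI hs
    have h2 : IsMul (symK b) (MM l b (a s) - MM l b (a t)) (Mop (symNu l b) (a s - a t)) := by
      rw [← map_sub]
      filter_upwards [h.isMul_MM (a s - a t), hν.isMul (a s - a t)] with x e1 e2
      rw [e2, e1, symNu_eq, mul_assoc]
    rw [← real_inner_self_eq_norm_sq, h1.inner_eq_neg h2 symK_conj]
    refine (neg_le_abs _).trans ((abs_real_inner_le_norm _ _).trans ?_)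
    rw [mul_comm]
    gcongr
    exact hν.norm_le _
  set R := C * (‖a t‖ + 1) with hR
  set K := (p + 1) * (p * R ^ (p - 1)) with hK
  have hR0 : 0 ≤ R := by positivity
  have hK0 : 0 ≤ K := by have := Real.rpow_nonneg hR0 (p - 1); positivity
  set rem : ℝ → ℝ := fun s => Q p (MM l b (a s)) - Q p (MM l b (a t)) -
    (p + 1) * inner ℝ (force l b (g p) (a t)) (J s) with hrem
  have hremb : ∀ᶠ s in 𝓝 t, |rem s| ≤ K * Cν * (‖a s - a t‖ * ‖J s‖) := by
    have h1 : ∀ᶠ s in 𝓝 t, ‖a s - a t‖ < 1 := by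
      have := Metric.continuousAt_iff'.1 hac 1 one_pos
      simpa only [dist_eq_norm] using this
    filter_upwards [h1, Ioo_mem_nhds ht.1 ht.2] with s h1 hs
    have hsI : s ∈ Ico 0 T := ⟨hs.1.le, hs.2⟩
    have h2 : ‖a s‖ ≤ ‖a t‖ + 1 := by
      have := norm_le_norm_add_norm_sub' (a s) (a t); linarith
    have h3 := abs_Q_sub_le hp (H (‖a t‖ + 1) (a t) (by linarith)) (H _ (a s) h2)
      (h.nonlin_g_ae hp (a t))
    rw [hlin s hsI] at h3
    have e : rem s = Q p (MM l b (a s)) - Q p (MM l b (a t)) +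
      (p + 1) * -inner ℝ (force l b (g p) (a t)) (J s) := by simp only [hrem]; ring
    rw [e]
    refine h3.trans ?_
    calc _ ≤ K * (Cν * ‖a s - a t‖ * ‖J s‖) := mul_le_mul_of_nonneg_left (hquad s hsI) hK0
      _ = _ := by ring
  have hrem0 : rem t = 0 := by simp only [hrem, hJ0, inner_zero_right]; ring
  have hremd : HasDerivAt rem 0 t := by
    rw [hasDerivAt_iff_isLittleO]
    simp only [hrem0, sub_zero, smul_zero]
    -- The remainder is ‖Δa‖·‖J‖ up to a constant, that is o(1)·O(s - t).
    have b1 : rem =O[𝓝 t] fun s => ‖a s - a t‖ * ‖J s‖ :=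
      Asymptotics.IsBigO.of_bound (K * Cν) (hremb.mono fun s hs => by
        rw [Real.norm_eq_abs, Real.norm_of_nonneg (by positivity)]; exact hs)
    have b2 : (fun s => ‖a s - a t‖) =o[𝓝 t] fun _ => (1 : ℝ) := by
      rw [Asymptotics.isLittleO_one_iff]
      exact tendsto_iff_norm_sub_tendsto_zero.1 hac
    have b3 : J =O[𝓝 t] fun s => s - t := by
      have := hJd.isBigO_sub
      simpa only [hJ0, sub_zero] using this
    have b4 := b2.mul_isBigO b3.norm_left
    simp only [one_mul] at b4
    exact b1.trans_isLittleO b4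
  have hI : HasDerivAt (fun s => (inner ℝ (force l b (g p) (a t)) (J s) : ℝ))
      (inner ℝ (force l b (g p) (a t)) (c t)) t := by
    have := (hasDerivAt_const t (force l b (g p) (a t))).inner ℝ hJd
    simpa using this
  have := ((hI.const_mul (p + 1)).add hremd).const_add (Q p (MM l b (a t)))
  rw [add_zero] at this
  refine this.congr_of_eventuallyEq (Eventually.of_forall fun s => ?_)
  simp only [hrem, Pi.add_apply]; ring

/-- Conservation of energy. -/
lemma energy_mild {t : ℝ} (ht : t ∈ Ico 0 T) :
    energy l b p (MM l b (a t)) (NN b (velocity l b p a₀ c₀ a t)) =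
      energy l b p (MM l b a₀) (NN b c₀) := by
  have hd : ∀ s ∈ Ioo 0 T, HasDerivAt
      (fun s => energy l b p (MM l b (a s)) (NN b (velocity l b p a₀ c₀ a s))) 0 s := fun s hs => by
    simp_rw [h.energy_eq]
    have h1 := ((h.hasDerivAt_norm_sq_mild hp ha hs).const_mul (1 / 2)).sub
      ((h.hasDerivAt_Q_mild hp ha hs).const_mul (1 / (p + 1)))
    refine (h1.congr_deriv ?_).congr_of_eventuallyEq (Eventually.of_forall fun τ => ?_)
    · have : p + 1 ≠ 0 := by linarith
      field_simp
      ring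
    · simp only [Pi.sub_apply]; ring
  have hsub : Icc 0 t ⊆ Ico 0 T := fun x hx => ⟨hx.1, hx.2.trans_lt ht.2⟩
  have hc : ContinuousOn
      (fun s => energy l b p (MM l b (a s)) (NN b (velocity l b p a₀ c₀ a s))) (Icc 0 t) := by
    simp_rw [h.energy_eq]
    have c1 := ((h.continuousOn_velocity hp ha).mono hsub).norm.pow 2
    have c2 := (ha.cont.mono hsub).norm.pow 2
    have c3 := (h.continuous_Q_MM hp).comp_continuousOn (ha.cont.mono hsub)
    exact ((continuousOn_const.mul c1).add (continuousOn_const.mul c2)).sub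
      (continuousOn_const.mul c3)
  have h00 : energy l b p (MM l b (a 0)) (NN b (velocity l b p a₀ c₀ a 0)) =
      energy l b p (MM l b a₀) (NN b c₀) := by
    rw [h.mild_zero ha (ht.1.trans_lt ht.2), velocity, h.solC_zero]
  rcases ht.1.eq_or_lt with rfl | ht0
  · exact h00
  · obtain ⟨x, hx, hx'⟩ := exists_hasDerivAt_eq_slope _ (fun _ => (0 : ℝ)) ht0 hc
      fun τ hτ => hd τ ⟨hτ.1, hτ.2.trans ht.2⟩
    rw [eq_div_iff (by linarith), zero_mul, eq_comm, sub_eq_zero] at hx'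
    rw [hx', h00]

end Mild

end Admissible

/-! ### The potential well -/

lemma Q_smul (p : ℝ) {lam : ℝ} (hlam : 0 ≤ lam) (u : L2R) :
    Q p (lam • u) = lam ^ (p + 1) * Q p u := by
  rw [Q, Q, ← integral_const_mul]
  refine integral_congr_ae ?_
  filter_upwards [Lp.coeFn_smul lam u] with x hx
  rw [hx, Pi.smul_apply, smul_eq_mul, abs_mul, abs_of_nonneg hlam,
    Real.mul_rpow hlam (abs_nonneg _)]

lemma Q_zero {p : ℝ} (hp : 1 < p) : Q p 0 = 0 := by
  have := Q_smul p le_rfl (0 : L2R)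
  rwa [zero_smul, Real.zero_rpow (by linarith), zero_mul] at this

lemma two_mul_I_eq (l b : ℝ → ℝ) (u : L2R) : 2 * I l b u = ‖BInvSqrtLSqrt l b u‖ ^ 2 := by
  rw [I, norm_sq_eq_integral_sq]; ring

/-- A curve `H ≥ 0` with `H H'' ≥ (1 + α) H'²` and `H'' ≥ δ > 0` cannot exist globally. -/
lemma not_global_of_concave {H H₁ H₂ : ℝ → ℝ} {α δ : ℝ} (hα : 0 < α) (hδ : 0 < δ)
    (hH : ∀ t, 0 ≤ H t) (h1 : ∀ t > 0, HasDerivAt H (H₁ t) t)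
    (h2 : ∀ t > 0, HasDerivAt H₁ (H₂ t) t) (hc : ∀ t > 0, (1 + α) * H₁ t ^ 2 ≤ H t * H₂ t)
    (hpos : ∀ t > 0, δ ≤ H₂ t) : False := by
  -- H₁ grows at least linearly, so it is positive from t₁ on. There (H/H₁)' = 1 - H H₂/H₁² ≤ -α,
  -- and t₂ is chosen so late that H/H₁ would be negative.
  have lin : ∀ t, 1 ≤ t → H₁ 1 + δ * (t - 1) ≤ H₁ t := fun t ht => by
    have := (convex_Icc (1 : ℝ) t).mul_sub_le_image_sub_of_le_deriv (f := H₁) (C := δ)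
      (fun s hs => (h2 s (by linarith [hs.1])).continuousAt.continuousWithinAt)
      (fun s hs => (h2 s (by
        rw [interior_Icc] at hs; linarith [hs.1])).differentiableAt.differentiableWithinAt)
      (fun s hs => by
        rw [interior_Icc] at hs
        rw [(h2 s (by linarith [hs.1])).deriv]; exact hpos s (by linarith [hs.1]))
      1 ⟨le_rfl, ht⟩ t ⟨ht, le_rfl⟩ ht
    linarith
  set t₁ : ℝ := 1 + (|H₁ 1| + 1) / δ with ht₁
  have ht₁1 : 1 ≤ t₁ := by
    have : 0 ≤ (|H₁ 1| + 1) / δ := by positivity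
    linarith
  have hH₁ : ∀ t, t₁ ≤ t → 0 < H₁ t := fun t ht => by
    have e1 := lin t (ht₁1.trans ht)
    have e2 : δ * (t₁ - 1) = |H₁ 1| + 1 := by rw [ht₁]; field_simp; ring
    have e3 : δ * (t₁ - 1) ≤ δ * (t - 1) := by gcongr
    have := neg_abs_le (H₁ 1)
    linarith
  have hder : ∀ t, t₁ ≤ t → HasDerivAt (fun t => H t / H₁ t)
      ((H₁ t * H₁ t - H t * H₂ t) / H₁ t ^ 2) t := fun t ht =>
    (h1 t (by linarith)).div (h2 t (by linarith)) (hH₁ t ht).ne'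
  set t₂ : ℝ := t₁ + (H t₁ / H₁ t₁ + 1) / α with ht₂
  have h0 : 0 ≤ H t₁ / H₁ t₁ := div_nonneg (hH _) (hH₁ t₁ le_rfl).le
  have ht12 : t₁ ≤ t₂ := by
    have : 0 ≤ (H t₁ / H₁ t₁ + 1) / α := by positivity
    linarith
  have := (convex_Icc t₁ t₂).image_sub_le_mul_sub_of_deriv_le (f := fun t => H t / H₁ t) (C := -α)
      (fun s hs => (hder s hs.1).continuousAt.continuousWithinAt)
      (fun s hs => (hder s (by
        rw [interior_Icc] at hs; exact hs.1.le)).differentiableAt.differentiableWithinAt)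
      (fun s hs => by
        rw [interior_Icc] at hs
        rw [(hder s hs.1.le).deriv, div_le_iff₀ (pow_pos (hH₁ s hs.1.le) 2)]
        have := hc s (by linarith [hs.1])
        nlinarith)
      t₁ ⟨le_rfl, ht12⟩ t₂ ⟨ht12, le_rfl⟩ ht12
  have e : -α * (t₂ - t₁) = -(H t₁ / H₁ t₁ + 1) := by rw [ht₂]; field_simp; ring
  have h3 : 0 ≤ H t₂ / H₁ t₂ := div_nonneg (hH _) (hH₁ t₂ ht12).le
  linarith

namespace Admissible

variable {ρ r : ℝ} {l b : ℝ → ℝ} (h : Admissible ρ r l b)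
include h

/-- On the constraint 2I = Q the energy is nonnegative because 1/(p+1) ≤ 1/2. The infimum is thus
over a set bounded below, which the real-valued `sInf` requires. -/
lemma depth_le {p : ℝ} (hp : 1 < p) {a c : L2R} (ha : a ≠ 0) (hK : ‖a‖ ^ 2 = Q p (MM l b a)) :
    depth ρ r l b p ≤ energy l b p (MM l b a) (NN b c) := by
  refine csInf_le ⟨0, ?_⟩ ⟨MM l b a, NN b c, h.memH_MM a, h.memH_NN c, fun h0 => ha ?_, ?_, rfl⟩
  · rintro e ⟨u, w, -, -, -, hQ, rfl⟩
    rw [two_mul_I_eq, sub_eq_zero] at hQ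
    rw [energy, ← hQ]
    have h1 : 1 / (p + 1) ≤ 1 / 2 := one_div_le_one_div_of_le two_pos (by linarith)
    have h2 := sq_nonneg ‖BInvSqrt b w‖
    have h3 := mul_le_mul_of_nonneg_right h1 (sq_nonneg ‖BInvSqrtLSqrt l b u‖)
    linarith
  · exact h.MM_injective (by rw [h0, map_zero])
  · rw [h.two_mul_I, hK, sub_self]

/-- Inside the unstable set the depth is controlled by the quadratic part of the energy. -/
lemma depth_le_of_lt {p : ℝ} (hp : 1 < p) {a : L2R} (hK : ‖a‖ ^ 2 < Q p (MM l b a)) :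
    depth ρ r l b p ≤ (p - 1) / (2 * (p + 1)) * ‖a‖ ^ 2 := by
  have ha : a ≠ 0 := by
    rintro rfl
    rw [map_zero, Q_zero hp, norm_zero] at hK
    norm_num at hK
  have hn : 0 < ‖a‖ ^ 2 := by have := norm_pos_iff.2 ha; positivity
  have hQ : 0 < Q p (MM l b a) := hn.trans hK
  -- The scaling with lam^{p-1} Q = ‖a‖², which puts lam·a on the constraint; lam ≤ 1 since ‖a‖² <
  -- Q.
  set lam : ℝ := (‖a‖ ^ 2 / Q p (MM l b a)) ^ (1 / (p - 1)) with hlam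
  have hlam0 : 0 < lam := Real.rpow_pos_of_pos (div_pos hn hQ) _
  have hlam1 : lam ≤ 1 := Real.rpow_le_one (div_pos hn hQ).le ((div_le_one hQ).2 hK.le)
    (one_div_pos.2 (by linarith)).le
  have hpow : lam ^ (p - 1) * Q p (MM l b a) = ‖a‖ ^ 2 := by
    rw [hlam, ← Real.rpow_mul (div_pos hn hQ).le, one_div, inv_mul_cancel₀ (by linarith),
      Real.rpow_one, div_mul_cancel₀ _ hQ.ne']
  have hQl : Q p (MM l b (lam • a)) = lam ^ 2 * ‖a‖ ^ 2 := by
    rw [map_smul, Q_smul p hlam0.le, ← hpow, ← mul_assoc]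
    congr 1
    rw [← Real.rpow_natCast lam 2, ← Real.rpow_add hlam0]
    congr 1; push_cast; ring
  have hnl : ‖lam • a‖ ^ 2 = lam ^ 2 * ‖a‖ ^ 2 := by
    rw [norm_smul, mul_pow, Real.norm_of_nonneg hlam0.le]
  have key := h.depth_le hp (a := lam • a) (c := 0) (smul_ne_zero hlam0.ne' ha) (by rw [hnl, hQl])
  rw [h.energy_eq, hQl, hnl, norm_zero] at key
  refine key.trans ?_
  have e : 1 / 2 * (0 : ℝ) ^ 2 + 1 / 2 * (lam ^ 2 * ‖a‖ ^ 2) - 1 / (p + 1) * (lam ^ 2 * ‖a‖ ^ 2) =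
      (p - 1) / (2 * (p + 1)) * (lam ^ 2 * ‖a‖ ^ 2) := by
    have : p + 1 ≠ 0 := by linarith
    field_simp; ring
  rw [e]
  have h1 : lam ^ 2 ≤ 1 := pow_le_one₀ hlam0.le hlam1
  have h2 : 0 ≤ (p - 1) / (2 * (p + 1)) := div_nonneg (by linarith) (by linarith)
  exact mul_le_mul_of_nonneg_left (mul_le_of_le_one_left hn.le h1) h2

section Mild

variable {p : ℝ} (hp : 1 < p) {a₀ c₀ : L2R}
  (hE : energy l b p (MM l b a₀) (NN b c₀) < depth ρ r l b p)
  (hK : ‖a₀‖ ^ 2 < Q p (MM l b a₀))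
include hp hE hK

/-- The unstable set is invariant. -/
lemma unstable_invariant {T : ℝ} {a : ℝ → L2R} (ha : IsMild l (force l b (g p)) a₀ c₀ T a)
    {t : ℝ} (ht : t ∈ Ico 0 T) : ‖a t‖ ^ 2 < Q p (MM l b (a t)) := by
  set d := depth ρ r l b p with hd
  set κ := (p - 1) / (2 * (p + 1)) with hκ
  -- The inequality ‖a‖² < Q is relaxed to a closed condition, and the bound on the depth is added
  -- to exclude a = 0. At equality a nonzero a(s) would have energy at least d, and a(s) = 0 would
  -- force d ≤ 0 ≤ energy; both contradict energy < d.
  set S : Set ℝ := {s | ‖a s‖ ^ 2 - Q p (MM l b (a s)) ≤ 0 ∧ d - κ * ‖a s‖ ^ 2 ≤ 0} with hS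
  have hsub : Icc 0 t ⊆ Ico 0 T := fun x hx => ⟨hx.1, hx.2.trans_lt ht.2⟩
  have hc1 : ContinuousOn (fun s => ‖a s‖ ^ 2 - Q p (MM l b (a s))) (Ico 0 T) :=
    (ha.cont.norm.pow 2).sub ((h.continuous_Q_MM hp).comp_continuousOn ha.cont)
  have hc2 : ContinuousOn (fun s => d - κ * ‖a s‖ ^ 2) (Ico 0 T) :=
    continuousOn_const.sub (continuousOn_const.mul (ha.cont.norm.pow 2))
  have strict : ∀ s ∈ Ico 0 T, s ∈ S → ‖a s‖ ^ 2 < Q p (MM l b (a s)) := fun s hs hsS => by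
    refine lt_of_le_of_ne (by linarith [hsS.1]) fun heq => ?_
    have hen := h.energy_mild hp ha hs
    rcases eq_or_ne (a s) 0 with h0 | h0
    · rw [h.energy_eq, h0, map_zero, Q_zero hp, norm_zero] at hen
      have h2 := hsS.2
      rw [h0, norm_zero] at h2
      have := sq_nonneg ‖velocity l b p a₀ c₀ a s‖
      linarith
    · have := h.depth_le hp (c := velocity l b p a₀ c₀ a s) h0 heq
      linarith
  have mem : ∀ s, ‖a s‖ ^ 2 < Q p (MM l b (a s)) → s ∈ S := fun s hs =>
    ⟨by linarith, by linarith [h.depth_le_of_lt hp hs]⟩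
  -- S is closed, and each of its points satisfies the strict, open inequality, so S extends to the
  -- right; a connectedness argument covers [0, t].
  have hall : Icc 0 t ⊆ S := by
    refine IsClosed.Icc_subset_of_forall_mem_nhdsWithin ?_ ?_ fun x hx => ?_
    · have e : S ∩ Icc 0 t =
          (Icc 0 t ∩ (fun s => ‖a s‖ ^ 2 - Q p (MM l b (a s))) ⁻¹' Iic 0) ∩
          (Icc 0 t ∩ (fun s => d - κ * ‖a s‖ ^ 2) ⁻¹' Iic 0) := by
        ext s; simp only [hS, mem_inter_iff, mem_ofPred_eq, mem_preimage, mem_Iic]; tauto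
      rw [e]
      exact ((hc1.mono hsub).preimage_isClosed_of_isClosed isClosed_Icc isClosed_Iic).inter
        ((hc2.mono hsub).preimage_isClosed_of_isClosed isClosed_Icc isClosed_Iic)
    · refine mem 0 ?_
      rwa [h.mild_zero ha (ht.1.trans_lt ht.2)]
    · have hxT : x ∈ Ico 0 T := hsub ⟨hx.2.1, hx.2.2.le⟩
      have h1 : ‖a x‖ ^ 2 - Q p (MM l b (a x)) < 0 := by linarith [strict x hxT hx.1]
      have h2 := (hc1 x hxT).eventually (Iio_mem_nhds h1)
      have h3 : Ico 0 T ∈ 𝓝[>] x :=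
        mem_of_superset (Ioo_mem_nhdsGT hxT.2) fun y hy => ⟨hxT.1.trans hy.1.le, hy.2⟩
      filter_upwards [nhdsWithin_le_of_mem h3 h2] with s hs
      exact mem s (by have : _ < (0 : ℝ) := hs; linarith)
  exact strict t ht (hall ⟨ht.1, le_rfl⟩)

/-- There is no global solution in the unstable set (Levine's concavity method). -/
lemma not_global {q₀ : L2R} (hq : IsMul (fun ξ => Complex.I * omega l ξ) q₀ a₀) {a : ℝ → L2R}
    (ha : ∀ T, IsMild l (force l b (g p)) a₀ c₀ T a) : False := by
  set c := velocity l b p a₀ c₀ a with hc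
  -- The L² primitive of c that also satisfies iω(D) q = a; the hypothesis on u₀ is needed for its
  -- initial value.
  set q : ℝ → L2R := fun t => q₀ + ∫ x in (0 : ℝ)..t, c x with hqdef
  set d := depth ρ r l b p with hd
  set E₀ := energy l b p (MM l b a₀) (NN b c₀) with hE₀
  have hI : ∀ t > (0 : ℝ), t ∈ Ioo 0 (t + 1) := fun t ht => ⟨ht, by linarith⟩
  have hI0 : ∀ t > (0 : ℝ), (0 : ℝ) ∈ Ico 0 (t + 1) := fun t ht => ⟨le_rfl, by linarith⟩
  have hqa : ∀ t > 0, IsMul (fun ξ => Complex.I * omega l ξ) (q t) (a t) := fun t ht => by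
    have h1 := hq.add (h.isMul_omega_integral hp (ha (t + 1)) (hI0 t ht) (Ioo_subset_Ico_self (hI t ht)))
    rwa [h.mild_zero (ha 1) one_pos, add_sub_cancel] at h1
  have hqM : ∀ t > 0, IsMul (symK b) (q t) (MM l b (a t)) := fun t ht => by
    refine ((hqa t ht).comp (h.isMul_MM _)).congr fun ξ => ?_
    rw [mul_comm, h.omega_mul_symM ξ, symK]; push_cast; ring
  have hqd : ∀ t > 0, HasDerivAt q (c t) t := fun t ht =>
    (h.hasDerivAt_integral_velocity hp (ha (t + 1)) (hI0 t ht) (hI t ht)).const_add q₀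
  have hcc : ∀ t > 0, ContinuousAt c t := fun t ht =>
    (h.continuousOn_velocity hp (ha (t + 1))).continuousAt (Ico_mem_nhds ht (by linarith))
  -- The weak equation for c may be tested with q, since q is in the domain of iω(D). The nonlinear
  -- term gives -⟨g(M a), M a⟩ = Q(M a).
  have hqc : ∀ t > 0, HasDerivAt (fun s => (inner ℝ (c s) (q s) : ℝ))
      (‖c t‖ ^ 2 - ‖a t‖ ^ 2 + Q p (MM l b (a t))) t := fun t ht => by
    refine (hasDerivAt_inner_of_weak (hcc t ht)
      (h.hasDerivAt_inner_velocity hp (ha (t + 1)) (hqa t ht) (hI t ht)) (hqd t ht)).congr_deriv ?_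
    rw [(h.isMul_force hp (a t)).inner_eq_neg (hqM t ht) symK_conj, h.Q_MM hp,
      real_inner_self_eq_norm_sq]
    change -‖a t‖ ^ 2 + _ + (inner ℝ (c t) (c t) : ℝ) = _
    rw [real_inner_self_eq_norm_sq]
    ring
  -- Energy conservation expresses Q by the norms and E₀, leaving (p-1)/2 ‖a‖², which is at least
  -- (p+1) d in the unstable set.
  have hbound : ∀ t > 0, (p + 3) / 2 * ‖c t‖ ^ 2 + (p + 1) * (d - E₀) ≤
      ‖c t‖ ^ 2 - ‖a t‖ ^ 2 + Q p (MM l b (a t)) := fun t ht => by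
    have htI := Ioo_subset_Ico_self (hI t ht)
    have h1 := h.energy_mild hp (ha (t + 1)) htI
    rw [h.energy_eq] at h1
    have h2 := h.depth_le_of_lt hp (h.unstable_invariant hp hE hK (ha (t + 1)) htI)
    have hp1 : (p + 1) ≠ 0 := by linarith
    have h3 : Q p (MM l b (a t)) = (p + 1) * (1 / 2 * ‖c t‖ ^ 2 + 1 / 2 * ‖a t‖ ^ 2 - E₀) := by
      rw [hE₀, ← h1]; field_simp; ring
    have h4 : (p + 1) * d ≤ (p - 1) / 2 * ‖a t‖ ^ 2 := by
      have := mul_le_mul_of_nonneg_left h2 (by linarith : 0 ≤ p + 1)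
      refine this.trans (le_of_eq ?_)
      field_simp
    rw [h3]
    nlinarith
  -- H H'' ≥ (p+3)‖q‖²‖c‖² ≥ (p+3)/4 · H'², hence α = (p+3)/4 - 1.
  refine not_global_of_concave (H := fun t => ‖q t‖ ^ 2) (H₁ := fun t => 2 * inner ℝ (c t) (q t))
    (H₂ := fun t => 2 * (‖c t‖ ^ 2 - ‖a t‖ ^ 2 + Q p (MM l b (a t)))) (α := (p - 1) / 4)
    (δ := 2 * ((p + 1) * (d - E₀))) (by linarith)
    (by have := mul_pos (by linarith : 0 < p + 1) (sub_pos.2 hE); linarith)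
    (fun t => sq_nonneg _) (fun t ht => ?_) (fun t ht => (hqc t ht).const_mul 2)
    (fun t ht => ?_) (fun t ht => ?_)
  · have := (hqd t ht).norm_sq
    rwa [real_inner_comm] at this
  · have h1 := hbound t ht
    have h2 : (inner ℝ (c t) (q t) : ℝ) ^ 2 ≤ ‖c t‖ ^ 2 * ‖q t‖ ^ 2 := by
      rw [← mul_pow, ← sq_abs]
      exact pow_le_pow_left₀ (abs_nonneg _) (abs_real_inner_le_norm _ _) 2
    have h3 : 0 < (p + 1) * (d - E₀) := mul_pos (by linarith) (sub_pos.2 hE)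
    have h4 : (p + 3) / 2 * ‖c t‖ ^ 2 ≤ ‖c t‖ ^ 2 - ‖a t‖ ^ 2 + Q p (MM l b (a t)) := by linarith
    have h5 := mul_le_mul_of_nonneg_left h4 (sq_nonneg ‖q t‖)
    have h6 := mul_le_mul_of_nonneg_left h2 (by linarith : 0 ≤ p + 3)
    linarith
  · have h1 := hbound t ht
    have : 0 ≤ (p + 3) / 2 * ‖c t‖ ^ 2 := mul_nonneg (by linarith) (sq_nonneg _)
    linarith

end Mild

end Admissible

/-! ### The maximal solution -/

namespace Admissible

variable {ρ r : ℝ} {l b : ℝ → ℝ} (h : Admissible ρ r l b)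
include h

/-- If `M a₀ = v₀'` with `v₀ ∈ L²`, then `a₀ = iω(D) q₀` with `q₀ ∈ L²`. -/
lemma exists_primitive {v₀ a₀ : L2R} (hv : IsMul (fun ξ => Complex.I * ξ) v₀ (MM l b a₀)) :
    ∃ q₀, IsMul (fun ξ => Complex.I * omega l ξ) q₀ a₀ := by
  set k : ℝ → ℝ := fun ξ => (b ξ) ^ (-(1 / 2) : ℝ) with hk
  have hkc := h.comparable_bInv
  obtain ⟨C, hC⟩ := hkc.locSymbol.bdd 1
  obtain ⟨c', hc', _, _, hl⟩ := h.comparable_lRoot.bounds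
  have hlc : ∀ ξ, c' ≤ l ξ ^ (1 / 2 : ℝ) := fun ξ => by
    refine le_trans ?_ (hl ξ).1
    exact le_mul_of_one_le_right hc'.le
      (Real.one_le_rpow (one_le_br ξ) (by have := h.nonneg_ρ; linarith))
  have hC0 : 0 ≤ C := (norm_nonneg _).trans (hC 0 (by simp))
  have ha : ∀ᵐ η : ℝ, (Fhat a₀ : ℝ → ℂ) η = ((k (2 * Real.pi * η) : ℝ) : ℂ) *
      ((l (2 * Real.pi * η) ^ (1 / 2 : ℝ) : ℝ) : ℂ) *
      (Complex.I * ((2 * Real.pi * η : ℝ) : ℂ) * Fhat v₀ η) := by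
    filter_upwards [h.isMul_MInv_MM a₀, hv] with η e1 e2
    rw [e1, e2, Complex.ofReal_mul]
  -- At low frequency b^{-1/2} is bounded, so v₀ controls the product. For |ξ| ≥ 1 the factor |ξ|
  -- l^{1/2} is bounded below, and a₀ controls it.
  have hmem : MemLp (fun η : ℝ => ((k (2 * Real.pi * η) : ℝ) : ℂ) * Fhat v₀ η) 2 volume := by
    have hdom : MemLp (fun η => C * ‖(Fhat v₀ : ℝ → ℂ) η‖ + c'⁻¹ * ‖(Fhat a₀ : ℝ → ℂ) η‖) 2
        volume := ((Lp.memLp (Fhat v₀)).norm.const_mul C).add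
          ((Lp.memLp (Fhat a₀)).norm.const_mul c'⁻¹)
    refine hdom.mono' ((hkc.locSymbol.meas.comp (measurable_const_mul _)).aestronglyMeasurable.mul
      (Lp.aestronglyMeasurable _)) ?_
    filter_upwards [ha] with η e1
    rw [norm_mul]
    rcases le_total |2 * Real.pi * η| 1 with h1 | h1
    · have := mul_le_mul_of_nonneg_right (hC _ h1) (norm_nonneg ((Fhat v₀ : ℝ → ℂ) η))
      have h2 : 0 ≤ c'⁻¹ * ‖(Fhat a₀ : ℝ → ℂ) η‖ := by positivity
      linarith
    · have h2 : ‖((k (2 * Real.pi * η) : ℝ) : ℂ)‖ * ‖(Fhat v₀ : ℝ → ℂ) η‖ ≤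
          c'⁻¹ * ‖(Fhat a₀ : ℝ → ℂ) η‖ := by
        rw [e1, norm_mul, norm_mul, norm_mul, norm_mul, Complex.norm_I, one_mul,
          Complex.norm_real (2 * Real.pi * η), Real.norm_eq_abs,
          Complex.norm_real (l _ ^ _), Real.norm_of_nonneg (hc'.le.trans (hlc _)),
          ← div_eq_inv_mul, le_div_iff₀ hc']
        have h3 := hlc (2 * Real.pi * η)
        calc _ = ‖((k (2 * Real.pi * η) : ℝ) : ℂ)‖ * c' * (1 * ‖(Fhat v₀ : ℝ → ℂ) η‖) := by ring
          _ ≤ _ := by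
            gcongr
            exact mul_nonneg (norm_nonneg _) (hc'.le.trans h3)
      have h3 : 0 ≤ C * ‖(Fhat v₀ : ℝ → ℂ) η‖ := by positivity
      linarith
  obtain ⟨q₀, hq₀⟩ := exists_isMul (m := fun ξ => ((k ξ : ℝ) : ℂ)) hkc.locSymbol.herm v₀ hmem
  refine ⟨q₀, ?_⟩
  filter_upwards [ha, hq₀] with η e1 e2
  rw [e1, e2, omega]
  push_cast
  ring

variable {a₀ c₀ : L2R}

/-- Mild solutions on overlapping intervals can be glued. -/
lemma isMild_glue {G : L2R → L2R} (hG : LocNonl l b G) {T : ℝ} {τ : ℝ → ℝ} {f : ℝ → ℝ → L2R}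
    (hτ : ∀ t ∈ Ico 0 T, t < τ t) (hf : ∀ t ∈ Ico 0 T, IsMild l G a₀ c₀ (τ t) (f t)) :
    IsMild l G a₀ c₀ T (fun t => f t t) := by
  -- By uniqueness the diagonal curve coincides with a single solution on a whole interval around t,
  -- so continuity and the equation are inherited.
  have key : ∀ t ∈ Ico 0 T, IsMild l G a₀ c₀ (min (τ t) T) (fun s => f s s) := fun t ht => by
    refine ((hf t ht).mono (min_le_left _ T)).congr (fun s hs => ?_) fun _ _ => rfl
    have hsT : s ∈ Ico 0 T := ⟨hs.1, hs.2.trans_le (min_le_right _ _)⟩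
    exact h.isMild_unique hG ((hf s hsT).mono (min_le_left _ (τ t)))
      ((hf t ht).mono (min_le_right (τ s) _))
      ⟨hs.1, lt_min (hτ s hsT) (hs.2.trans_le (min_le_left _ _))⟩
  have hmem : ∀ t ∈ Ico 0 T, t ∈ Ico 0 (min (τ t) T) := fun t ht => ⟨ht.1, lt_min (hτ t ht) ht.2⟩
  refine ⟨fun t ht => ((key t ht).cont t (hmem t ht)).mono_of_mem_nhdsWithin ?_,
    fun t ht => (key t ht).eq t (hmem t ht)⟩
  refine mem_of_superset (inter_mem_nhdsWithin _ (Iio_mem_nhds (hmem t ht).2)) ?_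
  exact fun s hs => ⟨hs.1.1, hs.2⟩

/-- A bounded mild solution can be continued. -/
lemma exists_extension {p : ℝ} (hp : 1 < p) {T : ℝ} (hT : 0 ≤ T) {R : ℝ}
    -- The bound is asked for every C because the Sobolev constant fixing the truncation level is
    -- chosen inside the proof; only truncations that agree with g on the ball of radius R + 1
    -- occur.
    (hR : ∀ C > 0, ∀ a, IsMild l (force l b (gTrunc p (C * (R + 1)))) a₀ c₀ (T + 1) a →
      (∀ x ≤ R + 1, ∀ a : L2R, ‖a‖ ≤ x → force l b (g p) a =
        force l b (gTrunc p (C * (R + 1))) a) → ∀ t ∈ Icc 0 T, ‖a t‖ ≤ R) (hR0 : 0 ≤ R) :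
    ∃ T' > T, ∃ a, IsMild l (force l b (g p)) a₀ c₀ T' a := by
  obtain ⟨C, hC, H⟩ := h.exists_force_eq (l := l) (b := b) p
  have HF : ∀ x ≤ R + 1, ∀ a : L2R, ‖a‖ ≤ x → force l b (g p) a =
      force l b (gTrunc p (C * (R + 1))) a := fun x hx a ha => (H (R + 1) a (ha.trans hx)).2
  obtain ⟨a, ha⟩ := h.exists_isMild_trunc hp (R := C * (R + 1)) (by positivity) a₀ c₀
    (T := T + 1) (by linarith)
  have hb := hR C hC a ha HF
  have hTm : T ∈ Ico 0 (T + 1) := ⟨hT, by linarith⟩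
  -- The truncated solution is bounded by R up to T, so by continuity it stays below R + 1 slightly
  -- longer, where the truncation is inactive.
  have h1 : ∀ᶠ s in 𝓝[Ico 0 (T + 1)] T, ‖a s‖ < R + 1 :=
    (ha.cont T hTm).norm.eventually (Iio_mem_nhds (by have := hb T ⟨hT, le_rfl⟩; linarith))
  obtain ⟨ε, hε, hball⟩ := Metric.mem_nhdsWithin_iff.1 h1
  refine ⟨T + min ε 1, by have := lt_min hε one_pos; linarith, a,
    (ha.mono (by have := min_le_right ε 1; linarith)).congr (fun _ _ => rfl) fun t ht => ?_⟩
  refine HF (R + 1) le_rfl _ ?_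
  rcases le_or_gt t T with htT | htT
  · linarith [hb t ⟨ht.1, htT⟩]
  · refine le_of_lt (hball ⟨?_, ht.1, by have := min_le_right ε 1; linarith [ht.2]⟩)
    rw [Metric.mem_ball, Real.dist_eq, abs_of_pos (by linarith)]
    have := min_le_left ε 1
    linarith [ht.2]

/-- Continuation from the degenerate interval T = 0, where only the initial value has to be bounded.
-/
lemma exists_local {p : ℝ} (hp : 1 < p) (a₀ c₀ : L2R) :
    ∃ T > 0, ∃ a, IsMild l (force l b (g p)) a₀ c₀ T a := by
  refine h.exists_extension hp (le_refl (0 : ℝ)) (R := ‖a₀‖) (fun C _ a ha _ t ht => ?_)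
    (norm_nonneg _)
  have ht0 : t = 0 := le_antisymm ht.2 ht.1
  rw [ht0, ha.eq 0 ⟨le_rfl, by norm_num⟩, h.solA_zero]

/-- A mild solution that is bounded on a bounded interval can be continued. -/
lemma exists_continuation {p : ℝ} (hp : 1 < p) {T : ℝ} (hT : 0 < T) {a : ℝ → L2R}
    (ha : IsMild l (force l b (g p)) a₀ c₀ T a) {R : ℝ} (hR : ∀ t ∈ Ico 0 T, ‖a t‖ ≤ R) :
    ∃ T' > T, ∃ a', IsMild l (force l b (g p)) a₀ c₀ T' a' := by
  have hR0 : 0 ≤ R := (norm_nonneg _).trans (hR 0 ⟨le_rfl, hT⟩)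
  refine h.exists_extension hp hT.le (R := R) (fun C hC a' ha' HF t ht => ?_) hR0
  have ha2 : IsMild l (force l b (gTrunc p (C * (R + 1)))) a₀ c₀ T a :=
    ha.congr (fun _ _ => rfl) fun t ht => (HF R (by linarith) _ (hR t ht)).symm
  have heq : ∀ s ∈ Ico 0 T, ‖a' s‖ ≤ R := fun s hs => by
    rw [h.isMild_unique (h.locNonl_trunc hp (by positivity)) (ha'.mono (by linarith)) ha2 hs]
    exact hR s hs
  rcases ht.2.lt_or_eq with hlt | rfl
  · exact heq t ⟨ht.1, hlt⟩
  -- The bound at the endpoint, where the original solution is not defined, follows from left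
  -- continuity of the truncated one.
  · have hc : Tendsto (fun s => ‖a' s‖) (𝓝[<] t) (𝓝 ‖a' t‖) := by
      rw [← nhdsWithin_Ico_eq_nhdsLT hT]
      exact ((ha'.cont t ⟨hT.le, by linarith⟩).norm).mono
        (Ico_subset_Ico_right (by linarith))
    refine le_of_tendsto hc ?_
    filter_upwards [Ioo_mem_nhdsLT hT] with s hs using heq s ⟨hs.1.le, hs.2⟩

/-- The energy norm of a maximal mild solution tends to infinity. -/
lemma tendsto_norm_of_maximal {p : ℝ} (hp : 1 < p) {T : ℝ} (hT : 0 < T) {a : ℝ → L2R}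
    (ha : IsMild l (force l b (g p)) a₀ c₀ T a)
    (hmax : ∀ T' > T, ¬ ∃ a', IsMild l (force l b (g p)) a₀ c₀ T' a') :
    Tendsto (fun t => ‖a t‖ ^ 2 + ‖velocity l b p a₀ c₀ a t‖ ^ 2) (𝓝[<] T) atTop := by
  set c := velocity l b p a₀ c₀ a with hc
  set N : ℝ → ℝ := fun t => ‖a t‖ ^ 2 + ‖c t‖ ^ 2 with hN
  by_contra hnot
  rw [tendsto_atTop] at hnot
  push Not at hnot
  obtain ⟨R, hR⟩ := hnot
  have hR0 : 0 ≤ R := by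
    obtain ⟨t, ht⟩ := hR.exists
    exact (add_nonneg (sq_nonneg _) (sq_nonneg _)).trans ht.le
  obtain ⟨K, hK⟩ := (h.locNonl_force hp).bdd (R + 2)
  have hK0 : 0 ≤ K := (norm_nonneg _).trans (hK 0 (by rw [norm_zero]; linarith))
  -- L bounds the derivative of N = ‖a‖² + ‖c‖² as long as N ≤ R + 1.
  set L := 2 * K * (R + 2) with hL
  have hL0 : 0 ≤ L := by positivity
  -- A time with N(t₀) < R and less than 1/(L+1) before T, so that N cannot rise above R + 1 before
  -- T. The velocity is controlled too, and the bounded solution continues past T.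
  obtain ⟨t₀, ht₀R, ht₀⟩ := (hR.and_eventually (Ioo_mem_nhdsLT
    (max_lt hT (sub_lt_self T (by positivity : 0 < 1 / (L + 1)))))).exists
  have ht00 : 0 < t₀ := (le_max_left _ _).trans_lt ht₀.1
  have ht01 : T - 1 / (L + 1) < t₀ := (le_max_right _ _).trans_lt ht₀.1
  have hNc : ContinuousOn N (Ico 0 T) :=
    (ha.cont.norm.pow 2).add ((h.continuousOn_velocity hp ha).norm.pow 2)
  have htail : ∀ t ∈ Ico t₀ T, N t ≤ R + 1 := fun t ht => by
    have hB : ∀ s ∈ Icc t₀ t, R + (L + 1) * (s - t₀) ≤ R + 1 := fun s hs => by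
      have h1 : s - t₀ ≤ 1 / (L + 1) := by linarith [hs.2, ht.2]
      have h2 := mul_le_mul_of_nonneg_left h1 (by linarith : 0 ≤ L + 1)
      rw [mul_one_div_cancel (by linarith)] at h2
      linarith
    have := image_le_of_deriv_right_lt_deriv_boundary' (f := N)
      (f' := fun s => 2 * inner ℝ (force l b (g p) (a s)) (c s)) (a := t₀) (b := t)
      (hNc.mono fun x hx => ⟨ht00.le.trans hx.1, hx.2.trans_lt ht.2⟩)
      (fun x hx => (h.hasDerivAt_norm_sq_mild hp ha
        ⟨ht00.trans_le hx.1, hx.2.trans ht.2⟩).hasDerivWithinAt)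
      (B := fun s => R + (L + 1) * (s - t₀)) (B' := fun _ => L + 1) (by simpa using ht₀R.le)
      (by fun_prop) (fun x _ => by
        have : HasDerivAt (fun s : ℝ => R + (L + 1) * (s - t₀)) (L + 1) x := by
          simpa using (((hasDerivAt_id x).sub_const t₀).const_mul (L + 1)).const_add R
        exact this.hasDerivWithinAt)
      (fun x hx heq => by
        have h1 : N x ≤ R + 1 := heq.trans_le (hB x ⟨hx.1, hx.2.le⟩)
        have h2 : ‖a x‖ ≤ R + 2 := by
          refine abs_le_of_sq_le_sq' ?_ (by linarith) |>.2
          have := sq_nonneg ‖c x‖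
          simp only [hN] at h1
          nlinarith
        have h3 : ‖c x‖ ≤ R + 2 := by
          refine abs_le_of_sq_le_sq' ?_ (by linarith) |>.2
          have := sq_nonneg ‖a x‖
          simp only [hN] at h1
          nlinarith
        have h4 : (inner ℝ (force l b (g p) (a x)) (c x) : ℝ) ≤ K * (R + 2) :=
          (real_inner_le_norm _ _).trans (mul_le_mul (hK _ h2) h3 (norm_nonneg _) hK0)
        linarith) ⟨ht.1, le_rfl⟩
    exact this.trans (hB t ⟨ht.1, le_rfl⟩)
  obtain ⟨R₁, hR₁⟩ := (isCompact_Icc (a := (0 : ℝ)) (b := t₀)).exists_bound_of_continuousOn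
    (ha.cont.mono fun s hs => ⟨hs.1, hs.2.trans_lt ht₀.2⟩)
  refine (?_ : ¬ ∃ T' > T, ∃ a', IsMild l (force l b (g p)) a₀ c₀ T' a')
    (h.exists_continuation hp hT ha (R := max R₁ (R + 1)) fun t ht => ?_)
  · rintro ⟨T', hT', h'⟩
    exact hmax T' hT' h'
  · rcases le_or_gt t t₀ with h1 | h1
    · exact (hR₁ t ⟨ht.1, h1⟩).trans (le_max_left _ _)
    · refine le_trans ?_ (le_max_right _ _)
      have h2 := htail t ⟨h1.le, ht.2⟩
      refine abs_le_of_sq_le_sq' ?_ (by linarith) |>.2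
      have := sq_nonneg ‖c t‖
      simp only [hN] at h2
      nlinarith

/-- If there is no global mild solution, then the solution blows up in finite time. -/
lemma blowsUp_of_not_global {p : ℝ} (hp : 1 < p)
    (hng : ∀ a, ¬ ∀ T, IsMild l (force l b (g p)) a₀ c₀ T a) :
    BlowsUpInFiniteTime ρ r l b p (MM l b a₀) (NN b c₀) := by
  have hG := h.locNonl_force (p := p) hp
  set S : Set ℝ := {T | ∃ a, IsMild l (force l b (g p)) a₀ c₀ T a} with hS
  have hnall : ∃ T, T ∉ S := by
    -- Solutions on every interval [0, t + 1) would glue to a global one.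
    by_contra! hall
    choose f hf using hall
    refine hng (fun t => f (t + 1) t) fun T => ?_
    exact h.isMild_glue hG (τ := fun t => t + 1) (f := fun t => f (t + 1))
      (fun t _ => by linarith) fun t _ => hf (t + 1)
  obtain ⟨T₁, hT₁⟩ := hnall
  have hbdd : BddAbove S := ⟨T₁, fun T ⟨a, ha⟩ => by
    by_contra! hlt
    exact hT₁ ⟨a, ha.mono hlt.le⟩⟩
  obtain ⟨T₀, hT₀, hT₀S⟩ := h.exists_local hp a₀ c₀
  set T := sSup S with hTdef
  have hT : 0 < T := hT₀.trans_le (le_csSup hbdd hT₀S)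
  have hex : ∀ t, ∃ τ f, t ∈ Ico 0 T → t < τ ∧ IsMild l (force l b (g p)) a₀ c₀ τ f := fun t => by
    by_cases ht : t ∈ Ico 0 T
    · obtain ⟨τ, ⟨f, hf⟩, hτ⟩ := exists_lt_of_lt_csSup ⟨T₀, hT₀S⟩ ht.2
      exact ⟨τ, f, fun _ => ⟨hτ, hf⟩⟩
    · exact ⟨0, 0, fun H => absurd H ht⟩
  choose τ f hτf using hex
  have ha := h.isMild_glue hG (fun t ht => (hτf t ht).1) fun t ht => (hτf t ht).2
  set a : ℝ → L2R := fun t => f t t with hadef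
  refine ⟨T, fun t => MM l b (a t), fun t => NN b (velocity l b p a₀ c₀ a t), hT,
    h.isSolution_of_isMild hp hT ha, ?_, fun T' u' w' hT' hs => ?_⟩
  · have hN := h.tendsto_norm_of_maximal hp hT ha fun T' hT' hS' =>
      absurd (le_csSup hbdd (hS' : T' ∈ S)) (not_le.2 hT')
    obtain ⟨A, hA, hn⟩ := h.comparable_MInv.normH_equiv
    obtain ⟨A', hA', hn'⟩ := h.comparable_bInv.normH_equiv
    -- The Sobolev norms are equivalent to ‖a‖ and ‖c‖, so their sum is at least √(‖a‖² + ‖c‖²)/(A +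
    -- A').
    refine tendsto_atTop_mono (fun t => ?_)
      ((Real.tendsto_sqrt_atTop.comp hN).atTop_div_const (add_pos hA hA'))
    have h1 := (hn _ _ (h.isMul_MInv_MM (a t))).2
    have h2 := (hn' _ _ (h.isMul_bInv_NN (velocity l b p a₀ c₀ a t))).2
    have n1 : 0 ≤ normH (s₀ ρ r) (MM l b (a t)) := Real.sqrt_nonneg _
    have n2 : 0 ≤ normH (s₀ ρ r - ρ / 2) (NN b (velocity l b p a₀ c₀ a t)) := Real.sqrt_nonneg _
    rw [div_le_iff₀ (add_pos hA hA')]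
    refine Real.sqrt_le_iff.2 ⟨by positivity, ?_⟩
    have h3 : ‖a t‖ ^ 2 + ‖velocity l b p a₀ c₀ a t‖ ^ 2 ≤
        (‖a t‖ + ‖velocity l b p a₀ c₀ a t‖) ^ 2 := by
      have := mul_nonneg (norm_nonneg (a t)) (norm_nonneg (velocity l b p a₀ c₀ a t))
      linarith [add_sq ‖a t‖ ‖velocity l b p a₀ c₀ a t‖]
    refine h3.trans (pow_le_pow_left₀ (by positivity) ?_ 2)
    have m1 := mul_nonneg hA'.le n1
    have m2 := mul_nonneg hA.le n2
    linarith
  -- Any distributional solution is mild, so its lifetime belongs to S and uniqueness of mild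
  -- solutions identifies it.
  · obtain ⟨a', ha', huw⟩ := h.isMild_of_isSolution hp hT' hs
    have hle : T' ≤ T := le_csSup hbdd ⟨a', ha'⟩
    have heq : ∀ t ∈ Ico 0 T', a' t = a t := fun t ht =>
      h.isMild_unique hG ha' (ha.mono hle) ht
    refine ⟨hle, fun t ht => ⟨by rw [(huw t ht).1, heq t ht], ?_⟩⟩
    rw [(huw t ht).2]
    refine congrArg (NN b) ?_
    exact solC_congr ht.1 fun s hs => by rw [heq s ⟨hs.1, hs.2.trans_lt ht.2⟩]

end Admissible

end

end NonlocalWave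

theorem theorem3p5 (ρ r : ℝ) (hρ : 0 ≤ ρ) (hr : 0 ≤ r) (hρr : 1 ≤ r + ρ / 2)
    (hne : (ρ, r) ≠ (0, 1)) (l b : ℝ → ℝ) (hl : NonlocalWave.IsEllipticSymbol ρ l)
    (hb : NonlocalWave.IsEllipticSymbol (-r) b) (p : ℝ) (hp : 1 < p)
    (u₀ w₀ v₀ : NonlocalWave.L2R)
    (hdata : (u₀, w₀) ∈ NonlocalWave.SigmaMinus ρ r l b p)
    (hv : NonlocalWave.IsWeakDeriv v₀ u₀) :
    NonlocalWave.BlowsUpInFiniteTime ρ r l b p u₀ w₀ := by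
  -- r + ρ/2 ≥ 1 gives r + ρ ≥ 1, with equality only at ρ = 0, r = 1, the excluded pair.
  have hemb : 1 < r + ρ := by
    rcases hρ.eq_or_lt with rfl | hρ'
    · refine lt_of_le_of_ne (by linarith) fun he => hne ?_
      rw [add_zero] at he
      rw [he]
    · linarith
  have h : NonlocalWave.Admissible ρ r l b := ⟨hρ, hr, hρr, hemb, hl, hb⟩
  obtain ⟨hu, hw, hE, hK⟩ := hdata
  simp only at hu hw hE hK
  obtain ⟨a₀, rfl⟩ := h.exists_MM_eq hu
  obtain ⟨c₀, rfl⟩ := h.exists_NN_eq hw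
  rw [h.two_mul_I, sub_neg] at hK
  obtain ⟨q₀, hq₀⟩ := h.exists_primitive hv.isMul
  exact h.blowsUp_of_not_global hp fun a ha => h.not_global hp hE hK hq₀ ha
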